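/- **Conventions.** $\mathbb S=\{q\in\mathbb H: q^2=-1\}$, $\mathbb C_J=\mathbb R+J\mathbb R$, $\mathbb S_{x+Iy}=x+\mathbb Sy$. An axially symmetric domain is a nonempty connected open set that contains $\mathbb S_p$ for each of its points $p$; it is *basic* if the connected components of $\Omega\cap\mathbb C_J$ are simply connected for all $J\in\mathbb S$. A function $f$ is slice regular on $\Omega$ ($f\in\mathcal{SR}(\Omega)$) if $f(x+Jy)=A(x+iy)+JB(x+iy)$ for all $J\in\mathbb S$, where $F=A+\iota B$ is holomorphic with values in $\mathbb H\otimes_{\mathbb R}\mathbb C$ and $F(\bar z)=\overline{F(z)}$ (the bar being $a+\iota b\mapsto a-\iota b$); $f*g$ is the function induced by the product of the two stem functions, and $\exp_*f=\sum_k f^{*k}/k!$. $\mathcal{SR}_{\mathbb R}(\Omega)$ denotes the slice-preserving ones ($f(\Omega\cap\mathbb C_J)\subset\mathbb C_J$ for all $J$). Write $f=f_0+f_1i+f_2j+f_3k$ with $f_l\in\mathcal{SR}_{\mathbb R}$, $f_v=f-f_0$, $f^s=\sum_{l=0}^3 f_l^2$; $f$ is vectorial if $f=f_v$. Vectorial $f,h$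 are equivalent at $p$ if $af+bh=0$ on some axially symmetric domain $V\ni p$ for some $a,b\in\mathcal{SR}_{\mathbb R}(V)$, not both identically zero. $\mathcal{SR}_{[g_v]}(U)$ is the set of $f\in\mathcal{SR}(U)$ with $f_v$ equivalent to $g_v$ at every point of $U$ and, if $g_v\equiv0$ on $U$, with $f_v\equiv0$ (so that $\mathcal{SR}_{[0]}=\mathcal{SR}_{\mathbb R}$). If $g_v\not\equiv0$, $Z([g_v])$ is the union of the zero sets of the minimal representatives of $[g_v]$, i.e. of the vectorial $w$ on axially symmetric open $U\subset\Omega$ that are equivalent to $g_v$ at every point and vanish identically on no sphere $\mathbb S_p\subset U$ (including $\mathbb S_p=\{p\}$ for real $p$); $Z([0])=\varnothing$. $\mathcal I(x+Iy)=I$ for $y>0$. $\log_0(q)=\log|q|+\mathcal I(q)\arg q$ is the principal logarithm on $\mathbb H\setminus(-\infty,0]$, and $\sqrt{q}=\exp(\frac12\log_0 q)$ there; $\mu(q)=\sum_m\frac{(-1)^mq^m}{(2m)!}$, $\nu(q)=\sum_m\frac{(-1)^mq^m}{(2m+1)!}$, and $\mu_0^{-1}$ is the inverse of the restriction of $\mu$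 to $M_0=\{q^2:0\le\operatorname{Re}q<\pi\}$. For $h\in\mathcal{SR}_{\mathbb R}$ nonvanishing, $n\in\mathbb Z$, put $L_n(h)=\log_0\big((-1)^nh\big)+n\pi\mathcal I$; call $n$ *admissible for $h$ at $z_0$* if $n$ is odd when $h(z_0)\in(-\infty,0)$ and even otherwise. Whenever $L_n(h)$ is used below on a set $U$, it is part of the claim that $(-1)^nh$ avoids $(-\infty,0]$ on $U$. **Theorem.** Let $\Omega$ be a basic domain, $g\in\mathcal{SR}(\Omega)$ nonvanishing on $\Omega$ and $z_0\in\Omega$. Below, $U$ always denotes a basic domain with $z_0\in U\subset\Omega$. **General.** There are $U$ and $f\in\mathcal{SR}(U)$ with $\exp_*f=g$ on $U$. There are $U$ and $f\in\mathcal{SR}_{[g_v]}(U)$ with $\exp_*f=g$ on $U$ if and only if it does not happen that $g$ is slice preserving, $z_0\in\mathbb R$ and $g(z_0)\notin(0,\infty)$. **Case 1: $g\in\mathcal{SR}_{\mathbb R}(\Omega)$.** (a) If $V\subset\Omega$ is an axially symmetric domain and $f\in\mathcal{SR}_{\mathbb R}(V)$ satisfies $\exp_*f=g$ on $V$, then $g(V\cap\mathbb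 R)\subset(0,\infty)$. (b) If $z_0\notin\mathbb R$, there is $U$ with $U\cap\mathbb R=\varnothing$ such that the $f\in\mathcal{SR}_{\mathbb R}(U)$ with $\exp_*f=g$ on $U$ are exactly the functions $L_n(g)$, $n$ admissible for $g$ at $z_0$. (c) If $z_0\in\mathbb R$ and $g(z_0)>0$, there is $U$ such that $g(U)\cap(-\infty,0]=\varnothing$ and $\log_0\circ g$ is the only $f\in\mathcal{SR}_{\mathbb R}(U)$ with $\exp_*f=g$ on $U$. (d) If $z_0\in\mathbb R$ and $g(z_0)<0$, there is $U$ such that $-g$ avoids $(-\infty,0]$ on $U$ and, for every axially symmetric domain $V\subset U$, every vectorial slice-regular $w$ on $V$ with $w^s=1$ and every $n\in\mathbb Z$, $f=\log_0\circ(-g)+(2n+1)\pi w\in\mathcal{SR}_{[w]}(V)$ and $\exp_*f=g$ on $V$. **Case 2: $g_v\not\equiv0$, $g_v^s\equiv0$ on $\Omega$.** Then $\Omega\cap\mathbb R=\varnothing$, $g_0$ has no zero in $\Omega$, and there is $U$ such that the $f\in\mathcal{SR}(U)$ with $\exp_*f=g$ on $U$ are exactly the functions $L_n(g_0)+g_v/g_0$,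 $n$ admissible for $g_0$ at $z_0$; these all lie in $\mathcal{SR}_{[g_v]}(U)$. **Case 3: $g_v\not\equiv0$ and $Z([g_v])\cap\mathbb S_{z_0}=\varnothing$.** There are $U$ (with $U\cap\mathbb R=\varnothing$ if $z_0\notin\mathbb R$), functions $r=\sqrt{g^s}$, $s=\sqrt{g_v^s}$, $\varphi$ in $\mathcal{SR}_{\mathbb R}(U)$ and a vectorial slice-regular $w$ on $U$ such that on $U$: $r\neq0$, $r^2=g^s$, $s^2=g_v^s$, $w^s=1$, $g_v=sw$ (i.e. $w=g_v/\sqrt{g_v^s}$), $\cos\varphi=g_0/r$, $\sin\varphi=s/r$, and - if $z_0\in\mathbb R$: $r(U\cap\mathbb R)\subset(0,\infty)$, $r(U)\cap(-\infty,0]=\varnothing$, and for every $n\in\mathbb Z$ the function $f=\log_0\circ r+(\varphi+2n\pi)w$ lies in $\mathcal{SR}_{[g_v]}(U)$ and satisfies $\exp_*f=g$ on $U$; - if $z_0\notin\mathbb R$: for every $k$ admissible for $r$ at $z_0$ and all $m,n\in\mathbb Z$ with $m+n$ even, $f=L_k(r)+m\pi\mathcal I+(\varphi+n\pi)w$ lies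 in $\mathcal{SR}_{[g_v]}(U)$ and satisfies $\exp_*f=g$ on $U$. **Case 4: $z_0\in\mathbb S_p$ for some $p\in Z([g_v])$.** Then $z_0\notin\mathbb R$ and there is $U$ with $U\cap\mathbb R=\varnothing$ on which $g_0$ has no zero and $1+g_v^s/g_0^2$ avoids $(-\infty,0]$, such that, with $\rho=\sqrt{1+g_v^s/g_0^2}$ (principal root), $r=g_0\rho$, $F=\mu_0^{-1}(1/\rho)$: $r,F\in\mathcal{SR}_{\mathbb R}(U)$; on $U$, $r\ne0$, $r^2=g^s$, $F\in M_0$, $\mu(F)=g_0/r$, $\nu(F)\neq0$; on $\mathbb S_{z_0}$, $r=g_0$ and $F=0$; and for every $n$ admissible for $r$ at $z_0$ the function $$f=L_n(r)+\frac{g_v}{\nu(F)\,r}$$ lies in $\mathcal{SR}_{[g_v]}(U)$ and satisfies $\exp_*f=g$ on $U$. -/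

import Mathlib

open scoped Quaternion

noncomputable section

namespace StarLog

/-! ### Quaternions, slices, axially symmetric and basic domains -/

/-- The 2-sphere of imaginary units. -/
def unitSphere : Set ℍ[ℝ] := {J | J ^ 2 = -1}

/-- The real axis in the quaternions. -/
def realAxis : Set ℍ[ℝ] := Set.range (fun t : ℝ => (t : ℍ[ℝ]))

/-- The identification of the complex plane with the slice `ℝ + Jℝ`. -/
def sliceEmb (J : ℍ[ℝ]) (z : ℂ) : ℍ[ℝ] := (z.re : ℍ[ℝ]) + J * (z.im : ℍ[ℝ])

/-- The slice `ℝ + Jℝ`. -/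
def slicePlane (J : ℍ[ℝ]) : Set ℍ[ℝ] := Set.range (sliceEmb J)

/-- The intersection of `Ω` with the slice of `J`, read in the complex plane. -/
def sliceSection (Ω : Set ℍ[ℝ]) (J : ℍ[ℝ]) : Set ℂ := {z | sliceEmb J z ∈ Ω}

/-- The sphere `x + 𝕊 y` through `p = x + I y` (the singleton `{p}` when `p` is real). -/
def sphereThrough (p : ℍ[ℝ]) : Set ℍ[ℝ] := {q | q.re = p.re ∧ ‖q.im‖ = ‖p.im‖}

/-- Axial symmetry of a set. -/
def IsAxiallySymmetric (Ω : Set ℍ[ℝ]) : Prop :=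
  ∀ z : ℂ, ∀ I ∈ unitSphere, sliceEmb I z ∈ Ω → ∀ J ∈ unitSphere, sliceEmb J z ∈ Ω

/-- Axially symmetric domains: nonempty, open, connected, axially symmetric. -/
def IsAxSymDomain (Ω : Set ℍ[ℝ]) : Prop :=
  IsOpen Ω ∧ IsConnected Ω ∧ IsAxiallySymmetric Ω

/-- Basic domains: axially symmetric domains, all connected components of whose intersections
with the slices are simply connected. -/
def IsBasicDomain (Ω : Set ℍ[ℝ]) : Prop :=
  IsAxSymDomain Ω ∧ ∀ J ∈ unitSphere, ∀ z ∈ sliceSection Ω J,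
    IsSimplyConnected (connectedComponentIn (sliceSection Ω J) z)

/-- `U` is a basic neighbourhood of `z₀` contained in `Ω`. -/
def IsBasicNhd (U : Set ℍ[ℝ]) (z₀ : ℍ[ℝ]) (Ω : Set ℍ[ℝ]) : Prop :=
  IsBasicDomain U ∧ z₀ ∈ U ∧ U ⊆ Ω

/-- The imaginary unit function: `I` at `x + I y` with `y > 0`. It is only meaningful off the
real axis (here it is given the value `0` on the real axis). -/
def imUnit (q : ℍ[ℝ]) : ℍ[ℝ] := ‖q.im‖⁻¹ • q.im

/-! ### Stem functions and slice regular functions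

The complexification `ℍ + ι ℍ` is `ℍ[ℂ]`, the quaternions with complex coefficients. -/

/-- The part `a` of `a + ι b`. -/
def stemRe (Z : ℍ[ℂ]) : ℍ[ℝ] := ⟨Z.re.re, Z.imI.re, Z.imJ.re, Z.imK.re⟩

/-- The part `b` of `a + ι b`. -/
def stemIm (Z : ℍ[ℂ]) : ℍ[ℝ] := ⟨Z.re.im, Z.imI.im, Z.imJ.im, Z.imK.im⟩

/-- The map `a + ι b ↦ a + J b` from `ℍ[ℂ]` to `ℍ[ℝ]`. -/
def phi (J : ℍ[ℝ]) (Z : ℍ[ℂ]) : ℍ[ℝ] := stemRe Z + J * stemIm Z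

/-- The involution `a + ι b ↦ a - ι b` of `ℍ[ℂ]`. -/
def iotaConj (Z : ℍ[ℂ]) : ℍ[ℂ] :=
  ⟨(starRingEnd ℂ) Z.re, (starRingEnd ℂ) Z.imI, (starRingEnd ℂ) Z.imJ, (starRingEnd ℂ) Z.imK⟩

/-- `Ω` intersected with the complex plane `ℝ + iℝ`. -/
def planeSection (Ω : Set ℍ[ℝ]) : Set ℂ := {z | (z : ℍ[ℝ]) ∈ Ω}

/-- `F` is a stem function on `D`. -/
def IsStem (F : ℂ → ℍ[ℂ]) (D : Set ℂ) : Prop :=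
  ∀ z ∈ D, F ((starRingEnd ℂ) z) = iotaConj (F z)

/-- Holomorphy of an `ℍ[ℂ]`-valued function (with respect to the complex structure `ι`). -/
def IsHolomorphic (F : ℂ → ℍ[ℂ]) (D : Set ℂ) : Prop :=
  DifferentiableOn ℂ (fun z => (F z).re) D ∧ DifferentiableOn ℂ (fun z => (F z).imI) D ∧
  DifferentiableOn ℂ (fun z => (F z).imJ) D ∧ DifferentiableOn ℂ (fun z => (F z).imK) D

/-- `f` is induced on `Ω` by the stem function `F`. -/
def IsInducedBy (f : ℍ[ℝ] → ℍ[ℝ]) (F : ℂ → ℍ[ℂ]) (Ω : Set ℍ[ℝ]) : Prop :=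
  ∀ J ∈ unitSphere, ∀ z ∈ planeSection Ω, f (sliceEmb J z) = phi J (F z)

/-- Slice regular functions on an axially symmetric open set `Ω`. -/
def SR (f : ℍ[ℝ] → ℍ[ℝ]) (Ω : Set ℍ[ℝ]) : Prop :=
  ∃ F : ℂ → ℍ[ℂ], IsStem F (planeSection Ω) ∧ IsHolomorphic F (planeSection Ω) ∧
    IsInducedBy f F Ω

/-- Slice regular, slice preserving functions on `Ω`. -/
def SRR (f : ℍ[ℝ] → ℍ[ℝ]) (Ω : Set ℍ[ℝ]) : Prop :=
  SR f Ω ∧ ∀ I ∈ unitSphere, ∀ q ∈ Ω, q ∈ slicePlane I → f q ∈ slicePlane I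

/-- The slice function induced by a stem function `F`, at `q = x + I y` with `y ≥ 0`. -/
def sliceOf (F : ℂ → ℍ[ℂ]) (q : ℍ[ℝ]) : ℍ[ℝ] := phi (imUnit q) (F ⟨q.re, ‖q.im‖⟩)

/-- The stem function of a slice function `f`: with `i` the first standard imaginary unit,
`F(z) = (f(z) + f(z̄))/2 + ι (i (f(z̄) - f(z))/2)` for `z` in the plane `ℝ + iℝ`. -/
def stemOf (f : ℍ[ℝ] → ℍ[ℝ]) (z : ℂ) : ℍ[ℂ] :=
  let a : ℍ[ℝ] := (2 : ℝ)⁻¹ • (f (z : ℍ[ℝ]) + f (((starRingEnd ℂ) z : ℂ) : ℍ[ℝ]))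
  let b : ℍ[ℝ] := (2 : ℝ)⁻¹ •
    ((Complex.I : ℍ[ℝ]) * (f (((starRingEnd ℂ) z : ℂ) : ℍ[ℝ]) - f (z : ℍ[ℝ])))
  ⟨⟨a.re, b.re⟩, ⟨a.imI, b.imI⟩, ⟨a.imJ, b.imJ⟩, ⟨a.imK, b.imK⟩⟩

/-- The `*`-product: the slice function induced by the product of the stem functions. -/
def starMul (f g : ℍ[ℝ] → ℍ[ℝ]) : ℍ[ℝ] → ℍ[ℝ] := sliceOf (fun z => stemOf f z * stemOf g z)

/-- The `*`-powers. -/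
def starPow (f : ℍ[ℝ] → ℍ[ℝ]) : ℕ → ℍ[ℝ] → ℍ[ℝ]
  | 0 => fun _ => 1
  | k + 1 => starMul f (starPow f k)

/-- `exp_* f = g` on `U`, where `exp_* f = ∑ f^{*k} / k!`. -/
def StarExpEq (f g : ℍ[ℝ] → ℍ[ℝ]) (U : Set ℍ[ℝ]) : Prop :=
  ∀ q ∈ U, HasSum (fun k : ℕ => ((k.factorial : ℝ)⁻¹) • starPow f k q) (g q)

/-! ### Scalar and vectorial part, symmetrization

`f = f₀ + f₁ i + f₂ j + f₃ k` with slice preserving `f₀, f₁, f₂, f₃`. -/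

/-- The scalar part `f₀`. -/
def scalarPart (f : ℍ[ℝ] → ℍ[ℝ]) : ℍ[ℝ] → ℍ[ℝ] := sliceOf (fun z => ⟨(stemOf f z).re, 0, 0, 0⟩)

/-- The component `f₁`. -/
def compI (f : ℍ[ℝ] → ℍ[ℝ]) : ℍ[ℝ] → ℍ[ℝ] := sliceOf (fun z => ⟨(stemOf f z).imI, 0, 0, 0⟩)

/-- The component `f₂`. -/
def compJ (f : ℍ[ℝ] → ℍ[ℝ]) : ℍ[ℝ] → ℍ[ℝ] := sliceOf (fun z => ⟨(stemOf f z).imJ, 0, 0, 0⟩)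

/-- The component `f₃`. -/
def compK (f : ℍ[ℝ] → ℍ[ℝ]) : ℍ[ℝ] → ℍ[ℝ] := sliceOf (fun z => ⟨(stemOf f z).imK, 0, 0, 0⟩)

/-- The vectorial part `f_v = f - f₀`. -/
def vecPart (f : ℍ[ℝ] → ℍ[ℝ]) (q : ℍ[ℝ]) : ℍ[ℝ] := f q - scalarPart f q

/-- The symmetrization `f^s = f₀² + f₁² + f₂² + f₃²`. -/
def symmetrization (f : ℍ[ℝ] → ℍ[ℝ]) (q : ℍ[ℝ]) : ℍ[ℝ] :=
  scalarPart f q ^ 2 + compI f q ^ 2 + compJ f q ^ 2 + compK f q ^ 2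

/-- Vectorial slice regular functions on `Ω`. -/
def SRV (f : ℍ[ℝ] → ℍ[ℝ]) (Ω : Set ℍ[ℝ]) : Prop := SR f Ω ∧ Set.EqOn f (vecPart f) Ω

/-! ### Vectorial classes and their zero sets -/

/-- Linear dependence over the slice preserving regular functions on a domain `V`. -/
def LinDep (f g : ℍ[ℝ] → ℍ[ℝ]) (V : Set ℍ[ℝ]) : Prop :=
  ∃ a b : ℍ[ℝ] → ℍ[ℝ], SRR a V ∧ SRR b V ∧ ((∃ q ∈ V, a q ≠ 0) ∨ (∃ q ∈ V, b q ≠ 0)) ∧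
    ∀ q ∈ V, a q * f q + b q * g q = 0

/-- `f ∼_p g`, for vectorial functions `f`, `g` given on `U`. -/
def EquivAt (p : ℍ[ℝ]) (U : Set ℍ[ℝ]) (f g : ℍ[ℝ] → ℍ[ℝ]) : Prop :=
  ∃ V, IsAxSymDomain V ∧ p ∈ V ∧ V ⊆ U ∧ LinDep f g V

/-- `f` belongs to `SR_ω(U)` for the class `ω = [g_v]` on `U`. For `ω = [0]` this set is by
convention that of the slice preserving functions, i.e. `f_v` has to vanish. -/
def SRClass (f g : ℍ[ℝ] → ℍ[ℝ]) (U : Set ℍ[ℝ]) : Prop :=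
  SR f U ∧ ((∀ q ∈ U, vecPart g q = 0) → ∀ q ∈ U, vecPart f q = 0) ∧
    ∀ p ∈ U, EquivAt p U (vecPart f) (vecPart g)

/-- `w` is a minimal representative on `U` of the class `[g_v]`: it has neither real nor
spherical zeroes, that is, it vanishes identically on no sphere `x + 𝕊 y` (`y ≥ 0`) in `U`. -/
def IsMinimalRep (w g : ℍ[ℝ] → ℍ[ℝ]) (U : Set ℍ[ℝ]) : Prop :=
  SRV w U ∧ (∀ p ∈ U, EquivAt p U w (vecPart g)) ∧ ∀ p ∈ U, ∃ q ∈ sphereThrough p, w q ≠ 0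

/-- The zero set `Z([g_v])` of the class of `g_v` on `Ω`; it is empty for the class `[0]`. -/
def classZeros (g : ℍ[ℝ] → ℍ[ℝ]) (Ω : Set ℍ[ℝ]) : Set ℍ[ℝ] :=
  {q | (∃ p ∈ Ω, vecPart g p ≠ 0) ∧
    ∃ (U : Set ℍ[ℝ]) (w : ℍ[ℝ] → ℍ[ℝ]), IsOpen U ∧ IsAxiallySymmetric U ∧ U ⊆ Ω ∧
      IsMinimalRep w g U ∧ q ∈ U ∧ w q = 0}

/-! ### Elementary functions of one quaternionic variable -/

/-- The half line `(-∞, 0]`. -/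
def nonposRay : Set ℍ[ℝ] := (fun t : ℝ => (t : ℍ[ℝ])) '' Set.Iic 0

/-- The half line `(-∞, 0)`. -/
def negRay : Set ℍ[ℝ] := (fun t : ℝ => (t : ℍ[ℝ])) '' Set.Iio 0

/-- The half line `(0, +∞)`. -/
def posRay : Set ℍ[ℝ] := (fun t : ℝ => (t : ℍ[ℝ])) '' Set.Ioi 0

/-- The principal logarithm `log |q| + I arg q` on `ℍ ∖ (-∞, 0]`, with `arg q ∈ [0, π)` the
argument in the slice of `I`, the imaginary unit of `q`. -/
def qlog (q : ℍ[ℝ]) : ℍ[ℝ] :=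
  ((Real.log ‖q‖ : ℝ) : ℍ[ℝ]) + Complex.arg ⟨q.re, ‖q.im‖⟩ • imUnit q

/-- The principal square root on `ℍ ∖ (-∞, 0]`. -/
def qsqrt (q : ℍ[ℝ]) : ℍ[ℝ] := NormedSpace.exp ((2 : ℝ)⁻¹ • qlog q)

/-- The quaternionic cosine. -/
def qcos (q : ℍ[ℝ]) : ℍ[ℝ] := ∑' m : ℕ, ((-1 : ℝ) ^ m / ((2 * m).factorial : ℝ)) • q ^ (2 * m)

/-- The quaternionic sine. -/
def qsin (q : ℍ[ℝ]) : ℍ[ℝ] :=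
  ∑' m : ℕ, ((-1 : ℝ) ^ m / ((2 * m + 1).factorial : ℝ)) • q ^ (2 * m + 1)

/-- `μ(q) = ∑ (-1)^m q^m / (2m)!`, so that `μ(q²) = cos q`. -/
def qmu (q : ℍ[ℝ]) : ℍ[ℝ] := ∑' m : ℕ, ((-1 : ℝ) ^ m / ((2 * m).factorial : ℝ)) • q ^ m

/-- `ν(q) = ∑ (-1)^m q^m / (2m+1)!`, so that `ν(q²) = sin q / q`. -/
def qnu (q : ℍ[ℝ]) : ℍ[ℝ] := ∑' m : ℕ, ((-1 : ℝ) ^ m / ((2 * m + 1).factorial : ℝ)) • q ^ m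

/-- The domain `M₀ = {q² : 0 ≤ Re q < π}`, mapped bijectively by `μ` onto `ℍ ∖ (-∞, -1]`. -/
def muDom : Set ℍ[ℝ] := (fun q => q ^ 2) '' {q | 0 ≤ q.re ∧ q.re < Real.pi}

/-- The principal inverse branch of `μ`, i.e. the inverse of its restriction to `M₀`. -/
def muInv : ℍ[ℝ] → ℍ[ℝ] := Function.invFunOn qmu muDom

/-- The branch `log_0((-1)^n h) + n π I` of the logarithm of a slice preserving `h`. -/
def logBranch (n : ℤ) (h : ℍ[ℝ] → ℍ[ℝ]) (q : ℍ[ℝ]) : ℍ[ℝ] :=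
  qlog ((-1 : ℝ) ^ n • h q) + ((n : ℝ) * Real.pi) • imUnit q

/-- The indices `n` to be used near `z₀` for the slice preserving nonvanishing function `h`:
the odd ones if `h(z₀) ∈ (-∞, 0)`, the even ones otherwise. -/
def BranchIndex (h : ℍ[ℝ] → ℍ[ℝ]) (z₀ : ℍ[ℝ]) (n : ℤ) : Prop := Odd n ↔ h z₀ ∈ negRay

/-- `(-1)^n h` avoids `(-∞, 0]` on `U`, so that the branch of index `n` is really formed with the
principal logarithm there. -/
def BranchDefined (n : ℤ) (h : ℍ[ℝ] → ℍ[ℝ]) (U : Set ℍ[ℝ]) : Prop :=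
  ∀ q ∈ U, (-1 : ℝ) ^ n • h q ∉ nonposRay

end StarLog

end

open StarLog

namespace StarLog

open ComplexConjugate Filter Topology

/-! ### Slices and the maps `phi J` -/

/-! A slice function carries the same information as its stem function with values in `ℍ[ℂ]`, and
there the `*`-product is the pointwise product. Write Z = a + V with V vectorial and n for
`Quaternion.normSq`. Then V² = -n(V) is a central complex number, so the exponential series sums to
`expQ Z` = e^a (μ(n(V)) + ν(n(V)) V), where μ(σ²) = cos σ and ν(σ²) σ = sin σ. Thus exp_* f = g
becomes the pointwise equation `expQ (F z) = G z` (`starExpEq_iff`), and slice preserving functions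
are exactly those with complex scalar stems (`SRR_iff`).

Conjugation symmetry leaves only the closed upper half plane, where the sphere of z₀ is the single
point a = `up z₀`. An analytic germ at a, symmetric under conjugation when a is real, extends by
reflection to a tube around the sphere, and small tubes are basic domains (`isBasicDomain_tube`,
`differentiableOn_symmExt`). The problem is therefore local at a.

For scalar g one solves e^h = k in the complex plane. Two solutions differ by a function with values
in 2πiℤ, which is constant (`exists_int_of_exp_eq`). At real points stems are real, so g must be
positive there; where g is negative, the missing sign comes from exp((2n+1)πw) = -1 with n(w) = 1.

If n(G_v) vanishes identically then μ = ν = 1 at n(G_v/g₀), and g = g₀(1 + g_v/g₀) is already an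
exponential. Conversely n(F_v) is forced to be constant, hence zero (`isotropic_case`).

Otherwise the common power of z - a is divided out of G_v, leaving a vector that does not vanish at
a. Either this vector is isotropic at a, which produces a zero of the class on the sphere
(`normSq_germ_ne_zero`), or it can be normalized to w with n(w) = 1. In the latter case g = r(cos φ
+ sin φ w), and a logarithm is log r + φw (`polar_case`).

At a zero of the class G_v is isotropic (`isotropic_of_mem_classZeros`), although the direction w no
longer exists. But then g₀ ≠ 0 and g₀/r is close to 1, where μ is locally invertible; n(F_v) =
μ⁻¹(g₀/r) replaces the square of the angle (`zero_case`). -/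

theorem mem_unitSphere_iff {J : ℍ[ℝ]} :
    J ∈ unitSphere ↔ J.re = 0 ∧ J.imI ^ 2 + J.imJ ^ 2 + J.imK ^ 2 = 1 := by
  simp only [unitSphere, Set.mem_ofPred_eq, Quaternion.ext_iff, pow_two]
  simp
  constructor
  · rintro ⟨h1, h2, h3, h4⟩
    have h0 : J.re = 0 := by
      -- The imaginary components of J² are twice the real part times those of J; a nonzero real
      -- part would make J real with square -1.
      by_contra h
      have e2 : J.imI = 0 := by
        have : J.re * J.imI = 0 := by linarith
        simpa [h] using this
      have e3 : J.imJ = 0 := by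
        have : J.re * J.imJ = 0 := by linarith
        simpa [h] using this
      have e4 : J.imK = 0 := by
        have : J.re * J.imK = 0 := by linarith
        simpa [h] using this
      rw [e2, e3, e4] at h1
      nlinarith [mul_self_nonneg J.re]
    refine ⟨h0, ?_⟩
    rw [h0] at h1
    linarith
  · rintro ⟨h0, h1⟩
    refine ⟨?_, ?_, ?_, ?_⟩ <;> rw [h0] <;> linarith

theorem mul_self_of_mem {J : ℍ[ℝ]} (hJ : J ∈ unitSphere) : J * J = -1 := by
  rw [← pow_two]; exact hJ

theorem neg_mem_unitSphere {J : ℍ[ℝ]} (hJ : J ∈ unitSphere) : -J ∈ unitSphere := by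
  simpa [unitSphere] using hJ

theorem coeI_mem : ((Complex.I : ℂ) : ℍ[ℝ]) ∈ unitSphere := by
  simp [mem_unitSphere_iff]

/-- The second standard imaginary unit. -/
def unitJ : ℍ[ℝ] := ⟨0, 0, 1, 0⟩

@[simp] theorem unitJ_re : unitJ.re = 0 := rfl
@[simp] theorem unitJ_imI : unitJ.imI = 0 := rfl
@[simp] theorem unitJ_imJ : unitJ.imJ = 1 := rfl
@[simp] theorem unitJ_imK : unitJ.imK = 0 := rfl

theorem unitJ_mem : unitJ ∈ unitSphere :=
  mem_unitSphere_iff.2 ⟨rfl, show (0 : ℝ) ^ 2 + 1 ^ 2 + 0 ^ 2 = 1 by norm_num⟩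

theorem norm_of_mem {J : ℍ[ℝ]} (hJ : J ∈ unitSphere) : ‖J‖ = 1 := by
  have h := mem_unitSphere_iff.1 hJ
  have h2 := Quaternion.normSq_eq_norm_mul_self J
  rw [Quaternion.normSq_def', h.1] at h2
  nlinarith [norm_nonneg J]

/-- The embedding of the slice of `J` as an algebra homomorphism. -/
noncomputable def embHom (J : ℍ[ℝ]) (hJ : J ∈ unitSphere) : ℂ →ₐ[ℝ] ℍ[ℝ] :=
  Complex.lift ⟨J, mul_self_of_mem hJ⟩

theorem embHom_apply {J : ℍ[ℝ]} (hJ : J ∈ unitSphere) (z : ℂ) : embHom J hJ z = sliceEmb J z := by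
  simp only [embHom, Complex.lift_apply, Complex.liftAux_apply, sliceEmb]
  congr 1
  rw [Quaternion.mul_coe_eq_smul]

theorem sliceEmb_add (J : ℍ[ℝ]) (z w : ℂ) : sliceEmb J (z + w) = sliceEmb J z + sliceEmb J w := by
  simp only [sliceEmb, Complex.add_re, Complex.add_im, Quaternion.coe_add, mul_add]
  abel

theorem sliceEmb_mul {J : ℍ[ℝ]} (hJ : J ∈ unitSphere) (z w : ℂ) :
    sliceEmb J (z * w) = sliceEmb J z * sliceEmb J w := by
  simp only [← embHom_apply hJ, map_mul]

theorem sliceEmb_inv {J : ℍ[ℝ]} (hJ : J ∈ unitSphere) (z : ℂ) :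
    sliceEmb J z⁻¹ = (sliceEmb J z)⁻¹ := by
  simp only [← embHom_apply hJ, map_inv₀]

theorem sliceEmb_pow {J : ℍ[ℝ]} (hJ : J ∈ unitSphere) (z : ℂ) (n : ℕ) :
    sliceEmb J (z ^ n) = sliceEmb J z ^ n := by
  simp only [← embHom_apply hJ, map_pow]

theorem sliceEmb_neg (J : ℍ[ℝ]) (z : ℂ) : sliceEmb J (-z) = -sliceEmb J z := by
  simp only [sliceEmb, Complex.neg_re, Complex.neg_im, Quaternion.coe_neg, mul_neg]
  abel

theorem sliceEmb_smul (J : ℍ[ℝ]) (r : ℝ) (z : ℂ) : sliceEmb J (r • z) = r • sliceEmb J z := by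
  ext <;> simp [sliceEmb] <;> ring

@[simp] theorem sliceEmb_ofReal (J : ℍ[ℝ]) (r : ℝ) : sliceEmb J (r : ℂ) = (r : ℍ[ℝ]) := by
  simp [sliceEmb]

@[simp] theorem sliceEmb_zero (J : ℍ[ℝ]) : sliceEmb J 0 = 0 := by simp [sliceEmb]

@[simp] theorem sliceEmb_one (J : ℍ[ℝ]) : sliceEmb J 1 = 1 := by simp [sliceEmb]

theorem sliceEmb_coeI (z : ℂ) : sliceEmb ((Complex.I : ℂ) : ℍ[ℝ]) z = (z : ℍ[ℝ]) := by
  ext <;> simp [sliceEmb]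

theorem sliceEmb_neg_left (J : ℍ[ℝ]) (z : ℂ) : sliceEmb (-J) z = sliceEmb J (conj z) := by
  simp [sliceEmb]

theorem sliceEmb_re {J : ℍ[ℝ]} (hJ : J ∈ unitSphere) (z : ℂ) : (sliceEmb J z).re = z.re := by
  simp [sliceEmb, (mem_unitSphere_iff.1 hJ).1]

theorem sliceEmb_im {J : ℍ[ℝ]} (hJ : J ∈ unitSphere) (z : ℂ) :
    (sliceEmb J z).im = z.im • J := by
  have h := (mem_unitSphere_iff.1 hJ).1
  ext <;> simp [sliceEmb, h, mul_comm]

theorem norm_sliceEmb_im {J : ℍ[ℝ]} (hJ : J ∈ unitSphere) (z : ℂ) :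
    ‖(sliceEmb J z).im‖ = |z.im| := by
  rw [sliceEmb_im hJ, norm_smul, norm_of_mem hJ, mul_one, Real.norm_eq_abs]

theorem norm_sliceEmb {J : ℍ[ℝ]} (hJ : J ∈ unitSphere) (z : ℂ) : ‖sliceEmb J z‖ = ‖z‖ := by
  have h := mem_unitSphere_iff.1 hJ
  have h2 := Quaternion.normSq_eq_norm_mul_self (sliceEmb J z)
  rw [Quaternion.normSq_def'] at h2
  have h3 : ‖z‖ ^ 2 = z.re * z.re + z.im * z.im := by
    rw [← Complex.normSq_eq_norm_sq, Complex.normSq_apply]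
  simp [sliceEmb, h.1] at h2
  have : ‖sliceEmb J z‖ ^ 2 = ‖z‖ ^ 2 := by
    rw [h3]; simp only [sliceEmb]; linear_combination -h2 + z.im ^ 2 * h.2
  exact (sq_eq_sq₀ (norm_nonneg _) (norm_nonneg _)).1 this

theorem sliceEmb_injective {J : ℍ[ℝ]} (hJ : J ∈ unitSphere) : Function.Injective (sliceEmb J) := by
  intro z w h
  simp only [← embHom_apply hJ] at h
  exact (embHom J hJ).toRingHom.injective h

theorem sliceEmb_inj {J : ℍ[ℝ]} (hJ : J ∈ unitSphere) {z w : ℂ} :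
    sliceEmb J z = sliceEmb J w ↔ z = w := (sliceEmb_injective hJ).eq_iff

theorem sliceEmb_eq_zero {J : ℍ[ℝ]} (hJ : J ∈ unitSphere) {z : ℂ} :
    sliceEmb J z = 0 ↔ z = 0 := by
  rw [← sliceEmb_zero J, sliceEmb_inj hJ]

theorem continuous_sliceEmb (J : ℍ[ℝ]) : Continuous (sliceEmb J) := by
  unfold sliceEmb
  exact (Quaternion.continuous_coe.comp Complex.continuous_re).add
    (continuous_const.mul (Quaternion.continuous_coe.comp Complex.continuous_im))

theorem hasSum_sliceEmb {J : ℍ[ℝ]} (hJ : J ∈ unitSphere) {f : ℕ → ℂ} {a : ℂ} (h : HasSum f a) :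
    HasSum (fun k => sliceEmb J (f k)) (sliceEmb J a) := by
  have := h.map (embHom J hJ) (by
    rw [show (⇑(embHom J hJ)) = sliceEmb J from funext (embHom_apply hJ)]
    exact continuous_sliceEmb J)
  simpa [Function.comp_def, embHom_apply] using this

theorem tsum_sliceEmb {J : ℍ[ℝ]} (hJ : J ∈ unitSphere) {f : ℕ → ℂ} {a : ℂ} (h : HasSum f a) :
    ∑' k, sliceEmb J (f k) = sliceEmb J a := (hasSum_sliceEmb hJ h).tsum_eq

theorem exp_sliceEmb {J : ℍ[ℝ]} (hJ : J ∈ unitSphere) (z : ℂ) :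
    NormedSpace.exp (sliceEmb J z) = sliceEmb J (Complex.exp z) := by
  have h := NormedSpace.map_exp (embHom J hJ)
    (by rw [show (⇑(embHom J hJ)) = sliceEmb J from funext (embHom_apply hJ)]
        exact continuous_sliceEmb J) z
  rw [embHom_apply, embHom_apply] at h
  rw [← h, Complex.exp_eq_exp_ℂ]

/-- The point of the closed upper half plane representing the sphere through `q`. -/
noncomputable def up (q : ℍ[ℝ]) : ℂ := ⟨q.re, ‖q.im‖⟩

@[simp] theorem up_re (q : ℍ[ℝ]) : (up q).re = q.re := rfl
@[simp] theorem up_im (q : ℍ[ℝ]) : (up q).im = ‖q.im‖ := rfl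

theorem up_sliceEmb {J : ℍ[ℝ]} (hJ : J ∈ unitSphere) (z : ℂ) :
    up (sliceEmb J z) = ⟨z.re, |z.im|⟩ := by
  rw [up, sliceEmb_re hJ, norm_sliceEmb_im hJ]

theorem up_sliceEmb_of_nonneg {J : ℍ[ℝ]} (hJ : J ∈ unitSphere) {z : ℂ} (hz : 0 ≤ z.im) :
    up (sliceEmb J z) = z := by
  rw [up_sliceEmb hJ, abs_of_nonneg hz]

theorem continuous_up : Continuous up := by
  have : up = fun q => (q.re : ℂ) + (‖q.im‖ : ℂ) * Complex.I := by
    funext q; apply Complex.ext <;> simp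
  rw [this]
  exact (Complex.continuous_ofReal.comp Quaternion.continuous_re).add
    ((Complex.continuous_ofReal.comp Quaternion.continuous_im.norm).mul continuous_const)

theorem imUnit_mem {q : ℍ[ℝ]} (hq : q.im ≠ 0) : imUnit q ∈ unitSphere := by
  have h1 : ‖q.im‖ ≠ 0 := norm_ne_zero_iff.2 hq
  have h2 := Quaternion.normSq_eq_norm_mul_self q.im
  rw [Quaternion.normSq_def'] at h2
  rw [mem_unitSphere_iff]
  simp [imUnit] at h2 ⊢
  field_simp
  linarith

/-- Allows a pointwise identity at q to be checked in one slice at a point of the closed upper half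
plane. For real q any unit serves. -/
theorem exists_sliceEmb_up (q : ℍ[ℝ]) : ∃ J ∈ unitSphere, q = sliceEmb J (up q) := by
  by_cases hq : q.im = 0
  · refine ⟨_, coeI_mem, ?_⟩
    have h := Quaternion.re_add_im q
    rw [hq, add_zero] at h
    simp [sliceEmb, up, hq, h]
  · refine ⟨imUnit q, imUnit_mem hq, ?_⟩
    have h1 : ‖q.im‖ ≠ 0 := norm_ne_zero_iff.2 hq
    have h := Quaternion.re_add_im q
    conv_lhs => rw [← h]
    rw [sliceEmb, up, imUnit, Quaternion.mul_coe_eq_smul, smul_smul, mul_inv_cancel₀ h1, one_smul]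

theorem imUnit_sliceEmb_pos {J : ℍ[ℝ]} (hJ : J ∈ unitSphere) {z : ℂ} (hz : 0 < z.im) :
    imUnit (sliceEmb J z) = J := by
  rw [imUnit, norm_sliceEmb_im hJ, sliceEmb_im hJ, smul_smul, abs_of_pos hz,
    inv_mul_cancel₀ hz.ne', one_smul]

theorem imUnit_sliceEmb_neg {J : ℍ[ℝ]} (hJ : J ∈ unitSphere) {z : ℂ} (hz : z.im < 0) :
    imUnit (sliceEmb J z) = -J := by
  have h : sliceEmb J z = sliceEmb (-J) (conj z) := by rw [sliceEmb_neg_left]; simp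
  rw [h, imUnit_sliceEmb_pos (neg_mem_unitSphere hJ) (by simpa using hz)]

theorem imUnit_sliceEmb_real {J : ℍ[ℝ]} (hJ : J ∈ unitSphere) {z : ℂ} (hz : z.im = 0) :
    imUnit (sliceEmb J z) = 0 := by
  rw [imUnit, sliceEmb_im hJ, hz]; simp

/-! ### Complexified quaternions, their conjugation and their evaluation at an imaginary unit -/

@[simp] theorem stemRe_re (Z : ℍ[ℂ]) : (stemRe Z).re = Z.re.re := rfl
@[simp] theorem stemRe_imI (Z : ℍ[ℂ]) : (stemRe Z).imI = Z.imI.re := rfl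
@[simp] theorem stemRe_imJ (Z : ℍ[ℂ]) : (stemRe Z).imJ = Z.imJ.re := rfl
@[simp] theorem stemRe_imK (Z : ℍ[ℂ]) : (stemRe Z).imK = Z.imK.re := rfl
@[simp] theorem stemIm_re (Z : ℍ[ℂ]) : (stemIm Z).re = Z.re.im := rfl
@[simp] theorem stemIm_imI (Z : ℍ[ℂ]) : (stemIm Z).imI = Z.imI.im := rfl
@[simp] theorem stemIm_imJ (Z : ℍ[ℂ]) : (stemIm Z).imJ = Z.imJ.im := rfl
@[simp] theorem stemIm_imK (Z : ℍ[ℂ]) : (stemIm Z).imK = Z.imK.im := rfl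
@[simp] theorem iotaConj_re (Z : ℍ[ℂ]) : (iotaConj Z).re = conj Z.re := rfl
@[simp] theorem iotaConj_imI (Z : ℍ[ℂ]) : (iotaConj Z).imI = conj Z.imI := rfl
@[simp] theorem iotaConj_imJ (Z : ℍ[ℂ]) : (iotaConj Z).imJ = conj Z.imJ := rfl
@[simp] theorem iotaConj_imK (Z : ℍ[ℂ]) : (iotaConj Z).imK = conj Z.imK := rfl

theorem stemRe_add (Z W : ℍ[ℂ]) : stemRe (Z + W) = stemRe Z + stemRe W := by
  ext <;> simp

theorem stemIm_add (Z W : ℍ[ℂ]) : stemIm (Z + W) = stemIm Z + stemIm W := by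
  ext <;> simp

theorem phi_add (J : ℍ[ℝ]) (Z W : ℍ[ℂ]) : phi J (Z + W) = phi J Z + phi J W := by
  simp only [phi, stemRe_add, stemIm_add, mul_add]; abel

theorem stemRe_coe_mul (c : ℂ) (Z : ℍ[ℂ]) :
    stemRe ((c : ℍ[ℂ]) * Z) = (c.re : ℍ[ℝ]) * stemRe Z - (c.im : ℍ[ℝ]) * stemIm Z := by
  ext <;> simp

theorem stemIm_coe_mul (c : ℂ) (Z : ℍ[ℂ]) :
    stemIm ((c : ℍ[ℂ]) * Z) = (c.re : ℍ[ℝ]) * stemIm Z + (c.im : ℍ[ℝ]) * stemRe Z := by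
  ext <;> simp

/-- Evaluation at J is not multiplicative in general, but a complex scalar c = α + ιβ is central in
`ℍ[ℂ]` and ι acts as left multiplication by J. This is why a slice preserving left factor multiplies
pointwise. -/
theorem phi_coe_mul {J : ℍ[ℝ]} (hJ : J ∈ unitSphere) (c : ℂ) (Z : ℍ[ℂ]) :
    phi J ((c : ℍ[ℂ]) * Z) = sliceEmb J c * phi J Z := by
  have h := mul_self_of_mem hJ
  have h2 : J * (J * stemIm Z) = -stemIm Z := by rw [← mul_assoc, h, neg_one_mul]
  rw [phi, stemRe_coe_mul, stemIm_coe_mul]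
  simp only [phi, sliceEmb, Quaternion.coe_mul_eq_smul,
    Quaternion.mul_coe_eq_smul, add_mul, mul_add, smul_mul_assoc, mul_smul_comm, h2, smul_neg]
  abel

theorem phi_coe (J : ℍ[ℝ]) (c : ℂ) : phi J (c : ℍ[ℂ]) = sliceEmb J c := by
  have h1 : stemRe (c : ℍ[ℂ]) = (c.re : ℍ[ℝ]) := by ext <;> simp
  have h2 : stemIm (c : ℍ[ℂ]) = (c.im : ℍ[ℝ]) := by ext <;> simp
  rw [phi, h1, h2, sliceEmb]

/-- The compatibility behind well-definedness: x + Jy and x + (-J)(-y) are the same point. -/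
theorem phi_neg_left (J : ℍ[ℝ]) (Z : ℍ[ℂ]) : phi (-J) (iotaConj Z) = phi J Z := by
  have h1 : stemRe (iotaConj Z) = stemRe Z := by ext <;> simp
  have h2 : stemIm (iotaConj Z) = -stemIm Z := by ext <;> simp
  rw [phi, h1, h2, phi]; simp

theorem stem_ext {Z W : ℍ[ℂ]} (h1 : stemRe Z = stemRe W) (h2 : stemIm Z = stemIm W) : Z = W := by
  simp only [Quaternion.ext_iff, stemRe_re, stemRe_imI, stemRe_imJ, stemRe_imK, stemIm_re,
    stemIm_imI, stemIm_imJ, stemIm_imK] at h1 h2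
  ext1 <;> apply Complex.ext <;> tauto

/-- The sum of the values at J and -J gives twice the part a, and then J b determines b because J is
invertible. -/
theorem eq_of_phi_eq {Z W : ℍ[ℂ]} {J : ℍ[ℝ]} (hJ : J ∈ unitSphere) (h : phi J Z = phi J W)
    (h' : phi (-J) Z = phi (-J) W) : Z = W := by
  simp only [phi, neg_mul] at h h'
  have h1 : stemRe Z = stemRe W := by
    have h3 : (2 : ℝ) • stemRe Z = (2 : ℝ) • stemRe W := by
      rw [two_smul, two_smul]
      have h5 := congrArg₂ (· + ·) h h'
      calc stemRe Z + stemRe Z = (stemRe Z + J * stemIm Z) + (stemRe Z + -(J * stemIm Z)) := by abel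
        _ = _ := h5
        _ = stemRe W + stemRe W := by abel
    exact smul_right_injective _ (two_ne_zero) h3
  refine stem_ext h1 ?_
  rw [h1] at h
  have h4 := congrArg (fun x => J * x) (add_left_cancel h)
  simpa [← mul_assoc, mul_self_of_mem hJ] using h4

theorem iotaConj_mul (Z W : ℍ[ℂ]) : iotaConj (Z * W) = iotaConj Z * iotaConj W := by
  ext1 <;> simp

theorem iotaConj_coe (c : ℂ) : iotaConj (c : ℍ[ℂ]) = ((conj c : ℂ) : ℍ[ℂ]) := by
  ext1 <;> simp

/-! ### Induced functions -/

theorem mem_planeSection {U : Set ℍ[ℝ]} (hU : IsAxiallySymmetric U) {J : ℍ[ℝ]}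
    (hJ : J ∈ unitSphere) {z : ℂ} : z ∈ planeSection U ↔ sliceEmb J z ∈ U := by
  rw [planeSection, Set.mem_ofPred_eq, ← sliceEmb_coeI]
  exact ⟨fun h => hU z _ coeI_mem h J hJ, fun h => hU z _ hJ h _ coeI_mem⟩

theorem conj_mem_planeSection {U : Set ℍ[ℝ]} (hU : IsAxiallySymmetric U) {z : ℂ}
    (hz : z ∈ planeSection U) : conj z ∈ planeSection U := by
  rw [mem_planeSection hU coeI_mem, ← sliceEmb_neg_left,
    ← mem_planeSection hU (neg_mem_unitSphere coeI_mem)]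
  exact hz

theorem up_mem_planeSection {U : Set ℍ[ℝ]} (hU : IsAxiallySymmetric U) {q : ℍ[ℝ]} :
    up q ∈ planeSection U ↔ q ∈ U := by
  obtain ⟨J, hJ, h⟩ := exists_sliceEmb_up q
  rw [mem_planeSection hU hJ, ← h]

theorem isOpen_planeSection {U : Set ℍ[ℝ]} (hU : IsOpen U) : IsOpen (planeSection U) := by
  have : planeSection U = sliceEmb ((Complex.I : ℂ) : ℍ[ℝ]) ⁻¹' U := by
    ext z; rw [Set.mem_preimage, sliceEmb_coeI]; rfl
  rw [this]
  exact hU.preimage (continuous_sliceEmb _)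

theorem planeSection_mono {U V : Set ℍ[ℝ]} (h : U ⊆ V) : planeSection U ⊆ planeSection V :=
  fun _ hz => h hz

/-- `F` is a stem function on the section of `U`, and `f` is induced by it. -/
def Ind (f : ℍ[ℝ] → ℍ[ℝ]) (F : ℂ → ℍ[ℂ]) (U : Set ℍ[ℝ]) : Prop :=
  IsInducedBy f F U ∧ IsStem F (planeSection U)

/-- The complex valued function `h` is conjugation equivariant and induces `f` on `U`. -/
def SInd (f : ℍ[ℝ] → ℍ[ℝ]) (h : ℂ → ℂ) (U : Set ℍ[ℝ]) : Prop :=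
  (∀ J ∈ unitSphere, ∀ z ∈ planeSection U, f (sliceEmb J z) = sliceEmb J (h z)) ∧
    ∀ z ∈ planeSection U, h (conj z) = conj (h z)

theorem SInd.ind {f : ℍ[ℝ] → ℍ[ℝ]} {h : ℂ → ℂ} {U : Set ℍ[ℝ]} (H : SInd f h U) :
    Ind f (fun z => (h z : ℍ[ℂ])) U :=
  ⟨fun J hJ z hz => by beta_reduce; rw [phi_coe]; exact H.1 J hJ z hz,
    fun z hz => by beta_reduce; rw [iotaConj_coe, H.2 z hz]⟩

theorem Ind.mono {f : ℍ[ℝ] → ℍ[ℝ]} {F : ℂ → ℍ[ℂ]} {U V : Set ℍ[ℝ]} (H : Ind f F U) (h : V ⊆ U) :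
    Ind f F V :=
  ⟨fun J hJ z hz => H.1 J hJ z (h hz), fun z hz => H.2 z (h hz)⟩

theorem SInd.mono {f : ℍ[ℝ] → ℍ[ℝ]} {F : ℂ → ℂ} {U V : Set ℍ[ℝ]} (H : SInd f F U) (h : V ⊆ U) :
    SInd f F V :=
  ⟨fun J hJ z hz => H.1 J hJ z (h hz), fun z hz => H.2 z (h hz)⟩

theorem Ind.congr {f f' : ℍ[ℝ] → ℍ[ℝ]} {F F' : ℂ → ℍ[ℂ]} {U : Set ℍ[ℝ]}
    (hU : IsAxiallySymmetric U) (H : Ind f F U) (hf : ∀ q ∈ U, f' q = f q)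
    (hF : ∀ z ∈ planeSection U, F' z = F z) : Ind f' F' U :=
  ⟨fun J hJ z hz => by
      rw [hf _ ((mem_planeSection hU hJ).1 hz), hF z hz]; exact H.1 J hJ z hz,
    fun z hz => by rw [hF z hz, hF _ (conj_mem_planeSection hU hz)]; exact H.2 z hz⟩

theorem SInd.congr {f f' : ℍ[ℝ] → ℍ[ℝ]} {F F' : ℂ → ℂ} {U : Set ℍ[ℝ]}
    (hU : IsAxiallySymmetric U) (H : SInd f F U) (hf : ∀ q ∈ U, f' q = f q)
    (hF : ∀ z ∈ planeSection U, F' z = F z) : SInd f' F' U :=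
  ⟨fun J hJ z hz => by
      rw [hf _ ((mem_planeSection hU hJ).1 hz), hF z hz]; exact H.1 J hJ z hz,
    fun z hz => by rw [hF z hz, hF _ (conj_mem_planeSection hU hz)]; exact H.2 z hz⟩

theorem iotaConj_add (Z W : ℍ[ℂ]) : iotaConj (Z + W) = iotaConj Z + iotaConj W := by
  ext1 <;> simp

theorem Ind.add {f g : ℍ[ℝ] → ℍ[ℝ]} {F G : ℂ → ℍ[ℂ]} {U : Set ℍ[ℝ]} (hf : Ind f F U)
    (hg : Ind g G U) : Ind (fun q => f q + g q) (fun z => F z + G z) U :=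
  ⟨fun J hJ z hz => by beta_reduce; rw [phi_add, hf.1 J hJ z hz, hg.1 J hJ z hz],
    fun z hz => by beta_reduce; rw [iotaConj_add, hf.2 z hz, hg.2 z hz]⟩

theorem SInd.mul_ind {f g : ℍ[ℝ] → ℍ[ℝ]} {h : ℂ → ℂ} {G : ℂ → ℍ[ℂ]} {U : Set ℍ[ℝ]}
    (hf : SInd f h U) (hg : Ind g G U) :
    Ind (fun q => f q * g q) (fun z => (h z : ℍ[ℂ]) * G z) U :=
  ⟨fun J hJ z hz => by beta_reduce; rw [phi_coe_mul hJ, hf.1 J hJ z hz, hg.1 J hJ z hz],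
    fun z hz => by beta_reduce; rw [iotaConj_mul, iotaConj_coe, hf.2 z hz, hg.2 z hz]⟩

/-! ### Pointwise algebra of functions with complex scalar stems -/

section SIndOps

variable {f g : ℍ[ℝ] → ℍ[ℝ]} {h k : ℂ → ℂ} {U : Set ℍ[ℝ]}

theorem SInd.add (hf : SInd f h U) (hg : SInd g k U) :
    SInd (fun q => f q + g q) (fun z => h z + k z) U :=
  ⟨fun J hJ z hz => by beta_reduce; rw [sliceEmb_add, hf.1 J hJ z hz, hg.1 J hJ z hz],
    fun z hz => by beta_reduce; rw [map_add, hf.2 z hz, hg.2 z hz]⟩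

theorem SInd.mul (hf : SInd f h U) (hg : SInd g k U) :
    SInd (fun q => f q * g q) (fun z => h z * k z) U :=
  ⟨fun J hJ z hz => by beta_reduce; rw [sliceEmb_mul hJ, hf.1 J hJ z hz, hg.1 J hJ z hz],
    fun z hz => by beta_reduce; rw [map_mul, hf.2 z hz, hg.2 z hz]⟩

theorem SInd.inv (hf : SInd f h U) : SInd (fun q => (f q)⁻¹) (fun z => (h z)⁻¹) U :=
  ⟨fun J hJ z hz => by beta_reduce; rw [sliceEmb_inv hJ, hf.1 J hJ z hz],
    fun z hz => by beta_reduce; rw [map_inv₀, hf.2 z hz]⟩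

theorem SInd.neg (hf : SInd f h U) : SInd (fun q => -f q) (fun z => -h z) U :=
  ⟨fun J hJ z hz => by beta_reduce; rw [sliceEmb_neg, hf.1 J hJ z hz],
    fun z hz => by beta_reduce; rw [map_neg, hf.2 z hz]⟩

theorem SInd.pow (hf : SInd f h U) (n : ℕ) : SInd (fun q => f q ^ n) (fun z => h z ^ n) U :=
  ⟨fun J hJ z hz => by beta_reduce; rw [sliceEmb_pow hJ, hf.1 J hJ z hz],
    fun z hz => by beta_reduce; rw [map_pow, hf.2 z hz]⟩

theorem SInd.smul (hf : SInd f h U) (r : ℝ) : SInd (fun q => r • f q) (fun z => r • h z) U :=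
  ⟨fun J hJ z hz => by beta_reduce; rw [sliceEmb_smul, hf.1 J hJ z hz],
    fun z hz => by beta_reduce; rw [hf.2 z hz]; simp⟩

theorem sInd_coe (r : ℝ) (U : Set ℍ[ℝ]) : SInd (fun _ => (r : ℍ[ℝ])) (fun _ => (r : ℂ)) U :=
  ⟨fun J _ z _ => by beta_reduce; rw [sliceEmb_ofReal], fun z _ => by simp⟩

theorem sInd_one (U : Set ℍ[ℝ]) : SInd (fun _ => 1) (fun _ => 1) U :=
  ⟨fun J _ z _ => by beta_reduce; rw [sliceEmb_one], fun z _ => by simp⟩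

/-- Two induced functions agree as soon as their stem functions agree on the upper half plane. -/
theorem SInd.eq_of_up (hU : IsAxiallySymmetric U) (hf : SInd f h U) (hg : SInd g k U) {q : ℍ[ℝ]}
    (hq : q ∈ U) (H : h (up q) = k (up q)) : f q = g q := by
  obtain ⟨J, hJ, e⟩ := exists_sliceEmb_up q
  have hz := (up_mem_planeSection hU).2 hq
  rw [e, hf.1 J hJ _ hz, hg.1 J hJ _ hz, H]

theorem SInd.eq_zero_iff (hU : IsAxiallySymmetric U) (hf : SInd f h U) {q : ℍ[ℝ]} (hq : q ∈ U) :
    f q = 0 ↔ h (up q) = 0 := by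
  obtain ⟨J, hJ, e⟩ := exists_sliceEmb_up q
  have hz := (up_mem_planeSection hU).2 hq
  conv_lhs => rw [e, hf.1 J hJ _ hz, sliceEmb_eq_zero hJ]

theorem SInd.eqOn_stem (hU : IsAxiallySymmetric U) (hf : SInd f h U) (hg : SInd g k U)
    (H : ∀ q ∈ U, f q = g q) {z : ℂ} (hz : z ∈ planeSection U) : h z = k z := by
  have := H _ ((mem_planeSection hU coeI_mem).1 hz)
  rwa [hf.1 _ coeI_mem z hz, hg.1 _ coeI_mem z hz, sliceEmb_inj coeI_mem] at this

end SIndOps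

/-- Uniqueness of the stem: z is evaluated in the slice of i with both orientations. -/
theorem Ind.eqOn_stem {f g : ℍ[ℝ] → ℍ[ℝ]} {F G : ℂ → ℍ[ℂ]} {U : Set ℍ[ℝ]}
    (hU : IsAxiallySymmetric U) (hf : Ind f F U) (hg : Ind g G U)
    (H : ∀ q ∈ U, f q = g q) {z : ℂ} (hz : z ∈ planeSection U) : F z = G z := by
  have h1 := H _ ((mem_planeSection hU coeI_mem).1 hz)
  have h2 := H _ ((mem_planeSection hU (neg_mem_unitSphere coeI_mem)).1 hz)
  rw [hf.1 _ coeI_mem z hz, hg.1 _ coeI_mem z hz] at h1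
  rw [hf.1 _ (neg_mem_unitSphere coeI_mem) z hz, hg.1 _ (neg_mem_unitSphere coeI_mem) z hz] at h2
  exact eq_of_phi_eq coeI_mem h1 h2

theorem Ind.eq_of_up {f g : ℍ[ℝ] → ℍ[ℝ]} {F G : ℂ → ℍ[ℂ]} {U : Set ℍ[ℝ]}
    (hU : IsAxiallySymmetric U) (hf : Ind f F U) (hg : Ind g G U) {q : ℍ[ℝ]}
    (hq : q ∈ U) (H : F (up q) = G (up q)) : f q = g q := by
  obtain ⟨J, hJ, e⟩ := exists_sliceEmb_up q
  have hz := (up_mem_planeSection hU).2 hq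
  rw [e, hf.1 J hJ _ hz, hg.1 J hJ _ hz, H]

theorem sInd_zero (U : Set ℍ[ℝ]) : SInd (fun _ => 0) (fun _ => 0) U :=
  ⟨fun J _ z _ => by beta_reduce; rw [sliceEmb_zero], fun z _ => by simp⟩

theorem ind_zero (U : Set ℍ[ℝ]) : Ind (fun _ => 0) (fun _ => 0) U := by
  simpa using (sInd_zero U).ind

/-- At a real point a stem function takes real values. -/
theorem stemIm_eq_zero_of_conj {F : ℂ → ℍ[ℂ]} {z : ℂ}
    (h : F (conj z) = iotaConj (F z)) (hz : z.im = 0) :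
    stemIm (F z) = 0 := by
  rw [Complex.conj_eq_iff_im.2 hz] at h
  have := congrArg stemIm h
  ext
  · have := congrArg (·.re) this; simp at this; simp; linarith
  · have := congrArg (·.imI) this; simp at this; simp; linarith
  · have := congrArg (·.imJ) this; simp at this; simp; linarith
  · have := congrArg (·.imK) this; simp at this; simp; linarith

/-- On the real axis `imUnit` has the default value 0. This is harmless, since the symmetry of the
stem makes its ι-part vanish there; below the axis the two sign changes cancel. -/
theorem sliceOf_sliceEmb {F : ℂ → ℍ[ℂ]} {J : ℍ[ℝ]} (hJ : J ∈ unitSphere) {z : ℂ}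
    (h : F (conj z) = iotaConj (F z)) : sliceOf F (sliceEmb J z) = phi J (F z) := by
  rw [sliceOf, sliceEmb_re hJ, norm_sliceEmb_im hJ]
  rcases lt_trichotomy z.im 0 with hz | hz | hz
  · have e : (⟨z.re, |z.im|⟩ : ℂ) = conj z := by
      apply Complex.ext <;> simp [abs_of_neg hz]
    rw [imUnit_sliceEmb_neg hJ hz, e, h, phi_neg_left]
  · have e : (⟨z.re, |z.im|⟩ : ℂ) = z := by
      apply Complex.ext <;> simp [hz]
    have h3 := stemIm_eq_zero_of_conj h hz
    rw [imUnit_sliceEmb_real hJ hz, e, phi, phi, h3]; simp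
  · have e : (⟨z.re, |z.im|⟩ : ℂ) = z := by
      apply Complex.ext <;> simp [abs_of_pos hz]
    rw [imUnit_sliceEmb_pos hJ hz, e]

theorem ind_sliceOf {F K : ℂ → ℍ[ℂ]} {U : Set ℍ[ℝ]} (hU : IsAxiallySymmetric U)
    (hF : IsStem F (planeSection U)) (hK : ∀ z ∈ planeSection U, K z = F z) :
    Ind (sliceOf K) F U := by
  refine ⟨fun J hJ z hz => ?_, hF⟩
  rw [sliceOf_sliceEmb hJ, hK z hz]
  rw [hK z hz, hK _ (conj_mem_planeSection hU hz), hF z hz]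

theorem sInd_sliceOf {h : ℂ → ℂ} {K : ℂ → ℍ[ℂ]} {U : Set ℍ[ℝ]} (hU : IsAxiallySymmetric U)
    (hF : ∀ z ∈ planeSection U, h (conj z) = conj (h z))
    (hK : ∀ z ∈ planeSection U, K z = (h z : ℍ[ℂ])) :
    SInd (sliceOf K) h U := by
  have := ind_sliceOf (F := fun z => (h z : ℍ[ℂ])) hU
    (fun z hz => by beta_reduce; rw [iotaConj_coe, hF z hz]) hK
  exact ⟨fun J hJ z hz => by rw [this.1 J hJ z hz, phi_coe], hF⟩

/-- With f(z) = a + ib and f(z̄) = a - ib, half the sum and -i times half the difference recover a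
and b. -/
theorem Ind.stemOf_eq {f : ℍ[ℝ] → ℍ[ℝ]} {F : ℂ → ℍ[ℂ]} {U : Set ℍ[ℝ]} (H : Ind f F U) {z : ℂ} (hz : z ∈ planeSection U) :
    stemOf f z = F z := by
  have hI := mul_self_of_mem coeI_mem
  have h1 : f (z : ℍ[ℝ]) = stemRe (F z) + ((Complex.I : ℂ) : ℍ[ℝ]) * stemIm (F z) := by
    rw [← sliceEmb_coeI, H.1 _ coeI_mem z hz, phi]
  have h2 : f ((conj z : ℂ) : ℍ[ℝ]) = stemRe (F z) - ((Complex.I : ℂ) : ℍ[ℝ]) * stemIm (F z) := by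
    rw [← sliceEmb_coeI, ← sliceEmb_neg_left, H.1 _ (neg_mem_unitSphere coeI_mem) z hz, phi,
      neg_mul, sub_eq_add_neg]
  have ha : (2 : ℝ)⁻¹ • (f (z : ℍ[ℝ]) + f ((conj z : ℂ) : ℍ[ℝ])) = stemRe (F z) := by
    rw [h1, h2, add_add_sub_cancel, ← two_smul ℝ, smul_smul]; norm_num
  have hb : (2 : ℝ)⁻¹ • (((Complex.I : ℂ) : ℍ[ℝ]) * (f ((conj z : ℂ) : ℍ[ℝ]) - f (z : ℍ[ℝ]))) =
      stemIm (F z) := by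
    have e : f ((conj z : ℂ) : ℍ[ℝ]) - f (z : ℍ[ℝ]) =
        -((2 : ℝ) • (((Complex.I : ℂ) : ℍ[ℝ]) * stemIm (F z))) := by
      rw [h1, h2, two_smul]; abel
    rw [e, mul_neg, mul_smul_comm, ← mul_assoc, hI, neg_one_mul, smul_neg, smul_neg, smul_neg, neg_neg,
      smul_smul]
    norm_num
  simp only [stemOf]
  rw [ha, hb]
  ext1 <;> rfl

theorem Ind.starMul {f g : ℍ[ℝ] → ℍ[ℝ]} {F G : ℂ → ℍ[ℂ]} {U : Set ℍ[ℝ]}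
    (hU : IsAxiallySymmetric U) (hf : Ind f F U) (hg : Ind g G U) :
    Ind (starMul f g) (fun z => F z * G z) U :=
  ind_sliceOf hU (fun z hz => by rw [iotaConj_mul, hf.2 z hz, hg.2 z hz])
    fun z hz => by rw [hf.stemOf_eq hz, hg.stemOf_eq hz]

theorem Ind.starPow {f : ℍ[ℝ] → ℍ[ℝ]} {F : ℂ → ℍ[ℂ]} {U : Set ℍ[ℝ]}
    (hU : IsAxiallySymmetric U) (hf : Ind f F U) (n : ℕ) :
    Ind (starPow f n) (fun z => F z ^ n) U := by
  induction n with
  | zero => simpa [StarLog.starPow] using (sInd_one U).ind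
  | succ k ih =>
    have := hf.starMul hU ih
    simpa only [StarLog.starPow, pow_succ'] using this

/-! ### Stems of the scalar part, the components and the symmetrization -/

section Parts

variable {f : ℍ[ℝ] → ℍ[ℝ]} {F : ℂ → ℍ[ℂ]} {U : Set ℍ[ℝ]}

theorem Ind.scalarPart (hU : IsAxiallySymmetric U) (hf : Ind f F U) :
    SInd (scalarPart f) (fun z => (F z).re) U :=
  sInd_sliceOf hU (fun z hz => by rw [hf.2 z hz]; rfl)
    fun z hz => by rw [hf.stemOf_eq hz]; rfl

theorem Ind.compI (hU : IsAxiallySymmetric U) (hf : Ind f F U) :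
    SInd (compI f) (fun z => (F z).imI) U :=
  sInd_sliceOf hU (fun z hz => by rw [hf.2 z hz]; rfl)
    fun z hz => by rw [hf.stemOf_eq hz]; rfl

theorem Ind.compJ (hU : IsAxiallySymmetric U) (hf : Ind f F U) :
    SInd (compJ f) (fun z => (F z).imJ) U :=
  sInd_sliceOf hU (fun z hz => by rw [hf.2 z hz]; rfl)
    fun z hz => by rw [hf.stemOf_eq hz]; rfl

theorem Ind.compK (hU : IsAxiallySymmetric U) (hf : Ind f F U) :
    SInd (compK f) (fun z => (F z).imK) U :=
  sInd_sliceOf hU (fun z hz => by rw [hf.2 z hz]; rfl)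
    fun z hz => by rw [hf.stemOf_eq hz]; rfl

theorem Ind.symmetrization (hU : IsAxiallySymmetric U) (hf : Ind f F U) :
    SInd (symmetrization f) (fun z => Quaternion.normSq (F z)) U := by
  have := ((((hf.scalarPart hU).pow 2).add ((hf.compI hU).pow 2)).add
    ((hf.compJ hU).pow 2)).add ((hf.compK hU).pow 2)
  simp only [Quaternion.normSq_def']
  exact this

theorem Ind.vecPart (hU : IsAxiallySymmetric U) (hf : Ind f F U) :
    Ind (vecPart f) (fun z => (F z).im) U := by
  have := hf.add (hf.scalarPart hU).neg.ind
  refine this.congr hU (fun q _ => ?_) (fun z _ => ?_)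
  · simp [StarLog.vecPart, sub_eq_add_neg]
  · ext1 <;> simp

end Parts

/-! ### Regularity in terms of stem functions -/

section Regular

variable {f : ℍ[ℝ] → ℍ[ℝ]} {U : Set ℍ[ℝ]}

theorem SR_iff : SR f U ↔ ∃ F, Ind f F U ∧ IsHolomorphic F (planeSection U) :=
  ⟨fun ⟨F, h1, h2, h3⟩ => ⟨F, ⟨h3, h1⟩, h2⟩, fun ⟨F, ⟨h3, h1⟩, h2⟩ => ⟨F, h1, h2, h3⟩⟩

theorem isHolomorphic_coe {h : ℂ → ℂ} {D : Set ℂ} (H : DifferentiableOn ℂ h D) :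
    IsHolomorphic (fun z => (h z : ℍ[ℂ])) D :=
  ⟨by simpa using H, by simp, by simp, by simp⟩

theorem imJ_eq_zero_of_mem_slice {q : ℍ[ℝ]} (h : q ∈ slicePlane ((Complex.I : ℂ) : ℍ[ℝ])) :
    q.imJ = 0 ∧ q.imK = 0 := by
  obtain ⟨z, rfl⟩ := h
  simp [sliceEmb]

theorem imI_eq_zero_of_mem_slice {q : ℍ[ℝ]} (h : q ∈ slicePlane unitJ) :
    q.imI = 0 ∧ q.imK = 0 := by
  obtain ⟨z, rfl⟩ := h
  simp [sliceEmb]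

theorem SRR_iff (hU : IsAxiallySymmetric U) :
    SRR f U ↔ ∃ h, SInd f h U ∧ DifferentiableOn ℂ h (planeSection U) := by
  constructor
  · rintro ⟨⟨F, h1, h2, h3⟩, h4⟩
    -- Preservation of the slice of i, tested at z and z̄, kills the j and k components of both
    -- parts a and b; the slice of j kills the i and k components.
    have key : ∀ z ∈ planeSection U, F z = ((F z).re : ℍ[ℂ]) := by
      intro z hz
      have hc := conj_mem_planeSection hU hz
      have a1 := imJ_eq_zero_of_mem_slice (h4 _ coeI_mem _ ((mem_planeSection hU coeI_mem).1 hz)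
        ⟨z, rfl⟩)
      have a2 := imJ_eq_zero_of_mem_slice (h4 _ coeI_mem _ ((mem_planeSection hU coeI_mem).1 hc)
        ⟨_, rfl⟩)
      have b1 := imI_eq_zero_of_mem_slice (h4 _ unitJ_mem _ ((mem_planeSection hU unitJ_mem).1 hz)
        ⟨z, rfl⟩)
      have b2 := imI_eq_zero_of_mem_slice (h4 _ unitJ_mem _ ((mem_planeSection hU unitJ_mem).1 hc)
        ⟨_, rfl⟩)
      rw [h3 _ coeI_mem z hz] at a1
      rw [h3 _ coeI_mem _ hc, h1 z hz] at a2
      rw [h3 _ unitJ_mem z hz] at b1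
      rw [h3 _ unitJ_mem _ hc, h1 z hz] at b2
      simp [phi] at a1 a2 b1 b2
      ext1 <;> apply Complex.ext <;> simp <;> linarith [a1.1, a1.2, a2.1, a2.2, b1.1, b1.2, b2.1, b2.2]
    refine ⟨fun z => (F z).re, ⟨fun J hJ z hz => ?_, fun z hz => ?_⟩, h2.1⟩
    · rw [h3 J hJ z hz, ← phi_coe, ← key z hz]
    · beta_reduce; rw [h1 z hz]; rfl
  · rintro ⟨h, h1, h2⟩
    refine ⟨SR_iff.2 ⟨_, h1.ind, isHolomorphic_coe h2⟩, ?_⟩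
    rintro I hI _ hq ⟨z, rfl⟩
    exact ⟨h z, (h1.1 I hI z ((mem_planeSection hU hI).2 hq)).symm⟩

theorem SRV_iff (hU : IsAxiallySymmetric U) :
    SRV f U ↔ ∃ F, Ind f F U ∧ IsHolomorphic F (planeSection U) ∧
      ∀ z ∈ planeSection U, (F z).re = 0 := by
  constructor
  · rintro ⟨h1, h2⟩
    obtain ⟨F, hF, hh⟩ := SR_iff.1 h1
    refine ⟨F, hF, hh, fun z hz => ?_⟩
    have := hF.eqOn_stem hU (hF.vecPart hU) h2 hz
    rw [this]; simp
  · rintro ⟨F, hF, hh, h0⟩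
    refine ⟨SR_iff.2 ⟨F, hF, hh⟩, fun q hq => ?_⟩
    refine hF.eq_of_up hU (hF.vecPart hU) hq ?_
    have := h0 _ ((up_mem_planeSection hU).2 hq)
    ext1 <;> simp [this]

end Regular

/-- A complexified quaternion with vanishing norm induces a zero on its sphere. -/
theorem exists_phi_eq_zero {Z : ℍ[ℂ]} (h : Quaternion.normSq Z = 0) (hZ : stemIm Z ≠ 0) :
    ∃ J ∈ unitSphere, phi J Z = 0 := by
  have h1 := congrArg Complex.re h
  have h2 := congrArg Complex.im h
  simp [Quaternion.normSq_def', pow_two] at h1 h2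
  have hb : Quaternion.normSq (stemIm Z) ≠ 0 := Quaternion.normSq_ne_zero.2 hZ
  -- J = -a b⁻¹ solves a + Jb = 0. The real part of n(Z) = 0 says |a| = |b|, so |J| = 1; its
  -- imaginary part says that a is orthogonal to b, so J has no real part.
  refine ⟨-(stemRe Z * (stemIm Z)⁻¹), ?_, ?_⟩
  · have e : Quaternion.normSq (-(stemRe Z * (stemIm Z)⁻¹)) = 1 := by
      rw [Quaternion.normSq_neg, map_mul, Quaternion.normSq_inv]
      have : Quaternion.normSq (stemRe Z) = Quaternion.normSq (stemIm Z) := by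
        simp [Quaternion.normSq_def']; linarith
      rw [this, mul_inv_cancel₀ hb]
    have e2 : (-(stemRe Z * (stemIm Z)⁻¹)).re = 0 := by
      rw [Quaternion.instInv]
      simp
      right
      linarith
    rw [mem_unitSphere_iff]
    refine ⟨e2, ?_⟩
    rw [Quaternion.normSq_def', e2] at e
    linarith
  · rw [phi, neg_mul, mul_assoc, inv_mul_cancel₀ hZ]; simp

/-- The converse direction: a = -Jb has the norm of b and is orthogonal to b, which are the real and
imaginary parts of n(Z) = 0. -/
theorem normSq_eq_zero_of_phi {Z : ℍ[ℂ]} {J : ℍ[ℝ]} (hJ : J ∈ unitSphere) (h : phi J Z = 0) :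
    Quaternion.normSq Z = 0 := by
  have hj := mem_unitSphere_iff.1 hJ
  have e : stemRe Z = -(J * stemIm Z) := eq_neg_of_add_eq_zero_left h
  have e1 := congrArg (·.re) e
  have e2 := congrArg (·.imI) e
  have e3 := congrArg (·.imJ) e
  have e4 := congrArg (·.imK) e
  simp [hj.1] at e1 e2 e3 e4
  apply Complex.ext
  · simp [Quaternion.normSq_def', pow_two]
    rw [e1, e2, e3, e4]
    linear_combination (Z.re.im ^ 2 + Z.imI.im ^ 2 + Z.imJ.im ^ 2 + Z.imK.im ^ 2) * hj.2
  · simp [Quaternion.normSq_def', pow_two]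
    rw [e1, e2, e3, e4]
    ring

/-! ### The entire functions `μ` and `ν`, and the exponential of a stem function -/

/-- The entire function with `cmu (σ ^ 2) = cos σ`. -/
noncomputable def cmu (s : ℂ) : ℂ := ∑' m : ℕ, ((-1 : ℝ) ^ m / ((2 * m).factorial : ℝ)) • s ^ m

/-- The entire function with `cnu (σ ^ 2) * σ = sin σ`. -/
noncomputable def cnu (s : ℂ) : ℂ :=
  ∑' m : ℕ, ((-1 : ℝ) ^ m / ((2 * m + 1).factorial : ℝ)) • s ^ m

/-- Domination by the exponential series, uniform on discs; it serves both μ (N = 2m) and ν (N = 2m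
+ 1). -/
theorem norm_term_le {m N : ℕ} (h : m ≤ N) {s : ℂ} {R : ℝ} (hs : ‖s‖ ≤ R) :
    ‖((-1 : ℝ) ^ m / (N.factorial : ℝ)) • s ^ m‖ ≤ R ^ m / (m.factorial : ℝ) := by
  rw [norm_smul, norm_div, norm_pow, norm_neg, norm_one, one_pow, norm_pow, Real.norm_natCast,
    one_div, inv_mul_eq_div]
  have h1 : (m.factorial : ℝ) ≤ N.factorial := by exact_mod_cast Nat.factorial_le h
  have h2 : (0 : ℝ) < m.factorial := by exact_mod_cast m.factorial_pos
  have h3 : 0 ≤ R := (norm_nonneg s).trans hs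
  gcongr

theorem summable_cmu (s : ℂ) :
    Summable fun m : ℕ => ((-1 : ℝ) ^ m / ((2 * m).factorial : ℝ)) • s ^ m :=
  Summable.of_norm_bounded (Real.summable_pow_div_factorial ‖s‖)
    fun m => norm_term_le (by omega) le_rfl

theorem summable_cnu (s : ℂ) :
    Summable fun m : ℕ => ((-1 : ℝ) ^ m / ((2 * m + 1).factorial : ℝ)) • s ^ m :=
  Summable.of_norm_bounded (Real.summable_pow_div_factorial ‖s‖)
    fun m => norm_term_le (by omega) le_rfl

theorem differentiable_series (N : ℕ → ℕ) (hN : ∀ m, m ≤ N m) :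
    Differentiable ℂ fun s : ℂ => ∑' m : ℕ, ((-1 : ℝ) ^ m / ((N m).factorial : ℝ)) • s ^ m := by
  intro s
  have h : DifferentiableOn ℂ
      (fun s : ℂ => ∑' m : ℕ, ((-1 : ℝ) ^ m / ((N m).factorial : ℝ)) • s ^ m)
      (Metric.ball 0 (‖s‖ + 1)) :=
    Complex.differentiableOn_tsum_of_summable_norm
      (Real.summable_pow_div_factorial (‖s‖ + 1)) (fun m => by fun_prop) Metric.isOpen_ball
      fun m w hw => norm_term_le (hN m) (mem_ball_zero_iff.1 hw).le
  exact h.differentiableAt (Metric.isOpen_ball.mem_nhds (by simp))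

theorem differentiable_cmu : Differentiable ℂ cmu :=
  differentiable_series (fun m => 2 * m) fun m => by omega

theorem differentiable_cnu : Differentiable ℂ cnu :=
  differentiable_series (fun m => 2 * m + 1) fun m => by omega

theorem cmu_sq (σ : ℂ) : cmu (σ ^ 2) = Complex.cos σ := by
  rw [← (Complex.hasSum_cos σ).tsum_eq, cmu]
  refine tsum_congr fun m => ?_
  rw [Complex.real_smul, ← pow_mul]
  push_cast
  ring

theorem cnu_sq_mul (σ : ℂ) : cnu (σ ^ 2) * σ = Complex.sin σ := by
  rw [← (Complex.hasSum_sin σ).tsum_eq, cnu, ← tsum_mul_right]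
  refine tsum_congr fun m => ?_
  rw [Complex.real_smul, ← pow_mul]
  push_cast
  ring

theorem cmu_zero : cmu 0 = 1 := by simpa using cmu_sq 0

theorem cnu_zero : cnu 0 = 1 := by
  rw [cnu, tsum_eq_single 0 (fun m hm => by simp [hm])]
  simp

theorem exists_sq_eq (s : ℂ) : ∃ σ : ℂ, s = σ ^ 2 := by
  obtain ⟨z, hz⟩ := IsAlgClosed.exists_pow_nat_eq s (n := 2) (by norm_num)
  exact ⟨z, hz.symm⟩

/-- This is cos² + sin² = 1 at a square root of s. -/
theorem cmu_sq_add (s : ℂ) : cmu s ^ 2 + s * cnu s ^ 2 = 1 := by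
  obtain ⟨σ, rfl⟩ := exists_sq_eq s
  have := Complex.sin_sq_add_cos_sq σ
  rw [← cnu_sq_mul, ← cmu_sq] at this
  linear_combination this

theorem cmu_conj (s : ℂ) : cmu (conj s) = conj (cmu s) := by
  rw [cmu, cmu, Complex.conj_tsum]
  refine tsum_congr fun m => ?_
  simp

theorem cnu_conj (s : ℂ) : cnu (conj s) = conj (cnu s) := by
  rw [cnu, cnu, Complex.conj_tsum]
  refine tsum_congr fun m => ?_
  simp

/-- The exponential in the algebra of complexified quaternions. -/
noncomputable def expQ (Z : ℍ[ℂ]) : ℍ[ℂ] :=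
  ((Complex.exp Z.re : ℂ) : ℍ[ℂ]) * (((cmu (Quaternion.normSq Z.im) : ℂ) : ℍ[ℂ]) +
    ((cnu (Quaternion.normSq Z.im) : ℂ) : ℍ[ℂ]) * Z.im)

theorem hasSum_exp (z : ℂ) : HasSum (fun k : ℕ => (k.factorial : ℝ)⁻¹ • z ^ k) (Complex.exp z) := by
  rw [Complex.exp_eq_exp_ℂ]
  exact NormedSpace.exp_series_hasSum_exp' (𝕂 := ℝ) z

theorem im_mul_im (Z : ℍ[ℂ]) : Z.im * Z.im = -((Quaternion.normSq Z.im : ℂ) : ℍ[ℂ]) := by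
  have := Quaternion.im_sq Z
  rwa [pow_two] at this

/-- Since V² = -s for the vectorial part V of Z, the span of 1 and V over ℂ is stable under
multiplication by Z = a + V; the recursion is that multiplication in coordinates. -/
theorem pow_eq_of_rec {a s : ℂ} {P Q : ℕ → ℂ} (hP : P 0 = 1) (hQ : Q 0 = 0)
    (hP' : ∀ k, P (k + 1) = a * P k - s * Q k) (hQ' : ∀ k, Q (k + 1) = P k + a * Q k)
    {Z : ℍ[ℂ]} (h1 : Z.re = a) (h2 : Quaternion.normSq Z.im = s) (k : ℕ) :
    Z ^ k = (P k : ℍ[ℂ]) + (Q k : ℍ[ℂ]) * Z.im := by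
  induction k with
  | zero => simp [hP, hQ]
  | succ k ih =>
    have e : Z = (a : ℍ[ℂ]) + Z.im := by rw [← h1, Quaternion.re_add_im]
    have h3 := im_mul_im Z
    rw [h2] at h3
    rw [pow_succ', ih, hP', hQ']
    have c1 : Z.im * (P k : ℍ[ℂ]) = (P k : ℍ[ℂ]) * Z.im := (Quaternion.coe_commutes _ _).symm
    have c2 : Z.im * ((Q k : ℍ[ℂ]) * Z.im) = -((s * Q k : ℂ) : ℍ[ℂ]) := by
      rw [← mul_assoc, ← Quaternion.coe_commutes, mul_assoc, h3, mul_neg, mul_comm s,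
        Quaternion.coe_mul]
    calc Z * ((P k : ℍ[ℂ]) + (Q k : ℍ[ℂ]) * Z.im)
        = ((a : ℍ[ℂ]) + Z.im) * ((P k : ℍ[ℂ]) + (Q k : ℍ[ℂ]) * Z.im) := by rw [← e]
      _ = _ := by
        rw [add_mul, mul_add, mul_add, c1, c2, ← mul_assoc, ← Quaternion.coe_mul,
          ← Quaternion.coe_mul, sub_eq_add_neg, Quaternion.coe_add, Quaternion.coe_neg,
          Quaternion.coe_add, add_mul]
        abel

/-- The coefficients of `Z ^ k = P + Q Z_v`, and the sums of the exponential series they form. -/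
theorem exists_pow_eq (a s : ℂ) : ∃ P Q : ℕ → ℂ,
    (∀ Z : ℍ[ℂ], Z.re = a → Quaternion.normSq Z.im = s →
      ∀ k, Z ^ k = (P k : ℍ[ℂ]) + (Q k : ℍ[ℂ]) * Z.im) ∧
    HasSum (fun k : ℕ => (k.factorial : ℝ)⁻¹ • P k) (Complex.exp a * cmu s) ∧
    HasSum (fun k : ℕ => (k.factorial : ℝ)⁻¹ • Q k) (Complex.exp a * cnu s) := by
  obtain ⟨σ, rfl⟩ := exists_sq_eq s
  -- The roots a ± iσ of X² - 2aX + a² + σ² coincide when σ = 0; then Q is k a^(k-1), the limit of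
  -- the divided difference used below.
  by_cases hσ : σ = 0
  · subst hσ
    have hP' : ∀ k, (fun k : ℕ => a ^ k) (k + 1) =
        a * (fun k => a ^ k) k - 0 ^ 2 * (fun k : ℕ => (k : ℂ) * a ^ (k - 1)) k := by
      intro k; simp [pow_succ']
    have hQ' : ∀ k, (fun k : ℕ => (k : ℂ) * a ^ (k - 1)) (k + 1) =
        (fun k => a ^ k) k + a * (fun k : ℕ => (k : ℂ) * a ^ (k - 1)) k := by
      rintro (_ | k)
      · simp
      · simp only [Nat.add_sub_cancel]; push_cast; ring
    refine ⟨fun k => a ^ k, fun k => k * a ^ (k - 1),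
      fun Z h1 h2 k => pow_eq_of_rec (by simp) (by simp) hP' hQ' h1 h2 k, ?_, ?_⟩
    · simpa [cmu_zero] using hasSum_exp a
    · rw [zero_pow two_ne_zero, cnu_zero, mul_one]
      -- The term k = 0 is zero, and (k+1)/(k+1)! = 1/k! turns the shifted series into the
      -- exponential series.
      rw [← hasSum_nat_add_iff' 1]
      simp only [Finset.range_one, Finset.sum_singleton, Nat.cast_zero, zero_mul, smul_zero,
        sub_zero, Nat.add_sub_cancel]
      convert! hasSum_exp a using 2 with k
      rw [Complex.real_smul, Complex.real_smul, Nat.factorial_succ]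
      have h1 : (k.factorial : ℂ) ≠ 0 := by exact_mod_cast k.factorial_ne_zero
      have h2 : (k : ℂ) + 1 ≠ 0 := by exact_mod_cast k.succ_ne_zero
      push_cast
      field_simp
  · have hd : (2 * Complex.I * σ) ≠ 0 := by simp [hσ]
    obtain ⟨P, hP⟩ : ∃ P : ℕ → ℂ,
      ∀ k, P k = ((a + Complex.I * σ) ^ k + (a - Complex.I * σ) ^ k) / 2 := ⟨_, fun _ => rfl⟩
    obtain ⟨Q, hQ⟩ : ∃ Q : ℕ → ℂ, ∀ k, Q k =
      ((a + Complex.I * σ) ^ k - (a - Complex.I * σ) ^ k) / (2 * Complex.I * σ) := ⟨_, fun _ => rfl⟩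
    have hP' : ∀ k, P (k + 1) = a * P k - σ ^ 2 * Q k := by
      intro k
      rw [hP, hP, hQ, pow_succ, pow_succ]
      generalize (a + Complex.I * σ) ^ k = x
      generalize (a - Complex.I * σ) ^ k = y
      field_simp
      linear_combination (σ * (x - y)) * Complex.I_sq
    have hQ' : ∀ k, Q (k + 1) = P k + a * Q k := by
      intro k
      rw [hP, hQ, hQ, pow_succ, pow_succ]
      generalize (a + Complex.I * σ) ^ k = x
      generalize (a - Complex.I * σ) ^ k = y
      field_simp
      ring
    refine ⟨P, Q, fun Z h1 h2 k => pow_eq_of_rec (by simp [hP]) (by simp [hQ]) hP' hQ' h1 h2 k,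
      ?_, ?_⟩
    · have := ((hasSum_exp (a + Complex.I * σ)).add (hasSum_exp (a - Complex.I * σ))).div_const 2
      convert! this using 1
      · funext k; rw [hP, ← smul_add, smul_div_assoc]
      · rw [cmu_sq, Complex.cos, sub_eq_add_neg, Complex.exp_add, Complex.exp_add]
        rw [mul_comm σ, neg_mul, mul_comm σ]
        ring
    · have := ((hasSum_exp (a + Complex.I * σ)).sub
        (hasSum_exp (a - Complex.I * σ))).div_const (2 * Complex.I * σ)
      convert! this using 1
      · funext k; rw [hQ, ← smul_sub, smul_div_assoc]
      · rw [eq_div_iff hd]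
        have h := cnu_sq_mul σ
        rw [Complex.sin] at h
        rw [sub_eq_add_neg a, Complex.exp_add, Complex.exp_add]
        rw [neg_mul, mul_comm σ Complex.I] at h
        linear_combination 2 * Complex.I * Complex.exp a * h + Complex.exp a *
          (Complex.exp (-(Complex.I * σ)) - Complex.exp (Complex.I * σ)) * Complex.I_sq

/-- The powers of Z have complex coefficients in 1 and Z_v, so the series splits into two complex
series placed in the slice of J. -/
theorem hasSum_phi_pow {J : ℍ[ℝ]} (hJ : J ∈ unitSphere) (Z : ℍ[ℂ]) :
    HasSum (fun k : ℕ => (k.factorial : ℝ)⁻¹ • phi J (Z ^ k)) (phi J (expQ Z)) := by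
  obtain ⟨P, Q, h1, h2, h3⟩ := exists_pow_eq Z.re (Quaternion.normSq Z.im)
  have := (hasSum_sliceEmb hJ h2).add ((hasSum_sliceEmb hJ h3).mul_right (phi J Z.im))
  convert this using 1
  · funext k
    rw [h1 Z rfl rfl k, phi_add, phi_coe, phi_coe_mul hJ, smul_add, sliceEmb_smul, sliceEmb_smul,
      smul_mul_assoc]
  · rw [expQ, mul_add, ← mul_assoc, ← Quaternion.coe_mul, ← Quaternion.coe_mul, phi_add, phi_coe,
      phi_coe_mul hJ]

/-- The bridge from the `*`-exponential to stems. Forwards, uniqueness of sums gives equality after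
evaluation at ±i, which determines the stem; backwards, each point is read in its own slice. -/
theorem starExpEq_iff {f g : ℍ[ℝ] → ℍ[ℝ]} {F G : ℂ → ℍ[ℂ]} {U : Set ℍ[ℝ]}
    (hU : IsAxiallySymmetric U) (hf : Ind f F U) (hg : Ind g G U) :
    StarExpEq f g U ↔ ∀ z ∈ planeSection U, expQ (F z) = G z := by
  constructor
  · intro H z hz
    have key : ∀ J ∈ unitSphere, phi J (expQ (F z)) = phi J (G z) := by
      intro J hJ
      have h1 := H _ ((mem_planeSection hU hJ).1 hz)
      rw [hg.1 J hJ z hz] at h1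
      simp only [(hf.starPow hU _).1 J hJ z hz] at h1
      exact (hasSum_phi_pow hJ (F z)).unique h1
    exact eq_of_phi_eq coeI_mem (key _ coeI_mem) (key _ (neg_mem_unitSphere coeI_mem))
  · intro H q hq
    obtain ⟨J, hJ, e⟩ := exists_sliceEmb_up q
    have hz := (up_mem_planeSection hU).2 hq
    rw [e, hg.1 J hJ _ hz, ← H _ hz]
    simp only [(hf.starPow hU _).1 J hJ _ hz]
    exact hasSum_phi_pow hJ _

/-! ### Tubes: basic neighbourhoods of a point -/

/-- The folding of the complex plane onto the closed upper half plane. -/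
def fold (z : ℂ) : ℂ := ⟨z.re, |z.im|⟩

/-- The points whose sphere is at distance less than `ε` from the sphere of `p`. -/
def tube (p : ℍ[ℝ]) (ε : ℝ) : Set ℍ[ℝ] := {q | up q ∈ Metric.ball (up p) ε}

/-- The radius `ε` is small enough for tubes around `a` to have simple slices. -/
def Adm (a : ℂ) (ε : ℝ) : Prop := 0 < ε ∧ (a.im = 0 ∨ ε ≤ a.im)

theorem fold_of_nonneg {z : ℂ} (h : 0 ≤ z.im) : fold z = z := by
  apply Complex.ext <;> simp [fold, abs_of_nonneg h]

theorem fold_of_nonpos {z : ℂ} (h : z.im ≤ 0) : fold z = conj z := by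
  apply Complex.ext <;> simp [fold, abs_of_nonpos h]

theorem up_im_nonneg (q : ℍ[ℝ]) : 0 ≤ (up q).im := norm_nonneg _

theorem isAxiallySymmetric_preimage_up (S : Set ℂ) : IsAxiallySymmetric (up ⁻¹' S) := by
  intro z I hI h J hJ
  rw [Set.mem_preimage, up_sliceEmb hI] at h
  rw [Set.mem_preimage, up_sliceEmb hJ]
  exact h

theorem isAxiallySymmetric_tube (p : ℍ[ℝ]) (ε : ℝ) : IsAxiallySymmetric (tube p ε) :=
  isAxiallySymmetric_preimage_up _

theorem isOpen_tube (p : ℍ[ℝ]) (ε : ℝ) : IsOpen (tube p ε) :=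
  Metric.isOpen_ball.preimage continuous_up

theorem sliceSection_tube {J : ℍ[ℝ]} (hJ : J ∈ unitSphere) (p : ℍ[ℝ]) (ε : ℝ) :
    sliceSection (tube p ε) J = {z | fold z ∈ Metric.ball (up p) ε} := by
  ext z
  simp only [sliceSection, tube, Set.mem_ofPred_eq, up_sliceEmb hJ, fold]

theorem planeSection_tube (p : ℍ[ℝ]) (ε : ℝ) :
    planeSection (tube p ε) = {z | fold z ∈ Metric.ball (up p) ε} := by
  rw [← sliceSection_tube coeI_mem]
  ext z
  exact mem_planeSection (isAxiallySymmetric_tube _ _) coeI_mem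

theorem conj_mem_ball {a z : ℂ} {ε : ℝ} :
    conj z ∈ Metric.ball (conj a) ε ↔ z ∈ Metric.ball a ε := by
  rw [Metric.mem_ball, Metric.mem_ball, Complex.dist_conj_conj]

/-- With radius at most the height of the centre, the disc stays off the real line and hence off its
mirror image. -/
theorem im_pos_of_mem_ball {a z : ℂ} {ε : ℝ} (h : ε ≤ a.im) (hz : z ∈ Metric.ball a ε) :
    0 < z.im := by
  have h1 := Complex.abs_im_le_norm (z - a)
  rw [Metric.mem_ball, dist_eq_norm] at hz
  rw [Complex.sub_im] at h1
  have := abs_le.1 (h1.trans hz.le)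
  have := abs_lt.1 (h1.trans_lt hz)
  linarith [this.1]

theorem fold_mem_ball_real {a z : ℂ} {ε : ℝ} (ha : a.im = 0) :
    fold z ∈ Metric.ball a ε ↔ z ∈ Metric.ball a ε := by
  have h : conj a = a := Complex.conj_eq_iff_im.2 ha
  rcases le_total 0 z.im with hz | hz
  · rw [fold_of_nonneg hz]
  · rw [fold_of_nonpos hz]
    conv_lhs => rw [← h]
    exact conj_mem_ball

/-- The imaginary quaternion with given components. -/
def imQuat (v : EuclideanSpace ℝ (Fin 3)) : ℍ[ℝ] := ⟨0, v 0, v 1, v 2⟩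

@[simp] theorem imQuat_re (v : EuclideanSpace ℝ (Fin 3)) : (imQuat v).re = 0 := rfl
@[simp] theorem imQuat_imI (v : EuclideanSpace ℝ (Fin 3)) : (imQuat v).imI = v 0 := rfl
@[simp] theorem imQuat_imJ (v : EuclideanSpace ℝ (Fin 3)) : (imQuat v).imJ = v 1 := rfl
@[simp] theorem imQuat_imK (v : EuclideanSpace ℝ (Fin 3)) : (imQuat v).imK = v 2 := rfl

theorem continuous_imQuat : Continuous imQuat := by
  have : imQuat = fun v => (v 0) • ((Complex.I : ℂ) : ℍ[ℝ]) + (v 1) • unitJ +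
      (v 2) • (((Complex.I : ℂ) : ℍ[ℝ]) * unitJ) := by
    funext v
    ext <;> simp
  rw [this]
  fun_prop

theorem isConnected_unitSphere : IsConnected unitSphere := by
  have h : unitSphere = imQuat '' Metric.sphere 0 1 := by
    ext J
    constructor
    · intro hJ
      obtain ⟨h1, h2⟩ := mem_unitSphere_iff.1 hJ
      refine ⟨!₂[J.imI, J.imJ, J.imK], ?_, ?_⟩
      · rw [EuclideanSpace.sphere_zero_eq _ zero_le_one]
        simp [Fin.sum_univ_three, h2]
      · ext <;> simp [h1]
    · rintro ⟨v, hv, rfl⟩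
      rw [EuclideanSpace.sphere_zero_eq _ zero_le_one] at hv
      simp [Fin.sum_univ_three] at hv
      exact mem_unitSphere_iff.2 ⟨rfl, hv⟩
  rw [h]
  refine IsConnected.image (isConnected_sphere ?_ _ zero_le_one) _ continuous_imQuat.continuousOn
  -- Connectedness of the sphere needs real dimension greater than 1; here it is 3.
  rw [← Module.finrank_eq_rank]
  simp

/-- A tube is the continuous image of a convex piece of a disc, cut by the closed upper half plane,
times the connected sphere of units. -/
theorem isConnected_tube (p : ℍ[ℝ]) {ε : ℝ} (hε : 0 < ε) : IsConnected (tube p ε) := by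
  have h : tube p ε = (fun x : ℂ × ℍ[ℝ] => sliceEmb x.2 x.1) ''
      ((Metric.ball (up p) ε ∩ {z | 0 ≤ z.im}) ×ˢ unitSphere) := by
    ext q
    constructor
    · intro hq
      obtain ⟨J, hJ, e⟩ := exists_sliceEmb_up q
      exact ⟨(up q, J), ⟨⟨hq, up_im_nonneg q⟩, hJ⟩, e.symm⟩
    · rintro ⟨⟨z, J⟩, ⟨⟨h1, h2⟩, h3⟩, rfl⟩
      show up (sliceEmb J z) ∈ Metric.ball (up p) ε
      rw [up_sliceEmb_of_nonneg h3 h2]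
      exact h1
  rw [h]
  have hc : IsConnected (Metric.ball (up p) ε ∩ {z | 0 ≤ z.im}) :=
    ⟨⟨up p, Metric.mem_ball_self hε, up_im_nonneg p⟩,
      ((convex_ball _ _).inter (convex_halfSpace_im_ge 0)).isPreconnected⟩
  refine (hc.prod isConnected_unitSphere).image _ ?_
  · apply Continuous.continuousOn
    unfold sliceEmb
    have h1 : Continuous fun x : ℂ × ℍ[ℝ] => ((x.1.re : ℝ) : ℍ[ℝ]) :=
      Quaternion.continuous_coe.comp (Complex.continuous_re.comp continuous_fst)
    have h2 : Continuous fun x : ℂ × ℍ[ℝ] => ((x.1.im : ℝ) : ℍ[ℝ]) :=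
      Quaternion.continuous_coe.comp (Complex.continuous_im.comp continuous_fst)
    exact h1.add (continuous_snd.mul h2)

theorem isAxSymDomain_tube (p : ℍ[ℝ]) {ε : ℝ} (hε : 0 < ε) : IsAxSymDomain (tube p ε) :=
  ⟨isOpen_tube _ _, isConnected_tube _ hε, isAxiallySymmetric_tube _ _⟩

theorem connectedComponentIn_eq {X : Type*} [TopologicalSpace X] {S A B : Set X} (hA : IsOpen A)
    (hB : IsOpen B) (hAB : Disjoint A B) (hS : S ⊆ A ∪ B) (hAS : A ⊆ S) (hc : IsPreconnected A)
    {x : X} (hx : x ∈ A) : connectedComponentIn S x = A := by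
  refine Set.Subset.antisymm ?_ (hc.subset_connectedComponentIn hx hAS)
  exact IsPreconnected.subset_left_of_subset_union hA hB hAB
    ((connectedComponentIn_subset S x).trans hS)
    ⟨x, mem_connectedComponentIn (hAS hx), hx⟩ isPreconnected_connectedComponentIn

theorem isSimplyConnected_ball (a : ℂ) {ε : ℝ} (hε : 0 < ε) :
    IsSimplyConnected (Metric.ball a ε) := by
  have := Metric.contractibleSpace_ball (x := a) hε
  exact SimplyConnectedSpace.ofContractible _

/-- Every slice of the tube is a single disc when the centre is real, and otherwise the union of two
disjoint conjugate discs, each of them a component. -/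
theorem isBasicDomain_tube {p : ℍ[ℝ]} {ε : ℝ} (h : Adm (up p) ε) : IsBasicDomain (tube p ε) := by
  refine ⟨isAxSymDomain_tube p h.1, fun J hJ z hz => ?_⟩
  rw [sliceSection_tube hJ] at hz ⊢
  rcases h.2 with ha | ha
  · have hS : {z | fold z ∈ Metric.ball (up p) ε} = Metric.ball (up p) ε :=
      Set.ext fun z => fold_mem_ball_real ha
    rw [hS] at hz ⊢
    rw [connectedComponentIn_eq (A := Metric.ball (up p) ε) (B := ∅) Metric.isOpen_ball isOpen_empty
      (by simp) (by intro; simp) (fun _ h => h) (convex_ball _ _).isPreconnected hz]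
    exact isSimplyConnected_ball _ h.1
  · have hS : {z | fold z ∈ Metric.ball (up p) ε} =
        Metric.ball (up p) ε ∪ Metric.ball (conj (up p)) ε := by
      ext z
      rw [Set.mem_ofPred_eq, Set.mem_union]
      constructor
      · intro hz
        rcases le_total 0 z.im with h0 | h0
        · rw [fold_of_nonneg h0] at hz; exact Or.inl hz
        · rw [fold_of_nonpos h0, ← conj_mem_ball, Complex.conj_conj] at hz; exact Or.inr hz
      · rintro (hz | hz)
        · rwa [fold_of_nonneg (im_pos_of_mem_ball ha hz).le]
        · rw [← conj_mem_ball, Complex.conj_conj] at hz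
          have := im_pos_of_mem_ball ha hz
          rw [Complex.conj_im] at this
          rwa [fold_of_nonpos (by linarith)]
    have hd : Disjoint (Metric.ball (up p) ε) (Metric.ball (conj (up p)) ε) := by
      rw [Set.disjoint_left]
      intro w h1 h2
      rw [← conj_mem_ball, Complex.conj_conj] at h2
      have h3 := im_pos_of_mem_ball ha h2
      have h4 := im_pos_of_mem_ball ha h1
      rw [Complex.conj_im] at h3
      linarith
    rw [hS]
    have hz' : z ∈ Metric.ball (up p) ε ∪ Metric.ball (conj (up p)) ε := hS ▸ hz
    rcases hz' with hz' | hz'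
    · rw [connectedComponentIn_eq Metric.isOpen_ball Metric.isOpen_ball hd subset_rfl
        Set.subset_union_left (convex_ball _ _).isPreconnected hz']
      exact isSimplyConnected_ball _ h.1
    · rw [connectedComponentIn_eq Metric.isOpen_ball Metric.isOpen_ball hd.symm
        (by rw [Set.union_comm]) Set.subset_union_right (convex_ball _ _).isPreconnected hz']
      exact isSimplyConnected_ball _ h.1

theorem mem_realAxis_iff {q : ℍ[ℝ]} : q ∈ realAxis ↔ (up q).im = 0 := by
  rw [up_im, norm_eq_zero]
  constructor
  · rintro ⟨t, rfl⟩; simp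
  · intro h
    refine ⟨q.re, ?_⟩
    have := Quaternion.re_add_im q
    rwa [h, add_zero] at this

theorem disjoint_tube_realAxis {p : ℍ[ℝ]} {ε : ℝ} (h : Adm (up p) ε) (hp : p ∉ realAxis) :
    Disjoint (tube p ε) realAxis := by
  rw [Set.disjoint_left]
  intro q hq hr
  have ha := h.2.resolve_left (fun h0 => hp (mem_realAxis_iff.2 h0))
  exact (im_pos_of_mem_ball ha hq).ne' (mem_realAxis_iff.1 hr)

theorem planeSection_mem_nhds {Ω : Set ℍ[ℝ]} (hΩ : IsOpen Ω) (hs : IsAxiallySymmetric Ω)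
    {p : ℍ[ℝ]} (hp : p ∈ Ω) : planeSection Ω ∈ 𝓝 (up p) :=
  (isOpen_planeSection hΩ).mem_nhds ((up_mem_planeSection hs).2 hp)

/-- Turns a property of germs at `up p` into one on the defining disc of a tube inside Ω. Off the
real axis the radius is also capped by the height of the centre. -/
theorem exists_tube {Ω : Set ℍ[ℝ]} (hΩ : IsOpen Ω) (hs : IsAxiallySymmetric Ω) {p : ℍ[ℝ]}
    (hp : p ∈ Ω) {P : ℂ → Prop} (hP : ∀ᶠ z in 𝓝 (up p), P z) :
    ∃ ε, Adm (up p) ε ∧ IsBasicNhd (tube p ε) p Ω ∧ ∀ z ∈ Metric.ball (up p) ε, P z := by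
  obtain ⟨ε, hε, h⟩ := Metric.eventually_nhds_iff_ball.1
    (hP.and (planeSection_mem_nhds hΩ hs hp))
  obtain ⟨δ, hδ, hle⟩ : ∃ δ, Adm (up p) δ ∧ δ ≤ ε := by
    rcases (up_im_nonneg p).eq_or_lt with h0 | h0
    · exact ⟨ε, ⟨hε, Or.inl h0.symm⟩, le_rfl⟩
    · exact ⟨min ε (up p).im, ⟨lt_min hε h0, Or.inr (min_le_right _ _)⟩, min_le_left _ _⟩
  have hb := Metric.ball_subset_ball (x := up p) hle
  refine ⟨δ, hδ, ⟨isBasicDomain_tube hδ, Metric.mem_ball_self hδ.1, fun q hq => ?_⟩,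
    fun z hz => (h z (hb hz)).1⟩
  exact (up_mem_planeSection hs).1 (h _ (hb hq)).2

/-! ### Reflection -/

/-- The extension of a function from the upper half plane by reflection. -/
noncomputable def symmExt (h : ℂ → ℂ) (z : ℂ) : ℂ := if 0 ≤ z.im then h z else conj (h (conj z))

theorem symmExt_of_nonneg (h : ℂ → ℂ) {z : ℂ} (hz : 0 ≤ z.im) : symmExt h z = h z := if_pos hz

theorem symmExt_up (h : ℂ → ℂ) (q : ℍ[ℝ]) : symmExt h (up q) = h (up q) :=
  symmExt_of_nonneg h (up_im_nonneg q)

theorem differentiableAt_conj_conj {h : ℂ → ℂ} {z : ℂ} (H : DifferentiableAt ℂ h (conj z)) :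
    DifferentiableAt ℂ (fun w => conj (h (conj w))) z := by
  have := H.conj_conj
  rwa [Complex.conj_conj] at this

section symm

variable {p : ℍ[ℝ]} {ε : ℝ} {h : ℂ → ℂ}

/-- Off the real line this is the definition of the extension; on it h must be real, which is the
assumed symmetry for a real centre. -/
theorem symmExt_conj (ha : Adm (up p) ε)
    (hs : (up p).im = 0 → ∀ z ∈ Metric.ball (up p) ε, h (conj z) = conj (h z)) {z : ℂ}
    (hz : z ∈ planeSection (tube p ε)) : symmExt h (conj z) = conj (symmExt h z) := by
  rcases lt_trichotomy z.im 0 with h0 | h0 | h0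
  · rw [symmExt, symmExt, if_pos (by simpa using h0.le), if_neg (not_le.2 h0), Complex.conj_conj]
  · have e : conj z = z := Complex.conj_eq_iff_im.2 h0
    rw [planeSection_tube, Set.mem_ofPred_eq, fold_of_nonneg h0.ge] at hz
    rcases ha.2 with ha' | ha'
    · rw [e, symmExt_of_nonneg h h0.ge, ← hs ha' z hz, e]
    · exact absurd h0 (im_pos_of_mem_ball ha' hz).ne'
  · rw [symmExt, symmExt, if_neg (by simpa using h0), if_pos h0.le, Complex.conj_conj]

/-- The two definitions never have to be glued along the real line: for a real centre h is symmetric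
already and the extension equals h, and otherwise the discs do not meet the line. -/
theorem differentiableOn_symmExt (ha : Adm (up p) ε)
    (hh : DifferentiableOn ℂ h (Metric.ball (up p) ε))
    (hs : (up p).im = 0 → ∀ z ∈ Metric.ball (up p) ε, h (conj z) = conj (h z)) :
    DifferentiableOn ℂ (symmExt h) (planeSection (tube p ε)) := by
  intro z hz
  apply DifferentiableAt.differentiableWithinAt
  rw [planeSection_tube, Set.mem_ofPred_eq] at hz
  rcases lt_trichotomy z.im 0 with h0 | h0 | h0
  · rw [fold_of_nonpos h0.le] at hz
    refine (differentiableAt_conj_conj (hh.differentiableAt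
      (Metric.isOpen_ball.mem_nhds hz))).congr_of_eventuallyEq ?_
    filter_upwards [(isOpen_lt Complex.continuous_im continuous_const).mem_nhds h0] with w hw
    exact if_neg (not_le.2 hw)
  · rcases ha.2 with ha' | ha'
    · rw [fold_mem_ball_real ha'] at hz
      refine (hh.differentiableAt (Metric.isOpen_ball.mem_nhds hz)).congr_of_eventuallyEq ?_
      filter_upwards [Metric.isOpen_ball.mem_nhds hz] with w hw
      by_cases hw0 : 0 ≤ w.im
      · exact if_pos hw0
      · rw [symmExt, if_neg hw0, ← hs ha' _ ?_, Complex.conj_conj]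
        rw [← conj_mem_ball, Complex.conj_conj, Complex.conj_eq_iff_im.2 ha']
        exact hw
    · rw [fold_of_nonneg h0.ge] at hz
      exact absurd h0 (im_pos_of_mem_ball ha' hz).ne'
  · rw [fold_of_nonneg h0.le] at hz
    refine (hh.differentiableAt (Metric.isOpen_ball.mem_nhds hz)).congr_of_eventuallyEq ?_
    filter_upwards [(isOpen_lt continuous_const Complex.continuous_im).mem_nhds h0] with w hw
    exact if_pos (le_of_lt hw)

end symm

/-! ### The identity theorem -/

section Identity

variable {Ω : Set ℍ[ℝ]} {h : ℂ → ℂ}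

theorem analyticAt_of_differentiableOn (hΩ : IsOpen Ω) {z : ℂ}
    (hh : DifferentiableOn ℂ h (planeSection Ω)) (hz : z ∈ planeSection Ω) : AnalyticAt ℂ h z :=
  hh.analyticAt ((isOpen_planeSection hΩ).mem_nhds hz)

theorem isPreconnected_image_up (hΩ : IsAxSymDomain Ω) : IsPreconnected (up '' Ω) :=
  hΩ.2.1.isPreconnected.image _ continuous_up.continuousOn

/-- The plane section may split into two conjugate components, so the identity theorem is applied on
the image of Ω in the closed upper half plane, which is connected because Ω is. -/
theorem eq_zero_of_frequently (hΩ : IsAxSymDomain Ω) (hh : DifferentiableOn ℂ h (planeSection Ω))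
    {p : ℍ[ℝ]} (hp : p ∈ Ω) (H : ∃ᶠ z in 𝓝[≠] (up p), h z = 0) {q : ℍ[ℝ]} (hq : q ∈ Ω) :
    h (up q) = 0 := by
  have ha : AnalyticOnNhd ℂ h (up '' Ω) := by
    rintro _ ⟨x, hx, rfl⟩
    exact analyticAt_of_differentiableOn hΩ.1 hh ((up_mem_planeSection hΩ.2.2).2 hx)
  exact ha.eqOn_zero_of_preconnected_of_frequently_eq_zero (isPreconnected_image_up hΩ)
    ⟨p, hp, rfl⟩ H ⟨q, hq, rfl⟩

theorem eventually_ne_zero (hΩ : IsAxSymDomain Ω) (hh : DifferentiableOn ℂ h (planeSection Ω))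
    {q : ℍ[ℝ]} (hq : q ∈ Ω) (hne : h (up q) ≠ 0) {p : ℍ[ℝ]} (hp : p ∈ Ω) :
    ∀ᶠ z in 𝓝[≠] (up p), h z ≠ 0 := by
  by_contra hc
  exact hne (eq_zero_of_frequently hΩ hh hp (fun h' => hc h') hq)

end Identity

/-! ### Elementary functions on slices -/

theorem sliceEmb_mem_nonposRay {J : ℍ[ℝ]} (hJ : J ∈ unitSphere) {c : ℂ} :
    sliceEmb J c ∈ nonposRay ↔ c ∉ Complex.slitPlane := by
  constructor
  · rintro ⟨t, ht, h⟩
    simp only at h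
    rw [← sliceEmb_ofReal J, sliceEmb_inj hJ] at h
    rw [← h, Complex.ofReal_mem_slitPlane]
    exact not_lt.2 ht
  · intro h
    rw [Complex.mem_slitPlane_iff] at h
    push Not at h
    refine ⟨c.re, h.1, ?_⟩
    simp only
    rw [← sliceEmb_ofReal J, sliceEmb_inj hJ]
    apply Complex.ext <;> simp [h.2]

theorem sliceEmb_mem_negRay {J : ℍ[ℝ]} (hJ : J ∈ unitSphere) {c : ℂ} :
    sliceEmb J c ∈ negRay ↔ c.re < 0 ∧ c.im = 0 := by
  constructor
  · rintro ⟨t, ht, h⟩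
    simp only at h
    rw [← sliceEmb_ofReal J, sliceEmb_inj hJ] at h
    rw [← h]
    exact ⟨ht, by simp⟩
  · intro h
    refine ⟨c.re, h.1, ?_⟩
    simp only
    rw [← sliceEmb_ofReal J, sliceEmb_inj hJ]
    apply Complex.ext <;> simp [h.2]

theorem sliceEmb_mem_posRay {J : ℍ[ℝ]} (hJ : J ∈ unitSphere) {c : ℂ} :
    sliceEmb J c ∈ posRay ↔ 0 < c.re ∧ c.im = 0 := by
  constructor
  · rintro ⟨t, ht, h⟩
    simp only at h
    rw [← sliceEmb_ofReal J, sliceEmb_inj hJ] at h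
    rw [← h]
    exact ⟨ht, by simp⟩
  · intro h
    refine ⟨c.re, h.1, ?_⟩
    simp only
    rw [← sliceEmb_ofReal J, sliceEmb_inj hJ]
    apply Complex.ext <;> simp [h.2]

theorem conj_mem_slitPlane {c : ℂ} : conj c ∈ Complex.slitPlane ↔ c ∈ Complex.slitPlane := by
  simp [Complex.mem_slitPlane_iff]

theorem log_conj_of_mem {c : ℂ} (h : c ∈ Complex.slitPlane) :
    Complex.log (conj c) = conj (Complex.log c) :=
  Complex.log_conj _ (Complex.mem_slitPlane_iff_arg.1 h).1

/-- Below the real line both `imUnit` and the argument change sign, so the product is unchanged. On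
the line the slit plane leaves only positive numbers, with argument 0, and the default value of
`imUnit` does not matter. -/
theorem qlog_sliceEmb {J : ℍ[ℝ]} (hJ : J ∈ unitSphere) {c : ℂ} (hc : c ∈ Complex.slitPlane) :
    qlog (sliceEmb J c) = sliceEmb J (Complex.log c) := by
  have h : sliceEmb J (Complex.log c) = ((Real.log ‖c‖ : ℝ) : ℍ[ℝ]) + c.arg • J := by
    rw [sliceEmb, Complex.log_re, Complex.log_im, Quaternion.mul_coe_eq_smul]
  rw [qlog, h, norm_sliceEmb hJ, sliceEmb_re hJ, norm_sliceEmb_im hJ]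
  congr 1
  rcases lt_trichotomy c.im 0 with h0 | h0 | h0
  · have e := fold_of_nonpos h0.le
    rw [fold] at e
    rw [imUnit_sliceEmb_neg hJ h0, e, Complex.arg_conj, if_neg (Complex.mem_slitPlane_iff_arg.1 hc).1]
    simp
  · rw [imUnit_sliceEmb_real hJ h0]
    have : c.arg = 0 := by
      rw [Complex.mem_slitPlane_iff] at hc
      exact Complex.arg_eq_zero_iff.2 ⟨(hc.resolve_right (fun h => h h0)).le, h0⟩
    rw [this]; simp
  · have e := fold_of_nonneg h0.le
    rw [fold] at e
    rw [imUnit_sliceEmb_pos hJ h0, e]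

/-- The stem function of the imaginary unit function. -/
noncomputable def unitStem (z : ℂ) : ℂ := (Real.sign z.im : ℂ) * Complex.I

/-- The stem function of the branch of index `n` of the logarithm. -/
noncomputable def logStem (n : ℤ) (h : ℂ → ℂ) (z : ℂ) : ℂ :=
  Complex.log ((-1 : ℝ) ^ n • h z) + ((n : ℝ) * Real.pi) • unitStem z

theorem sInd_imUnit (U : Set ℍ[ℝ]) : SInd imUnit unitStem U := by
  refine ⟨fun J hJ z _ => ?_, fun z _ => ?_⟩
  · rcases lt_trichotomy z.im 0 with h0 | h0 | h0
    · rw [imUnit_sliceEmb_neg hJ h0, unitStem, Real.sign_of_neg h0]; simp [sliceEmb]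
    · rw [imUnit_sliceEmb_real hJ h0, unitStem, h0]; simp
    · rw [imUnit_sliceEmb_pos hJ h0, unitStem, Real.sign_of_pos h0]; simp [sliceEmb]
  · simp [unitStem, Real.sign_neg]

theorem unitStem_of_pos {z : ℂ} (h : 0 < z.im) : unitStem z = Complex.I := by
  simp [unitStem, Real.sign_of_pos h]

section

variable {f : ℍ[ℝ] → ℍ[ℝ]} {h : ℂ → ℂ} {U : Set ℍ[ℝ]}

/-- Propagates conjugation-invariant conditions, such as membership in the slit plane, from the
upper half plane to the whole section. -/
theorem SInd.forall_of_up (hU : IsAxiallySymmetric U) (hf : SInd f h U) {P : ℂ → Prop}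
    (hP : ∀ c, P c → P (conj c)) (H : ∀ q ∈ U, P (h (up q))) {z : ℂ} (hz : z ∈ planeSection U) :
    P (h z) := by
  have h1 := H _ ((mem_planeSection hU coeI_mem).1 hz)
  rw [up_sliceEmb coeI_mem] at h1
  rcases le_total 0 z.im with h0 | h0
  · have e := fold_of_nonneg h0
    rw [fold] at e
    rwa [e] at h1
  · have e := fold_of_nonpos h0
    rw [fold] at e
    rw [e, hf.2 z hz] at h1
    simpa using hP _ h1

theorem SInd.qlog (hf : SInd f h U) (hs : ∀ z ∈ planeSection U, h z ∈ Complex.slitPlane) :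
    SInd (fun q => qlog (f q)) (fun z => Complex.log (h z)) U :=
  ⟨fun J hJ z hz => by beta_reduce; rw [hf.1 J hJ z hz, qlog_sliceEmb hJ (hs z hz)],
    fun z hz => by beta_reduce; rw [hf.2 z hz, log_conj_of_mem (hs z hz)]⟩

theorem SInd.logBranch (hf : SInd f h U) {n : ℤ}
    (hs : ∀ z ∈ planeSection U, (-1 : ℝ) ^ n • h z ∈ Complex.slitPlane) :
    SInd (logBranch n f) (logStem n h) U :=
  ((hf.smul ((-1 : ℝ) ^ n)).qlog hs).add ((sInd_imUnit U).smul _)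

theorem SInd.qsqrt (hf : SInd f h U) (hs : ∀ z ∈ planeSection U, h z ∈ Complex.slitPlane) :
    SInd (fun q => qsqrt (f q)) (fun z => Complex.exp ((2 : ℝ)⁻¹ • Complex.log (h z))) U := by
  have := (hf.qlog hs).smul (2 : ℝ)⁻¹
  refine ⟨fun J hJ z hz => ?_, fun z hz => ?_⟩
  · have h1 := this.1 J hJ z hz
    simp only at h1
    beta_reduce
    rw [StarLog.qsqrt, h1, exp_sliceEmb hJ]
  · have h1 := this.2 z hz
    simp only at h1
    beta_reduce
    rw [h1, Complex.exp_conj]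

theorem SInd.not_mem_nonposRay_iff (hU : IsAxiallySymmetric U) (hf : SInd f h U) :
    (∀ q ∈ U, f q ∉ nonposRay) ↔ ∀ z ∈ planeSection U, h z ∈ Complex.slitPlane := by
  constructor
  · intro H z hz
    have := H _ ((mem_planeSection hU coeI_mem).1 hz)
    rwa [hf.1 _ coeI_mem z hz, sliceEmb_mem_nonposRay coeI_mem, not_not] at this
  · intro H q hq
    obtain ⟨J, hJ, e⟩ := exists_sliceEmb_up q
    have hz := (up_mem_planeSection hU).2 hq
    rw [e, hf.1 J hJ _ hz, sliceEmb_mem_nonposRay hJ, not_not]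
    exact H _ hz

end

/-! ### The series for cosine, sine, μ and ν on slices -/

theorem qcos_sliceEmb {J : ℍ[ℝ]} (hJ : J ∈ unitSphere) (c : ℂ) :
    qcos (sliceEmb J c) = sliceEmb J (Complex.cos c) := by
  rw [← tsum_sliceEmb hJ (Complex.hasSum_cos c), qcos]
  refine tsum_congr fun m => ?_
  rw [← sliceEmb_pow hJ, ← sliceEmb_smul]
  congr 1
  rw [Complex.real_smul]
  push_cast
  ring

theorem qsin_sliceEmb {J : ℍ[ℝ]} (hJ : J ∈ unitSphere) (c : ℂ) :
    qsin (sliceEmb J c) = sliceEmb J (Complex.sin c) := by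
  rw [← tsum_sliceEmb hJ (Complex.hasSum_sin c), qsin]
  refine tsum_congr fun m => ?_
  rw [← sliceEmb_pow hJ, ← sliceEmb_smul]
  congr 1
  rw [Complex.real_smul]
  push_cast
  ring

theorem qmu_sliceEmb {J : ℍ[ℝ]} (hJ : J ∈ unitSphere) (c : ℂ) :
    qmu (sliceEmb J c) = sliceEmb J (cmu c) := by
  rw [cmu, ← tsum_sliceEmb hJ (summable_cmu c).hasSum, qmu]
  refine tsum_congr fun m => ?_
  rw [← sliceEmb_pow hJ, ← sliceEmb_smul]

theorem qnu_sliceEmb {J : ℍ[ℝ]} (hJ : J ∈ unitSphere) (c : ℂ) :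
    qnu (sliceEmb J c) = sliceEmb J (cnu c) := by
  rw [cnu, ← tsum_sliceEmb hJ (summable_cnu c).hasSum, qnu]
  refine tsum_congr fun m => ?_
  rw [← sliceEmb_pow hJ, ← sliceEmb_smul]

theorem SInd.qmu {f : ℍ[ℝ] → ℍ[ℝ]} {h : ℂ → ℂ} {U : Set ℍ[ℝ]} (hf : SInd f h U) :
    SInd (fun q => qmu (f q)) (fun z => cmu (h z)) U :=
  ⟨fun J hJ z hz => by beta_reduce; rw [hf.1 J hJ z hz, qmu_sliceEmb hJ],
    fun z hz => by beta_reduce; rw [hf.2 z hz, cmu_conj]⟩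

theorem SInd.qnu {f : ℍ[ℝ] → ℍ[ℝ]} {h : ℂ → ℂ} {U : Set ℍ[ℝ]} (hf : SInd f h U) :
    SInd (fun q => qnu (f q)) (fun z => cnu (h z)) U :=
  ⟨fun J hJ z hz => by beta_reduce; rw [hf.1 J hJ z hz, qnu_sliceEmb hJ],
    fun z hz => by beta_reduce; rw [hf.2 z hz, cnu_conj]⟩

theorem SInd.qcos {f : ℍ[ℝ] → ℍ[ℝ]} {h : ℂ → ℂ} {U : Set ℍ[ℝ]} (hf : SInd f h U) :
    SInd (fun q => qcos (f q)) (fun z => Complex.cos (h z)) U :=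
  ⟨fun J hJ z hz => by beta_reduce; rw [hf.1 J hJ z hz, qcos_sliceEmb hJ],
    fun z hz => by beta_reduce; rw [hf.2 z hz, Complex.cos_conj]⟩

theorem SInd.qsin {f : ℍ[ℝ] → ℍ[ℝ]} {h : ℂ → ℂ} {U : Set ℍ[ℝ]} (hf : SInd f h U) :
    SInd (fun q => qsin (f q)) (fun z => Complex.sin (h z)) U :=
  ⟨fun J hJ z hz => by beta_reduce; rw [hf.1 J hJ z hz, qsin_sliceEmb hJ],
    fun z hz => by beta_reduce; rw [hf.2 z hz, Complex.sin_conj]⟩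

/-! ### The principal inverse of `μ` -/

theorem int_eq_zero_of_mul_pi {k : ℤ} (h1 : -(2 * Real.pi) < 2 * k * Real.pi)
    (h2 : 2 * k * Real.pi < 2 * Real.pi) : k = 0 := by
  have hp := Real.pi_pos
  have a : (-1 : ℝ) < k := by
    by_contra hc
    nlinarith [mul_le_mul_of_nonneg_right (not_lt.1 hc) hp.le]
  have b : (k : ℝ) < 1 := by
    by_contra hc
    nlinarith [mul_le_mul_of_nonneg_right (not_lt.1 hc) hp.le]
  have a' : -1 < k := by exact_mod_cast a
  have b' : k < 1 := by exact_mod_cast b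
  omega

/-- Equal cosines mean w = 2kπ ± z, and the bounds on the real parts leave k = 0. Only the squares
are determined, since on the imaginary axis both z and -z lie in the strip. -/
theorem sq_eq_sq_of_cos_eq {z w : ℂ} (hz : 0 ≤ z.re) (hz' : z.re < Real.pi) (hw : 0 ≤ w.re)
    (hw' : w.re < Real.pi) (h : Complex.cos z = Complex.cos w) : z ^ 2 = w ^ 2 := by
  obtain ⟨k, hk | hk⟩ := Complex.cos_eq_cos_iff.1 h
  · have h1 := congrArg Complex.re hk
    simp at h1
    have hk0 : k = 0 := int_eq_zero_of_mul_pi (by linarith) (by linarith)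
    rw [hk, hk0]; simp
  · have h1 := congrArg Complex.re hk
    simp at h1
    have hk0 : k = 0 := int_eq_zero_of_mul_pi (by linarith) (by linarith)
    rw [hk, hk0]; simp

theorem sliceEmb_eq_of_im_eq_zero (J J' : ℍ[ℝ]) {c : ℂ} (h : c.im = 0) :
    sliceEmb J c = sliceEmb J' c := by
  simp [sliceEmb, h]

/-- The two points may lie in different slices. If the common value is not real, its imaginary part
fixes the unit up to sign, the sign being absorbed by conjugation; if it is real, so are the two
squares and the slice is irrelevant. -/
theorem injOn_qmu : Set.InjOn qmu muDom := by
  rintro _ ⟨q, ⟨hq1, hq2⟩, rfl⟩ _ ⟨q', ⟨hq1', hq2'⟩, rfl⟩ h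
  obtain ⟨J, hJ, e⟩ := exists_sliceEmb_up q
  obtain ⟨J', hJ', e'⟩ := exists_sliceEmb_up q'
  generalize hz : up q = z at e
  generalize hw : up q' = w at e'
  have z1 : z.re = q.re := by rw [← hz]; rfl
  have w1 : w.re = q'.re := by rw [← hw]; rfl
  rw [← z1] at hq1 hq2
  rw [← w1] at hq1' hq2'
  simp only [e, e', ← sliceEmb_pow hJ, ← sliceEmb_pow hJ'] at h ⊢
  rw [qmu_sliceEmb hJ, qmu_sliceEmb hJ', cmu_sq, cmu_sq] at h
  have him := congrArg Quaternion.im h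
  have hre := congrArg (·.re) h
  simp only [sliceEmb_im hJ, sliceEmb_im hJ', sliceEmb_re hJ, sliceEmb_re hJ'] at him hre
  -- A real cosine means cos x̄ = cos x, and x̄ lies in the strip too, so x² equals its conjugate.
  have key : ∀ x : ℂ, 0 ≤ x.re → x.re < Real.pi → (Complex.cos x).im = 0 → (x ^ 2).im = 0 := by
    intro x h1 h2 h3
    rw [← Complex.conj_eq_iff_im, ← Complex.cos_conj] at h3
    rw [← Complex.conj_eq_iff_im, map_pow]
    exact sq_eq_sq_of_cos_eq (by simpa using h1) (by simpa using h2) h1 h2 h3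
  have hn := congrArg norm him
  rw [norm_smul, norm_smul, norm_of_mem hJ, norm_of_mem hJ', mul_one, mul_one, Real.norm_eq_abs,
    Real.norm_eq_abs] at hn
  by_cases h0 : (Complex.cos z).im = 0
  · have h0' : (Complex.cos w).im = 0 := by rwa [h0, abs_zero, eq_comm, abs_eq_zero] at hn
    have hc : Complex.cos z = Complex.cos w := Complex.ext hre (h0.trans h0'.symm)
    rw [sq_eq_sq_of_cos_eq hq1 hq2 hq1' hq2' hc]
    exact sliceEmb_eq_of_im_eq_zero _ _ (key w hq1' hq2' h0')
  · rcases abs_eq_abs.1 hn with h1 | h1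
    · rw [← h1] at him
      have hJJ : J = J' := smul_right_injective _ h0 him
      have hc : Complex.cos z = Complex.cos w := Complex.ext hre h1
      rw [sq_eq_sq_of_cos_eq hq1 hq2 hq1' hq2' hc, hJJ]
    · have h2 : (Complex.cos w).im = -(Complex.cos z).im := by linarith
      rw [h2, neg_smul, ← smul_neg] at him
      have hJJ : J = -J' := smul_right_injective _ h0 him
      have hc : Complex.cos z = Complex.cos (conj w) := by
        rw [Complex.cos_conj]
        exact Complex.ext (by simpa using hre) (by simpa using h1)
      rw [sq_eq_sq_of_cos_eq hq1 hq2 (by simpa using hq1') (by simpa using hq2') hc, hJJ,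
        sliceEmb_neg_left]
      simp

/-- The square root with nonnegative real part has modulus, hence real part, less than π. -/
theorem sliceEmb_mem_muDom {J : ℍ[ℝ]} (hJ : J ∈ unitSphere) {c : ℂ} (hc : ‖c‖ < Real.pi ^ 2) :
    sliceEmb J c ∈ muDom := by
  obtain ⟨z, hz, hz0⟩ : ∃ z : ℂ, c = z ^ 2 ∧ 0 ≤ z.re := by
    obtain ⟨z, hz⟩ := exists_sq_eq c
    rcases le_total 0 z.re with h | h
    · exact ⟨z, hz, h⟩
    · exact ⟨-z, by rw [hz]; ring, by simpa using h⟩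
  refine ⟨sliceEmb J z, ⟨?_, ?_⟩, ?_⟩
  · rwa [sliceEmb_re hJ]
  · rw [sliceEmb_re hJ]
    rw [hz, norm_pow] at hc
    exact ((le_abs_self _).trans (Complex.abs_re_le_norm z)).trans_lt
      ((sq_lt_sq₀ (norm_nonneg _) Real.pi_pos.le).1 hc)
  · simp only [← sliceEmb_pow hJ, hz]

/-- Any solution of small modulus is the principal one, so the inverse chosen by `muInv` agrees with
an analytic local inverse. -/
theorem muInv_sliceEmb {J : ℍ[ℝ]} (hJ : J ∈ unitSphere) {c d : ℂ} (hc : ‖c‖ < Real.pi ^ 2)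
    (h : cmu c = d) : muInv (sliceEmb J d) = sliceEmb J c := by
  rw [← h, ← qmu_sliceEmb hJ]
  exact injOn_qmu.leftInvOn_invFunOn (sliceEmb_mem_muDom hJ hc)

theorem deriv_cmu_sq (σ : ℂ) (hσ : σ ≠ 0) : deriv cmu (σ ^ 2) = -cnu (σ ^ 2) / 2 := by
  have h1 : HasDerivAt (fun x : ℂ => cmu (x ^ 2)) (deriv cmu (σ ^ 2) * (2 * σ)) σ := by
    have h0 : HasDerivAt (fun x : ℂ => x ^ 2) (2 * σ) σ := by simpa using hasDerivAt_pow 2 σ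
    exact (differentiable_cmu (σ ^ 2)).hasDerivAt.comp σ h0
  have h2 : (fun x : ℂ => cmu (x ^ 2)) = Complex.cos := funext cmu_sq
  rw [h2] at h1
  have h3 := h1.unique (Complex.hasDerivAt_cos σ)
  rw [← cnu_sq_mul] at h3
  have : (deriv cmu (σ ^ 2) + cnu (σ ^ 2) / 2) * (2 * σ) = 0 := by linear_combination h3
  have h4 := (mul_eq_zero.1 this).resolve_right (by simp [hσ])
  linear_combination h4

/-- The chain rule for μ(σ²) = cos σ gives μ' = -ν/2 only away from 0; continuity of both sides
extends it. -/
theorem deriv_cmu_zero : deriv cmu 0 = -1 / 2 := by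
  have h1 : Continuous (deriv cmu) :=
    ((differentiable_cmu.contDiff (n := 1)).continuous_deriv le_rfl)
  have h2 : Continuous fun s => -cnu s / 2 := by
    have := differentiable_cnu.continuous
    fun_prop
  have h3 : Set.EqOn (deriv cmu) (fun s => -cnu s / 2) {0}ᶜ := by
    intro s hs
    obtain ⟨σ, rfl⟩ := exists_sq_eq s
    exact deriv_cmu_sq σ (fun h => hs (by simp [h]))
  have h4 := congrFun (h1.ext_on (dense_compl_singleton 0) h2 h3) 0
  rw [h4, cnu_zero]

/-- The local inverse of `μ` at `1 = μ 0`. -/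
theorem exists_local_inverse_cmu : ∃ κ : ℂ → ℂ, AnalyticAt ℂ κ 1 ∧ κ 1 = 0 ∧
    ∀ᶠ c in 𝓝 1, cmu (κ c) = c ∧ ‖κ c‖ < Real.pi ^ 2 ∧ cnu (κ c) ≠ 0 := by
  have ha : AnalyticAt ℂ cmu 0 := differentiable_cmu.analyticAt 0
  have hd : deriv cmu 0 ≠ 0 := by rw [deriv_cmu_zero]; norm_num
  have h1 := ha.analyticAt_localInverse hd
  have h2 := HasStrictDerivAt.eventually_right_inverse ha.hasStrictDerivAt hd
  have h3 : ha.hasStrictDerivAt.localInverse _ _ _ hd (cmu 0) = 0 :=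
    HasStrictFDerivAt.localInverse_apply_image ..
  rw [cmu_zero] at h1 h2 h3
  refine ⟨_, h1, h3, h2.and ?_⟩
  have hc := h1.continuousAt
  refine (hc.norm.eventually_lt continuousAt_const ?_).and
    ((differentiable_cnu.continuous.continuousAt.comp hc).eventually_ne ?_)
  · rw [h3, norm_zero]; positivity
  · rw [Function.comp_apply, h3, cnu_zero]; exact one_ne_zero

/-! ### Exponentials, classes and branches in terms of stem functions -/

/-- The form in which every logarithm below is verified: a complex combination of 1 and a vectorial
W, where n(bW) = b² n(W). -/
theorem expQ_add_mul (a b : ℂ) {W : ℍ[ℂ]} (hW : W.re = 0) :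
    expQ ((a : ℍ[ℂ]) + (b : ℍ[ℂ]) * W) = ((Complex.exp a : ℂ) : ℍ[ℂ]) *
      (((cmu (b ^ 2 * Quaternion.normSq W) : ℂ) : ℍ[ℂ]) +
        ((cnu (b ^ 2 * Quaternion.normSq W) * b : ℂ) : ℍ[ℂ]) * W) := by
  have h1 : ((a : ℍ[ℂ]) + (b : ℍ[ℂ]) * W).re = a := by simp [hW]
  have h2 : ((a : ℍ[ℂ]) + (b : ℍ[ℂ]) * W).im = (b : ℍ[ℂ]) * W := by
    ext1 <;> simp [hW]
  rw [expQ, h1, h2, map_mul, Quaternion.normSq_coe, Quaternion.coe_mul, mul_assoc]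

theorem expQ_add_mul_of_normSq_one (a b : ℂ) {W : ℍ[ℂ]} (hW : W.re = 0)
    (h1 : Quaternion.normSq W = 1) :
    expQ ((a : ℍ[ℂ]) + (b : ℍ[ℂ]) * W) = ((Complex.exp a : ℂ) : ℍ[ℂ]) *
      (((Complex.cos b : ℂ) : ℍ[ℂ]) + ((Complex.sin b : ℂ) : ℍ[ℂ]) * W) := by
  rw [expQ_add_mul a b hW, h1, mul_one, cmu_sq, cnu_sq_mul]

theorem expQ_coe (a : ℂ) : expQ (a : ℍ[ℂ]) = ((Complex.exp a : ℂ) : ℍ[ℂ]) := by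
  have := expQ_add_mul a 0 (W := 0) rfl
  simpa [cmu_zero] using this

section

variable {f g : ℍ[ℝ] → ℍ[ℝ]} {F G : ℂ → ℍ[ℂ]} {h k : ℂ → ℂ} {U : Set ℍ[ℝ]}

theorem SInd.starExpEq_iff (hU : IsAxiallySymmetric U) (hf : SInd f h U) (hg : SInd g k U) :
    StarExpEq f g U ↔ ∀ z ∈ planeSection U, Complex.exp (h z) = k z := by
  rw [StarLog.starExpEq_iff hU hf.ind hg.ind]
  simp only [expQ_coe, Quaternion.coe_inj]

theorem starExpEq_of_up (hU : IsAxiallySymmetric U) (hf : Ind f F U) (hg : Ind g G U)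
    (H : ∀ q ∈ U, expQ (F (up q)) = G (up q)) : StarExpEq f g U := by
  intro q hq
  obtain ⟨J, hJ, e⟩ := exists_sliceEmb_up q
  have hz := (up_mem_planeSection hU).2 hq
  rw [e, hg.1 J hJ _ hz, ← H _ hq]
  simp only [(hf.starPow hU _).1 J hJ _ hz]
  exact hasSum_phi_pow hJ _

theorem isHolomorphic_add {D : Set ℂ} (hF : IsHolomorphic F D) (hG : IsHolomorphic G D) :
    IsHolomorphic (fun z => F z + G z) D :=
  ⟨by simpa using hF.1.fun_add hG.1, by simpa using hF.2.1.fun_add hG.2.1,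
    by simpa using hF.2.2.1.fun_add hG.2.2.1, by simpa using hF.2.2.2.fun_add hG.2.2.2⟩

theorem isHolomorphic_coe_mul {D : Set ℂ} (hh : DifferentiableOn ℂ h D) (hG : IsHolomorphic G D) :
    IsHolomorphic (fun z => (h z : ℍ[ℂ]) * G z) D :=
  ⟨by simpa using hh.fun_mul hG.1, by simpa using hh.fun_mul hG.2.1,
    by simpa using hh.fun_mul hG.2.2.1, by simpa using hh.fun_mul hG.2.2.2⟩

theorem isHolomorphic_im {D : Set ℂ} (hF : IsHolomorphic F D) :
    IsHolomorphic (fun z => (F z).im) D :=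
  ⟨by simp, by simpa using hF.2.1, by simpa using hF.2.2.1, by simpa using hF.2.2.2⟩

theorem differentiableOn_normSq {D : Set ℂ} (hF : IsHolomorphic F D) :
    DifferentiableOn ℂ (fun z => Quaternion.normSq (F z)) D := by
  simp only [Quaternion.normSq_def']
  exact (((hF.1.pow 2).add (hF.2.1.pow 2)).add (hF.2.2.1.pow 2)).add (hF.2.2.2.pow 2)

theorem IsHolomorphic.mono {D D' : Set ℂ} (hF : IsHolomorphic F D) (h : D' ⊆ D) :
    IsHolomorphic F D' :=
  ⟨hF.1.mono h, hF.2.1.mono h, hF.2.2.1.mono h, hF.2.2.2.mono h⟩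

/-- A relation between the vectorial parts of stem functions over slice preserving functions
gives membership in the class. -/
theorem srClass_of_relation (hU : IsAxSymDomain U) (hf : Ind f F U)
    (hF : IsHolomorphic F (planeSection U)) (hg : Ind g G U) {a b : ℍ[ℝ] → ℍ[ℝ]} {α β : ℂ → ℂ}
    (ha : SInd a α U) (hα : DifferentiableOn ℂ α (planeSection U))
    (hb : SInd b β U) (hβ : DifferentiableOn ℂ β (planeSection U))
    (H : ∀ q ∈ U, (α (up q) : ℍ[ℂ]) * (F (up q)).im + (β (up q) : ℍ[ℂ]) * (G (up q)).im = 0)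
    (hne : ∃ q ∈ U, α (up q) ≠ 0 ∨ β (up q) ≠ 0)
    (h0 : (∀ q ∈ U, (G (up q)).im = 0) → ∀ q ∈ U, (F (up q)).im = 0) : SRClass f g U := by
  have hs := hU.2.2
  refine ⟨SR_iff.2 ⟨F, hf, hF⟩, fun hv => ?_, fun p hp => ⟨U, hU, hp, subset_rfl, a, b,
    (SRR_iff hs).2 ⟨α, ha, hα⟩, (SRR_iff hs).2 ⟨β, hb, hβ⟩, ?_, ?_⟩⟩
  · have h1 := h0 fun q hq => (hg.vecPart hs).eqOn_stem hs (ind_zero U) hv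
      ((up_mem_planeSection hs).2 hq)
    exact fun q hq => (hf.vecPart hs).eq_of_up hs (ind_zero U) hq (h1 q hq)
  · obtain ⟨q, hq, h | h⟩ := hne
    · exact Or.inl ⟨q, hq, fun h' => h ((ha.eq_zero_iff hs hq).1 h')⟩
    · exact Or.inr ⟨q, hq, fun h' => h ((hb.eq_zero_iff hs hq).1 h')⟩
  · intro q hq
    exact ((ha.mul_ind (hf.vecPart hs)).add (hb.mul_ind (hg.vecPart hs))).eq_of_up hs
      (ind_zero U) hq (H q hq)

end

/-! ### Branches of the logarithm -/

theorem planeSection_im_ne_zero {U : Set ℍ[ℝ]} (hU : IsAxiallySymmetric U)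
    (hr : Disjoint U realAxis) {z : ℂ} (hz : z ∈ planeSection U) : z.im ≠ 0 := by
  intro h0
  refine Set.disjoint_left.1 hr ((mem_planeSection hU coeI_mem).1 hz) (mem_realAxis_iff.2 ?_)
  rw [up_sliceEmb coeI_mem, h0, abs_zero]

theorem up_im_pos {U : Set ℍ[ℝ]} (hr : Disjoint U realAxis) {q : ℍ[ℝ]} (hq : q ∈ U) :
    0 < (up q).im :=
  (up_im_nonneg q).lt_of_ne fun h => Set.disjoint_left.1 hr hq (mem_realAxis_iff.2 h.symm)

/-- Off the real axis the stem is locally constant, equal to i above and -i below. -/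
theorem differentiableOn_unitStem {U : Set ℍ[ℝ]} (hU : IsAxiallySymmetric U)
    (hr : Disjoint U realAxis) : DifferentiableOn ℂ unitStem (planeSection U) := by
  intro z hz
  apply DifferentiableAt.differentiableWithinAt
  rcases (planeSection_im_ne_zero hU hr hz).lt_or_gt with h | h
  · refine (differentiableAt_const (-Complex.I)).congr_of_eventuallyEq ?_
    filter_upwards [(isOpen_lt Complex.continuous_im continuous_const).mem_nhds h] with w hw
    rw [unitStem, Real.sign_of_neg hw]; simp
  · refine (differentiableAt_const Complex.I).congr_of_eventuallyEq ?_
    filter_upwards [(isOpen_lt continuous_const Complex.continuous_im).mem_nhds h] with w hw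
    exact unitStem_of_pos hw

theorem exp_int_mul_unitStem (n : ℤ) {z : ℂ} (hz : z.im ≠ 0) :
    Complex.exp (((n : ℝ) * Real.pi) • unitStem z) = (-1) ^ n := by
  have key : ∀ m : ℤ, Complex.exp (m * (Real.pi * Complex.I)) = (-1) ^ m := by
    intro m
    rw [Complex.exp_int_mul, Complex.exp_pi_mul_I]
  rcases hz.lt_or_gt with h | h
  · have : ((n : ℝ) * Real.pi) • unitStem z = ((-n : ℤ) : ℂ) * (Real.pi * Complex.I) := by
      rw [unitStem, Real.sign_of_neg h, Complex.real_smul]; push_cast; ring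
    rw [this, key, zpow_neg, ← inv_zpow, inv_neg, inv_one]
  · have : ((n : ℝ) * Real.pi) • unitStem z = (n : ℂ) * (Real.pi * Complex.I) := by
      rw [unitStem_of_pos h, Complex.real_smul]; push_cast; ring
    rw [this, key]

/-- The sign (-1)^n put inside the logarithm is undone by e^{±nπi} = (-1)^n; the parity of n alone
matters. -/
theorem exp_logStem (n : ℤ) {h : ℂ → ℂ} {z : ℂ} (hz : z.im ≠ 0) (hh : h z ≠ 0) :
    Complex.exp (logStem n h z) = h z := by
  have h1 : (-1 : ℝ) ^ n • h z = (-1 : ℂ) ^ n * h z := by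
    rw [Complex.real_smul]; push_cast; rfl
  have h2 : (-1 : ℂ) ^ n ≠ 0 := zpow_ne_zero _ (by norm_num)
  rw [logStem, Complex.exp_add, exp_int_mul_unitStem n hz, h1,
    Complex.exp_log (mul_ne_zero h2 hh)]
  have h3 : (-1 : ℂ) ^ n * (-1) ^ n = 1 := by
    rw [← mul_zpow]; norm_num
  linear_combination (h z) * h3

section

variable {f : ℍ[ℝ] → ℍ[ℝ]} {h : ℂ → ℂ} {U : Set ℍ[ℝ]}

theorem smul_mem_slitPlane_iff_branchDefined (hU : IsAxiallySymmetric U) (hf : SInd f h U) (n : ℤ) :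
    BranchDefined n f U ↔ ∀ z ∈ planeSection U, (-1 : ℝ) ^ n • h z ∈ Complex.slitPlane :=
  (hf.smul ((-1 : ℝ) ^ n)).not_mem_nonposRay_iff hU

theorem ne_zero_of_smul_mem_slitPlane {n : ℤ} {c : ℂ}
    (h : (-1 : ℝ) ^ n • c ∈ Complex.slitPlane) : c ≠ 0 := by
  rintro rfl
  simp at h

theorem differentiableOn_logStem (hU : IsAxiallySymmetric U) (hr : Disjoint U realAxis) {n : ℤ}
    (hh : DifferentiableOn ℂ h (planeSection U))
    (hs : ∀ z ∈ planeSection U, (-1 : ℝ) ^ n • h z ∈ Complex.slitPlane) :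
    DifferentiableOn ℂ (logStem n h) (planeSection U) :=
  ((hh.fun_const_smul ((-1 : ℝ) ^ n)).clog hs).fun_add
    ((differentiableOn_unitStem hU hr).fun_const_smul _)

theorem mem_negRay_iff (hU : IsAxiallySymmetric U) (hf : SInd f h U) {q : ℍ[ℝ]} (hq : q ∈ U) :
    f q ∈ negRay ↔ (h (up q)).re < 0 ∧ (h (up q)).im = 0 := by
  obtain ⟨J, hJ, e⟩ := exists_sliceEmb_up q
  conv_lhs => rw [e, hf.1 J hJ _ ((up_mem_planeSection hU).2 hq)]
  exact sliceEmb_mem_negRay hJ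

theorem mem_posRay_iff (hU : IsAxiallySymmetric U) (hf : SInd f h U) {q : ℍ[ℝ]} (hq : q ∈ U) :
    f q ∈ posRay ↔ 0 < (h (up q)).re ∧ (h (up q)).im = 0 := by
  obtain ⟨J, hJ, e⟩ := exists_sliceEmb_up q
  conv_lhs => rw [e, hf.1 J hJ _ ((up_mem_planeSection hU).2 hq)]
  exact sliceEmb_mem_posRay hJ

theorem exists_branchIndex (f : ℍ[ℝ] → ℍ[ℝ]) (z₀ : ℍ[ℝ]) : ∃ n, BranchIndex f z₀ n := by
  by_cases h : f z₀ ∈ negRay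
  · exact ⟨1, by simp [BranchIndex, h]⟩
  · exact ⟨0, by simp [BranchIndex, h]⟩

theorem neg_one_zpow_eq {m n : ℤ} (h : Odd m ↔ Odd n) : (-1 : ℝ) ^ m = (-1 : ℝ) ^ n := by
  by_cases hm : Odd m
  · rw [hm.neg_one_zpow, (h.1 hm).neg_one_zpow]
  · rw [(Int.not_odd_iff_even.1 hm).neg_one_zpow,
      (Int.not_odd_iff_even.1 fun hn => hm (h.2 hn)).neg_one_zpow]

/-- A nonzero complex number off the negative ray lies in the slit plane, and the negative of one on
the ray does too. -/
theorem branchIndex_slitPlane (hU : IsAxiallySymmetric U) (hf : SInd f h U) {q : ℍ[ℝ]}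
    (hq : q ∈ U) (h0 : h (up q) ≠ 0) {n : ℤ} (hn : BranchIndex f q n) :
    (-1 : ℝ) ^ n • h (up q) ∈ Complex.slitPlane := by
  rw [BranchIndex, mem_negRay_iff hU hf hq] at hn
  by_cases ho : Odd n
  · have := hn.1 ho
    rw [ho.neg_one_zpow, Complex.mem_slitPlane_iff]
    left; simpa using this.1
  · rw [hn] at ho
    rw [Int.not_odd_iff_even.1 (fun h => ho (hn.1 h)) |>.neg_one_zpow, one_smul,
      Complex.mem_slitPlane_iff]
    by_contra hc
    push Not at hc
    refine ho ⟨lt_of_le_of_ne hc.1 fun h1 => h0 (Complex.ext h1 hc.2), hc.2⟩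

/-- Near a point all admissible branches are defined. -/
theorem eventually_branchDefined (hU : IsAxiallySymmetric U) (hf : SInd f h U) {q : ℍ[ℝ]}
    (hq : q ∈ U) (hc : ContinuousAt h (up q)) (h0 : h (up q) ≠ 0) :
    ∀ᶠ z in 𝓝 (up q), ∀ n, BranchIndex f q n → (-1 : ℝ) ^ n • h z ∈ Complex.slitPlane := by
  obtain ⟨m, hm⟩ := exists_branchIndex f q
  have h1 := branchIndex_slitPlane hU hf hq h0 hm
  have h2 : ∀ᶠ z in 𝓝 (up q), (-1 : ℝ) ^ m • h z ∈ Complex.slitPlane :=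
    (hc.const_smul ((-1 : ℝ) ^ m)).eventually_mem (Complex.isOpen_slitPlane.mem_nhds h1)
  filter_upwards [h2] with z hz n hn
  rwa [neg_one_zpow_eq (hn.trans hm.symm)]

theorem SInd.smul_mem_slitPlane (hU : IsAxiallySymmetric U) (hf : SInd f h U) (r : ℝ)
    (H : ∀ q ∈ U, r • h (up q) ∈ Complex.slitPlane) {z : ℂ} (hz : z ∈ planeSection U) :
    r • h z ∈ Complex.slitPlane :=
  hf.forall_of_up hU (P := fun c => r • c ∈ Complex.slitPlane)
    (fun c hc => by
      have := conj_mem_slitPlane.2 hc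
      simpa using this) H hz

end

/-- A holomorphic function with values in the zeros of an entire function is constant. -/
theorem eq_of_comp_eq_zero {U : Set ℍ[ℝ]} (hU : IsAxSymDomain U) {k P : ℂ → ℂ}
    (hk : DifferentiableOn ℂ k (planeSection U)) (hP : Differentiable ℂ P) {x : ℂ} (hx : P x ≠ 0)
    (H : ∀ z ∈ planeSection U, P (k z) = 0) {p q : ℍ[ℝ]} (hp : p ∈ U) (hq : q ∈ U) :
    k (up q) = k (up p) := by
  -- P is entire and not identically zero, so its zeros are isolated; by continuity k is constant
  -- near `up p`, and the identity theorem does the rest.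
  have h1 : ∀ᶠ w in 𝓝[≠] (k (up p)), P w ≠ 0 := by
    by_contra hc
    have ha : AnalyticOnNhd ℂ P Set.univ := fun w _ => hP.analyticAt w
    exact hx (ha.eqOn_zero_of_preconnected_of_frequently_eq_zero isPreconnected_univ
      (Set.mem_univ (k (up p))) (fun h' => hc h') (Set.mem_univ x))
  have hD := planeSection_mem_nhds hU.1 hU.2.2 hp
  have hc : ContinuousAt k (up p) := (hk.differentiableAt hD).continuousAt
  have h2 : ∀ᶠ z in 𝓝 (up p), k z = k (up p) := by
    filter_upwards [hc.eventually (eventually_nhdsWithin_iff.1 h1), hD] with z hz hzD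
    by_contra hne
    exact hz hne (H z hzD)
  have h3 := eq_zero_of_frequently hU (h := fun z => k z - k (up p))
    (hk.sub (differentiableOn_const _)) hp ?_ hq
  · exact sub_eq_zero.1 h3
  · refine (Eventually.frequently ?_)
    filter_upwards [h2.filter_mono nhdsWithin_le_nhds] with z hz
    rw [hz, sub_self]

/-! ### Slice preserving functions -/

section SlicePreserving

variable {Ω U : Set ℍ[ℝ]} {f g : ℍ[ℝ] → ℍ[ℝ]} {h k : ℂ → ℂ} {z₀ : ℍ[ℝ]}

theorem conj_up_of_mem_realAxis {x : ℍ[ℝ]} (hx : x ∈ realAxis) : conj (up x) = up x :=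
  Complex.conj_eq_iff_im.2 (mem_realAxis_iff.1 hx)

theorem SInd.im_eq_zero (hU : IsAxiallySymmetric U) (hf : SInd f h U) {x : ℍ[ℝ]} (hx : x ∈ U)
    (hr : x ∈ realAxis) : (h (up x)).im = 0 := by
  have := hf.2 _ ((up_mem_planeSection hU).2 hx)
  rw [conj_up_of_mem_realAxis hr] at this
  exact Complex.conj_eq_iff_im.1 this.symm

/-- At a real point the scalar stem of f is real, and the exponential of a real number is positive.
-/
theorem mem_posRay_of_starExpEq (hU : IsAxiallySymmetric U) (hg : SInd g k U) (hf : SRR f U)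
    (H : StarExpEq f g U) {x : ℍ[ℝ]} (hx : x ∈ U) (hr : x ∈ realAxis) : g x ∈ posRay := by
  obtain ⟨h, hh, -⟩ := (SRR_iff hU).1 hf
  rw [mem_posRay_iff hU hg hx, ← (hh.starExpEq_iff hU hg).1 H _ ((up_mem_planeSection hU).2 hx)]
  have h0 := hh.im_eq_zero hU hx hr
  have e : h (up x) = ((h (up x)).re : ℂ) := Complex.ext rfl (by simpa using h0)
  rw [e, ← Complex.ofReal_exp]
  exact ⟨by rw [Complex.ofReal_re]; exact Real.exp_pos _, Complex.ofReal_im _⟩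

theorem SRR_congr (hU : IsAxiallySymmetric U) (hf : SInd f h U)
    (hh : DifferentiableOn ℂ h (planeSection U)) : SRR f U := (SRR_iff hU).2 ⟨h, hf, hh⟩

/-- Two slice preserving logarithms differ by a constant multiple of `2 π i` on the upper half
plane. -/
theorem exists_int_of_exp_eq (hU : IsAxSymDomain U)
    (hh : DifferentiableOn ℂ h (planeSection U)) (hk : DifferentiableOn ℂ k (planeSection U))
    (H : ∀ z ∈ planeSection U, Complex.exp (h z) = Complex.exp (k z)) (hz₀ : z₀ ∈ U) :
    ∃ n : ℤ, ∀ q ∈ U, h (up q) = k (up q) + n * (2 * Real.pi * Complex.I) := by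
  have hs := hU.2.2
  obtain ⟨n, hn⟩ := Complex.exp_eq_exp_iff_exists_int.1 (H _ ((up_mem_planeSection hs).2 hz₀))
  refine ⟨n, fun q hq => ?_⟩
  -- The difference of the logarithms takes values in the zeros of e^w - 1, which is nonzero at πi.
  have := eq_of_comp_eq_zero hU (k := fun z => h z - k z) (P := fun w => Complex.exp w - 1)
    (x := Real.pi * Complex.I)
    (hh.sub hk) (Complex.differentiable_exp.sub_const 1) (by rw [Complex.exp_pi_mul_I]; norm_num)
    (fun z hz => by
      rw [Complex.exp_sub, H z hz, div_self (Complex.exp_ne_zero _), sub_self]) hz₀ hq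
  linear_combination this + hn

/-- A multiple of 2πi in the open upper half plane amounts to an even shift of the branch index, so
the parity condition on the index survives. -/
theorem log_eq_logStem (hz : 0 < (up z₀).im) {n m : ℤ} (h : ℂ → ℂ) :
    logStem n h (up z₀) + m * (2 * Real.pi * Complex.I) = logStem (n + 2 * m) h (up z₀) := by
  have e : (-1 : ℝ) ^ (n + 2 * m) = (-1 : ℝ) ^ n := neg_one_zpow_eq (by simp [Int.odd_add])
  rw [logStem, logStem, e, unitStem_of_pos hz, Complex.real_smul (x := (n : ℝ) * _),
    Complex.real_smul (x := ((n + 2 * m : ℤ) : ℝ) * _)]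
  push_cast
  ring

theorem BranchIndex.add_two_mul {n : ℤ} (hn : BranchIndex f z₀ n) (m : ℤ) :
    BranchIndex f z₀ (n + 2 * m) := by
  rw [BranchIndex] at hn ⊢
  rw [← hn]
  simp [Int.odd_add]

/-- The defined branches are exactly the slice preserving logarithms. -/
theorem logBranch_spec (hU : IsAxSymDomain U) (hr : Disjoint U realAxis) (hg : SInd g k U)
    (hk : DifferentiableOn ℂ k (planeSection U)) {n : ℤ}
    (hn : ∀ z ∈ planeSection U, (-1 : ℝ) ^ n • k z ∈ Complex.slitPlane) :
    SInd (logBranch n g) (logStem n k) U ∧ DifferentiableOn ℂ (logStem n k) (planeSection U) ∧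
      ∀ z ∈ planeSection U, Complex.exp (logStem n k z) = k z :=
  ⟨hg.logBranch hn, differentiableOn_logStem hU.2.2 hr hk hn, fun z hz =>
    exp_logStem n (planeSection_im_ne_zero hU.2.2 hr hz) (ne_zero_of_smul_mem_slitPlane (hn z hz))⟩

theorem exists_branch_tube (hΩ : IsAxSymDomain Ω) (hg : SInd g k Ω)
    (hk : DifferentiableOn ℂ k (planeSection Ω)) (hz₀ : z₀ ∈ Ω) (h0 : k (up z₀) ≠ 0)
    {P : ℂ → Prop} (hP : ∀ᶠ z in 𝓝 (up z₀), P z) :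
    ∃ ε, Adm (up z₀) ε ∧ IsBasicNhd (tube z₀ ε) z₀ Ω ∧ (∀ z ∈ Metric.ball (up z₀) ε, P z) ∧
      ∀ n, BranchIndex g z₀ n →
        ∀ z ∈ planeSection (tube z₀ ε), (-1 : ℝ) ^ n • k z ∈ Complex.slitPlane := by
  have hc : ContinuousAt k (up z₀) :=
    (hk.differentiableAt (planeSection_mem_nhds hΩ.1 hΩ.2.2 hz₀)).continuousAt
  obtain ⟨ε, h1, h2, h3⟩ := exists_tube hΩ.1 hΩ.2.2 hz₀
    (hP.and (eventually_branchDefined hΩ.2.2 hg hz₀ hc h0))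
  exact ⟨ε, h1, h2, fun z hz => (h3 z hz).1, fun n hn z hz =>
    (hg.mono h2.2.2).smul_mem_slitPlane h2.1.1.2.2 _ (fun q hq => (h3 _ hq).2 n hn) hz⟩

/-- Logarithms of a slice preserving function near a point off the real axis. -/
theorem slicePreserving_nonreal (hΩ : IsAxSymDomain Ω) (hg : SRR g Ω) (hg0 : ∀ q ∈ Ω, g q ≠ 0)
    (hz₀ : z₀ ∈ Ω) (hz : z₀ ∉ realAxis) :
    ∃ U, IsBasicNhd U z₀ Ω ∧ Disjoint U realAxis ∧
        (∀ n, BranchIndex g z₀ n → BranchDefined n g U ∧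
          SRR (logBranch n g) U ∧ StarExpEq (logBranch n g) g U) ∧
        (∀ f, SRR f U → StarExpEq f g U →
          ∃ n, BranchIndex g z₀ n ∧ Set.EqOn f (logBranch n g) U) := by
  obtain ⟨k, hk, hkd⟩ := (SRR_iff hΩ.2.2).1 hg
  have h0 : k (up z₀) ≠ 0 := fun h => hg0 z₀ hz₀ ((hk.eq_zero_iff hΩ.2.2 hz₀).2 h)
  obtain ⟨ε, h1, h2, -, h3⟩ := exists_branch_tube hΩ hk hkd hz₀ h0 (P := fun _ => True)
    (Eventually.of_forall fun _ => trivial)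
  have hU := h2.1.1
  have hs := hU.2.2
  have hr := disjoint_tube_realAxis h1 hz
  have hkU := hk.mono h2.2.2
  have hkdU := hkd.mono (planeSection_mono h2.2.2)
  refine ⟨_, h2, hr, fun n hn => ?_, fun f hf hfe => ?_⟩
  · obtain ⟨a1, a2, a3⟩ := logBranch_spec hU hr hkU hkdU (h3 n hn)
    exact ⟨(smul_mem_slitPlane_iff_branchDefined hs hkU n).2 (h3 n hn), SRR_congr hs a1 a2,
      (a1.starExpEq_iff hs hkU).2 a3⟩
  · obtain ⟨n, hn⟩ := exists_branchIndex g z₀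
    obtain ⟨a1, a2, a3⟩ := logBranch_spec hU hr hkU hkdU (h3 n hn)
    obtain ⟨h, hh, hhd⟩ := (SRR_iff hs).1 hf
    have h4 := (hh.starExpEq_iff hs hkU).1 hfe
    obtain ⟨m, hm⟩ := exists_int_of_exp_eq hU hhd a2 (fun z hz => (h4 z hz).trans (a3 z hz).symm)
      h2.2.1
    have hn' := hn.add_two_mul m
    refine ⟨_, hn', fun q hq => ?_⟩
    refine hh.eq_of_up hs (logBranch_spec hU hr hkU hkdU (h3 _ hn')).1 hq ?_
    rw [hm q hq, log_eq_logStem (up_im_pos hr hq)]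

/-- Logarithms of a slice preserving function near a real point where it is positive. -/
theorem slicePreserving_real_pos (hΩ : IsAxSymDomain Ω) (hg : SRR g Ω)
    (hz₀ : z₀ ∈ Ω) (hz : z₀ ∈ realAxis) (hpos : g z₀ ∈ posRay) :
    ∃ U, IsBasicNhd U z₀ Ω ∧ (∀ q ∈ U, g q ∉ nonposRay) ∧
        SRR (fun q => qlog (g q)) U ∧ StarExpEq (fun q => qlog (g q)) g U ∧
        (∀ f, SRR f U → StarExpEq f g U → Set.EqOn f (fun q => qlog (g q)) U) := by
  obtain ⟨k, hk, hkd⟩ := (SRR_iff hΩ.2.2).1 hg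
  have hp := (mem_posRay_iff hΩ.2.2 hk hz₀).1 hpos
  have hc : ContinuousAt k (up z₀) :=
    (hkd.differentiableAt (planeSection_mem_nhds hΩ.1 hΩ.2.2 hz₀)).continuousAt
  obtain ⟨ε, h1, h2, h3⟩ := exists_tube hΩ.1 hΩ.2.2 hz₀
    (hc.eventually_mem (Complex.isOpen_slitPlane.mem_nhds (Complex.mem_slitPlane_iff.2
      (Or.inl hp.1))))
  have hU := h2.1.1
  have hs := hU.2.2
  have hkU := hk.mono h2.2.2
  have hkdU := hkd.mono (planeSection_mono h2.2.2)
  have hsl : ∀ z ∈ planeSection (tube z₀ ε), k z ∈ Complex.slitPlane := fun z hz =>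
    hkU.forall_of_up hs (P := fun c => c ∈ Complex.slitPlane) (fun c => conj_mem_slitPlane.2) (fun q hq => h3 _ hq) hz
  have hl := hkU.qlog hsl
  have hld := hkdU.clog hsl
  have he : ∀ z ∈ planeSection (tube z₀ ε), Complex.exp (Complex.log (k z)) = k z :=
    fun z hz => Complex.exp_log (Complex.slitPlane_ne_zero (hsl z hz))
  refine ⟨_, h2, (hkU.not_mem_nonposRay_iff hs).2 hsl, SRR_congr hs hl hld,
    (hl.starExpEq_iff hs hkU).2 he, fun f hf hfe q hq => ?_⟩
  obtain ⟨h, hh, hhd⟩ := (SRR_iff hs).1 hf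
  have h4 := (hh.starExpEq_iff hs hkU).1 hfe
  obtain ⟨m, hm⟩ := exists_int_of_exp_eq hU hhd hld (fun z hz => (h4 z hz).trans (he z hz).symm)
    h2.2.1
  refine hh.eq_of_up hs hl hq ?_
  -- At the real point z₀ both logarithms are real, which leaves no room for a multiple of 2πi.
  have h5 := congrArg Complex.im (hm z₀ h2.2.1)
  have h6 := hl.im_eq_zero hs h2.2.1 hz
  rw [Complex.add_im, hh.im_eq_zero hs h2.2.1 hz, h6] at h5
  have h7 : (m : ℂ) = 0 := by
    simp [Real.pi_ne_zero] at h5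
    simp [h5]
  rw [hm q hq, h7, zero_mul, add_zero]

theorem exists_stem_of_SRV_one {w : ℍ[ℝ] → ℍ[ℝ]} (hU : IsAxiallySymmetric U) (hw : SRV w U)
    (h1 : ∀ q ∈ U, symmetrization w q = 1) : ∃ W, Ind w W U ∧ IsHolomorphic W (planeSection U) ∧
      (∀ z ∈ planeSection U, (W z).re = 0) ∧
      ∀ z ∈ planeSection U, Quaternion.normSq (W z) = 1 := by
  obtain ⟨W, hW, hWd, hW0⟩ := (SRV_iff hU).1 hw
  exact ⟨W, hW, hWd, hW0, fun z hz =>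
    (hW.symmetrization hU).eqOn_stem hU (sInd_one U) h1 hz⟩

theorem im_coe_add_mul (a b : ℂ) {W : ℍ[ℂ]} (hW : W.re = 0) :
    ((a : ℍ[ℂ]) + (b : ℍ[ℂ]) * W).im = (b : ℍ[ℂ]) * W := by
  ext1 <;> simp [hW]

theorem im_eq_self {W : ℍ[ℂ]} (hW : W.re = 0) : W.im = W := by
  ext1 <;> simp [hW]

/-- Logarithms of a slice preserving function near a real point where it is negative. -/
theorem slicePreserving_real_neg (hΩ : IsAxSymDomain Ω) (hg : SRR g Ω)
    (hz₀ : z₀ ∈ Ω) (hneg : g z₀ ∈ negRay) :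
    ∃ U, IsBasicNhd U z₀ Ω ∧ (∀ q ∈ U, -g q ∉ nonposRay) ∧
        (∀ V w, IsAxSymDomain V → V ⊆ U → SRV w V → (∀ q ∈ V, symmetrization w q = 1) → ∀ n : ℤ,
          SRClass (fun q => qlog (-g q) + ((2 * (n : ℝ) + 1) * Real.pi) • w q) w V ∧
          StarExpEq (fun q => qlog (-g q) + ((2 * (n : ℝ) + 1) * Real.pi) • w q) g V) := by
  obtain ⟨k, hk, hkd⟩ := (SRR_iff hΩ.2.2).1 hg
  have hp := (mem_negRay_iff hΩ.2.2 hk hz₀).1 hneg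
  have hc : ContinuousAt k (up z₀) :=
    (hkd.differentiableAt (planeSection_mem_nhds hΩ.1 hΩ.2.2 hz₀)).continuousAt
  obtain ⟨ε, h1, h2, h3⟩ := exists_tube hΩ.1 hΩ.2.2 hz₀
    (hc.neg.eventually_mem (Complex.isOpen_slitPlane.mem_nhds (Complex.mem_slitPlane_iff.2
      (Or.inl (by simpa using hp.1)))))
  have hU := h2.1.1
  have hkU := (hk.mono h2.2.2)
  have hsl : ∀ z ∈ planeSection (tube z₀ ε), -k z ∈ Complex.slitPlane := fun z hz =>
    hkU.neg.forall_of_up hU.2.2 (P := fun c => c ∈ Complex.slitPlane)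
      (fun c => conj_mem_slitPlane.2) (fun q hq => h3 _ hq) hz
  refine ⟨_, h2, (hkU.neg.not_mem_nonposRay_iff hU.2.2).2 hsl, fun V w hV hVU hw hw1 n => ?_⟩
  have hs := hV.2.2
  obtain ⟨W, hW, hWd, hW0, hW1⟩ := exists_stem_of_SRV_one hs hw hw1
  have hkV := hkU.mono hVU
  have hslV : ∀ z ∈ planeSection V, -k z ∈ Complex.slitPlane := fun z hz => hsl z (hVU hz)
  have hl := hkV.neg.qlog hslV
  have hld : DifferentiableOn ℂ (fun z => Complex.log (-k z)) (planeSection V) :=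
    (hkd.mono (planeSection_mono (hVU.trans h2.2.2))).fun_neg.clog hslV
  have hcst := sInd_coe ((2 * (n : ℝ) + 1) * Real.pi) V
  have hF := (hl.ind.add (hcst.mul_ind hW)).congr hs
    (f' := fun q => qlog (-g q) + ((2 * (n : ℝ) + 1) * Real.pi) • w q)
    (fun q _ => by rw [Quaternion.coe_mul_eq_smul]) (fun z _ => rfl)
  have hFd := isHolomorphic_add (isHolomorphic_coe hld)
    (isHolomorphic_coe_mul (h := fun _ => (((2 * (n : ℝ) + 1) * Real.pi : ℝ) : ℂ))
      (differentiableOn_const _) hWd)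
  obtain ⟨p, hp⟩ := hV.2.1.nonempty
  refine ⟨srClass_of_relation hV hF hFd hW (sInd_one V) (differentiableOn_const _) hcst.neg
    (differentiableOn_const _) ?_ ⟨p, hp, Or.inl one_ne_zero⟩ ?_,
    starExpEq_of_up hs hF hkV.ind ?_⟩
  · intro q hq
    have h0 := hW0 _ ((up_mem_planeSection hs).2 hq)
    rw [im_coe_add_mul _ _ h0, im_eq_self h0]
    simp
  · intro H q hq
    have h0 := hW0 _ ((up_mem_planeSection hs).2 hq)
    have h1 := H q hq
    rw [im_eq_self h0] at h1
    rw [im_coe_add_mul _ _ h0, h1, mul_zero]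
  · intro q hq
    have hz := (up_mem_planeSection hs).2 hq
    rw [expQ_add_mul_of_normSq_one _ _ (hW0 _ hz) (hW1 _ hz),
      Complex.exp_log (Complex.slitPlane_ne_zero (hslV _ hz))]
    -- An odd multiple of π has cosine -1 and sine 0, so w disappears and -(-g) = g remains.
    have e : (((2 * (n : ℝ) + 1) * Real.pi : ℝ) : ℂ) = Real.pi + n * (2 * Real.pi) := by
      push_cast; ring
    rw [e, Complex.cos_add_int_mul_two_pi, Complex.sin_add_int_mul_two_pi, Complex.cos_pi,
      Complex.sin_pi]
    simp

end SlicePreserving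

/-! ### Vectorial parts: identity theorem and the isotropic case -/

section Vector

variable {Ω U V : Set ℍ[ℝ]} {f g : ℍ[ℝ] → ℍ[ℝ]} {F G : ℂ → ℍ[ℂ]} {z₀ p : ℍ[ℝ]}

theorem expQ_re (Z : ℍ[ℂ]) :
    (expQ Z).re = Complex.exp Z.re * cmu (Quaternion.normSq Z.im) := by
  simp [expQ]

theorem expQ_im (Z : ℍ[ℂ]) : (expQ Z).im =
    ((Complex.exp Z.re * cnu (Quaternion.normSq Z.im) : ℂ) : ℍ[ℂ]) * Z.im := by
  ext1 <;> simp [expQ, mul_assoc]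

theorem normSq_eq_re_add_im (Z : ℍ[ℂ]) :
    Quaternion.normSq Z = Z.re ^ 2 + Quaternion.normSq Z.im := by
  simp only [Quaternion.normSq_def', Quaternion.re_im, Quaternion.imI_im, Quaternion.imJ_im,
    Quaternion.imK_im]
  ring

theorem exists_up_im_ne_zero (hΩ : IsAxiallySymmetric Ω) (hg : Ind g G Ω)
    (hv : ∃ q ∈ Ω, vecPart g q ≠ 0) : ∃ q ∈ Ω, (G (up q)).im ≠ 0 := by
  obtain ⟨q, hq, h⟩ := hv
  exact ⟨q, hq, fun h' => h ((hg.vecPart hΩ).eq_of_up hΩ (ind_zero Ω) hq h')⟩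

theorem im_ne_zero_iff {Z : ℍ[ℂ]} : Z.im ≠ 0 ↔ Z.imI ≠ 0 ∨ Z.imJ ≠ 0 ∨ Z.imK ≠ 0 := by
  rw [ne_eq, Quaternion.ext_iff]
  simp
  tauto

theorem eventually_im_ne_zero (hΩ : IsAxSymDomain Ω) (hG : IsHolomorphic G (planeSection Ω))
    (hv : ∃ q ∈ Ω, (G (up q)).im ≠ 0) (hp : p ∈ Ω) : ∀ᶠ z in 𝓝[≠] (up p), (G z).im ≠ 0 := by
  obtain ⟨q, hq, h⟩ := hv
  rcases im_ne_zero_iff.1 h with h | h | h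
  · filter_upwards [eventually_ne_zero hΩ hG.2.1 hq h hp] with z hz
    exact im_ne_zero_iff.2 (Or.inl hz)
  · filter_upwards [eventually_ne_zero hΩ hG.2.2.1 hq h hp] with z hz
    exact im_ne_zero_iff.2 (Or.inr (Or.inl hz))
  · filter_upwards [eventually_ne_zero hΩ hG.2.2.2 hq h hp] with z hz
    exact im_ne_zero_iff.2 (Or.inr (Or.inr hz))

theorem forall_im_eq_zero_of_up (hU : IsAxiallySymmetric U) (hg : Ind g G U)
    (H : ∀ q ∈ U, (G (up q)).im = 0) {z : ℂ} (hz : z ∈ planeSection U) : (G z).im = 0 :=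
  (hg.vecPart hU).eqOn_stem hU (ind_zero U)
    (fun q hq => (hg.vecPart hU).eq_of_up hU (ind_zero U) hq (H q hq)) hz

/-- By the identity theorem, a vectorial part not identically zero on Ω cannot vanish on a smaller
open set. -/
theorem exists_up_im_ne_zero_of_subset (hΩ : IsAxSymDomain Ω) (hg : Ind g G Ω)
    (hG : IsHolomorphic G (planeSection Ω)) (hv : ∃ q ∈ Ω, (G (up q)).im ≠ 0)
    (hV : IsOpen V) (hs : IsAxiallySymmetric V) (hVΩ : V ⊆ Ω) (hp : p ∈ V) :
    ∃ q ∈ V, (G (up q)).im ≠ 0 := by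
  by_contra hc
  push Not at hc
  have hD : ∀ᶠ z in 𝓝[≠] (up p), z ∈ planeSection V :=
    nhdsWithin_le_nhds (planeSection_mem_nhds hV hs hp)
  obtain ⟨z, hz1, hz2⟩ := ((eventually_im_ne_zero hΩ hG hv (hVΩ hp)).and hD).exists
  exact hz1 (forall_im_eq_zero_of_up hs (hg.mono hVΩ) hc hz2)

/-- On real quaternions n is positive definite, so isotropic vectors other than 0 must have a
nontrivial ι-part. -/
theorem eq_zero_of_normSq_eq_zero {Z : ℍ[ℂ]} (hZ : stemIm Z = 0)
    (h : Quaternion.normSq Z = 0) : Z = 0 := by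
  have e : Quaternion.normSq (stemRe Z) = 0 := by
    have h1 := congrArg Complex.re h
    have a1 := congrArg (·.re) hZ
    have a2 := congrArg (·.imI) hZ
    have a3 := congrArg (·.imJ) hZ
    have a4 := congrArg (·.imK) hZ
    simp at a1 a2 a3 a4
    simp [Quaternion.normSq_def', pow_two, a1, a2, a3, a4] at h1
    simp [Quaternion.normSq_def', pow_two]
    linarith
  refine stem_ext ((Quaternion.normSq_eq_zero.1 e).trans ?_) (hZ.trans ?_) <;> ext <;> simp

/-- An isotropic value of the stem, zero or not, yields a zero of g somewhere on the corresponding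
sphere. -/
theorem normSq_ne_zero_of_nonvanishing (hΩ : IsAxiallySymmetric Ω) (hg : Ind g G Ω)
    (hg0 : ∀ q ∈ Ω, g q ≠ 0) {z : ℂ} (hz : z ∈ planeSection Ω) :
    Quaternion.normSq (G z) ≠ 0 := by
  intro h
  by_cases h0 : stemIm (G z) = 0
  · have := eq_zero_of_normSq_eq_zero h0 h
    refine hg0 _ ((mem_planeSection hΩ coeI_mem).1 hz) ?_
    rw [hg.1 _ coeI_mem z hz, this, ← Quaternion.coe_zero, phi_coe, sliceEmb_zero]
  · obtain ⟨J, hJ, h1⟩ := exists_phi_eq_zero h h0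
    exact hg0 _ ((mem_planeSection hΩ hJ).1 hz) (by rw [hg.1 J hJ z hz, h1])

theorem normSq_im_eq_zero (hΩ : IsAxiallySymmetric Ω) (hg : Ind g G Ω)
    (hs : ∀ q ∈ Ω, symmetrization (vecPart g) q = 0) {z : ℂ} (hz : z ∈ planeSection Ω) :
    Quaternion.normSq (G z).im = 0 :=
  ((hg.vecPart hΩ).symmetrization hΩ).eqOn_stem hΩ (sInd_zero Ω) hs hz

/-- Along the real axis the stem is real and n is definite, so G_v would vanish on a real interval,
against the isolation of its zeros. -/
theorem disjoint_realAxis_of_isotropic (hΩ : IsAxSymDomain Ω) (hg : Ind g G Ω)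
    (hG : IsHolomorphic G (planeSection Ω)) (hv : ∃ q ∈ Ω, (G (up q)).im ≠ 0)
    (hs : ∀ z ∈ planeSection Ω, Quaternion.normSq (G z).im = 0) : Disjoint Ω realAxis := by
  rw [Set.disjoint_left]
  intro x hx hr
  have hD : ∀ᶠ z in 𝓝[≠] (up x), z ∈ planeSection Ω :=
    nhdsWithin_le_nhds (planeSection_mem_nhds hΩ.1 hΩ.2.2 hx)
  have h1 := (eventually_im_ne_zero hΩ hG hv hx).and hD
  have e : up x = ((x.re : ℝ) : ℂ) := Complex.ext rfl (by simpa using mem_realAxis_iff.1 hr)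
  rw [e] at h1
  have ht : Tendsto (fun t : ℝ => (t : ℂ)) (𝓝[≠] x.re) (𝓝[≠] ((x.re : ℝ) : ℂ)) :=
    tendsto_nhdsWithin_of_tendsto_nhds_of_eventually_within _
      (Complex.continuous_ofReal.continuousAt.tendsto.mono_left nhdsWithin_le_nhds)
      (by filter_upwards [self_mem_nhdsWithin] with t ht
          simpa using ht)
  obtain ⟨t, ht1, ht2⟩ := (ht.eventually h1).exists
  refine ht1 (eq_zero_of_normSq_eq_zero ?_ (hs _ ht2))
  exact stemIm_eq_zero_of_conj (F := fun z => (G z).im) ((hg.vecPart hΩ.2.2).2 _ ht2) (Complex.ofReal_im t)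

/-- Logarithms of a function whose vectorial part is isotropic. -/
theorem isotropic_case (hΩ : IsAxSymDomain Ω) (hg : SR g Ω) (hg0 : ∀ q ∈ Ω, g q ≠ 0)
    (hz₀ : z₀ ∈ Ω) (hv : ∃ q ∈ Ω, vecPart g q ≠ 0)
    (hiso : ∀ q ∈ Ω, symmetrization (vecPart g) q = 0) :
    Disjoint Ω realAxis ∧ (∀ q ∈ Ω, scalarPart g q ≠ 0) ∧
      ∃ U, IsBasicNhd U z₀ Ω ∧
        (∀ n, BranchIndex (scalarPart g) z₀ n → BranchDefined n (scalarPart g) U ∧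
          SRClass (fun q => logBranch n (scalarPart g) q + (scalarPart g q)⁻¹ * vecPart g q) g U ∧
          StarExpEq (fun q => logBranch n (scalarPart g) q + (scalarPart g q)⁻¹ * vecPart g q)
            g U) ∧
        (∀ f, SR f U → StarExpEq f g U → ∃ n, BranchIndex (scalarPart g) z₀ n ∧
          Set.EqOn f
            (fun q => logBranch n (scalarPart g) q + (scalarPart g q)⁻¹ * vecPart g q) U) := by
  have hsΩ := hΩ.2.2
  obtain ⟨G, hG, hGd⟩ := SR_iff.1 hg
  have hv' := exists_up_im_ne_zero hsΩ hG hv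
  have hN : ∀ z ∈ planeSection Ω, Quaternion.normSq (G z).im = 0 := fun z hz =>
    normSq_im_eq_zero hsΩ hG hiso hz
  have hrΩ := disjoint_realAxis_of_isotropic hΩ hG hGd hv' hN
  have hk0 : ∀ z ∈ planeSection Ω, (G z).re ≠ 0 := by
    intro z hz h
    apply normSq_ne_zero_of_nonvanishing hsΩ hG hg0 hz
    rw [normSq_eq_re_add_im, hN z hz, h]; simp
  have hkΩ := hG.scalarPart hsΩ
  obtain ⟨ε, h1, h2, -, h3⟩ := exists_branch_tube hΩ hkΩ hGd.1 hz₀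
    (hk0 _ ((up_mem_planeSection hsΩ).2 hz₀)) (P := fun _ => True)
    (Eventually.of_forall fun _ => trivial)
  refine ⟨hrΩ, fun q hq h => hk0 _ ((up_mem_planeSection hsΩ).2 hq)
    ((hkΩ.eq_zero_iff hsΩ hq).1 h), tube z₀ ε, h2, ?_⟩
  have hU := h2.1.1
  have hs := hU.2.2
  have hr : Disjoint (tube z₀ ε) realAxis := hrΩ.mono_left h2.2.2
  have hsub := planeSection_mono h2.2.2
  have hGU := hG.mono h2.2.2
  have hGdU := hGd.mono hsub
  have hkU := hkΩ.mono h2.2.2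
  obtain ⟨k, hk⟩ : ∃ k : ℂ → ℂ, k = fun z => (G z).re := ⟨_, rfl⟩
  have hk' : ∀ z, (G z).re = k z := fun z => by rw [hk]
  have hkd : DifferentiableOn ℂ k (planeSection (tube z₀ ε)) := hk ▸ hGdU.1
  simp only [hk'] at hkU h3 hk0
  have hid : DifferentiableOn ℂ (fun z => (k z)⁻¹) (planeSection (tube z₀ ε)) :=
    hkd.fun_inv fun z hz => hk0 z (hsub hz)
  have hL : ∀ n, BranchIndex (scalarPart g) z₀ n →
      Ind (fun q => logBranch n (scalarPart g) q + (scalarPart g q)⁻¹ * vecPart g q)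
        (fun z => (logStem n k z : ℍ[ℂ]) + (((k z)⁻¹ : ℂ) : ℍ[ℂ]) * (G z).im) (tube z₀ ε) :=
    fun n hn => (hkU.logBranch (h3 n hn)).ind.add (hkU.inv.mul_ind (hGU.vecPart hs))
  constructor
  · intro n hn
    obtain ⟨a1, a2, a3⟩ := logBranch_spec hU hr hkU hkd (h3 n hn)
    refine ⟨(smul_mem_slitPlane_iff_branchDefined hs hkU n).2 (h3 n hn),
      srClass_of_relation hU (hL n hn) (isHolomorphic_add (isHolomorphic_coe a2)
        (isHolomorphic_coe_mul hid (isHolomorphic_im hGdU))) hGU (sInd_one _)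
        (differentiableOn_const _) hkU.inv.neg hid.neg ?_ ⟨z₀, h2.2.1, Or.inl one_ne_zero⟩ ?_,
      starExpEq_of_up hs (hL n hn) hGU ?_⟩
    · intro q hq
      rw [im_coe_add_mul _ _ (by simp)]
      simp
    · intro H q hq
      rw [im_coe_add_mul _ _ (by simp), H q hq, mul_zero]
    · intro q hq
      have hz := (up_mem_planeSection hs).2 hq
      rw [expQ_add_mul _ _ (by simp), hN _ (hsub hz), mul_zero, cmu_zero, cnu_zero, one_mul,
        a3 _ hz, mul_add, ← mul_assoc, ← Quaternion.coe_mul, ← Quaternion.coe_mul, mul_one,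
        mul_inv_cancel₀ (hk0 _ (hsub hz)), Quaternion.coe_one, one_mul, ← hk',
        Quaternion.re_add_im]
  · intro f hf hfe
    obtain ⟨F, hF, hFd⟩ := SR_iff.1 hf
    have hE := (starExpEq_iff hs hF hGU).1 hfe
    have hsd := differentiableOn_normSq (isHolomorphic_im hFd)
    -- Taking n of G_v = e^{F₀} ν(n(F_v)) F_v gives 0 = e^{2F₀} ν² n(F_v).
    have hP : ∀ z ∈ planeSection (tube z₀ ε), cnu (Quaternion.normSq (F z).im) ^ 2 *
        Quaternion.normSq (F z).im = 0 := by
      intro z hz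
      have := hN z (hsub hz)
      rw [← hE z hz, expQ_im, map_mul, Quaternion.normSq_coe, mul_pow, mul_assoc] at this
      exact (mul_eq_zero.1 this).resolve_left (pow_ne_zero _ (Complex.exp_ne_zero _))
    -- A point where ν(x)² x is nonzero: at x = (π/2)² it is sin²(π/2) = 1.
    have hx : cnu ((Real.pi / 2 : ℂ) ^ 2) ^ 2 * (Real.pi / 2 : ℂ) ^ 2 ≠ 0 := by
      rw [← mul_pow, cnu_sq_mul, Complex.sin_pi_div_two]; norm_num
    have hconst : ∀ q ∈ tube z₀ ε, Quaternion.normSq (F (up q)).im =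
        Quaternion.normSq (F (up z₀)).im := fun q hq =>
      eq_of_comp_eq_zero hU (P := fun x => cnu x ^ 2 * x) hsd
        ((differentiable_cnu.pow 2).mul differentiable_id) hx hP h2.2.1 hq
    -- A nonzero constant value of n(F_v) would be a zero of ν, and then G_v would vanish on the
    -- whole tube.
    have hs0 : Quaternion.normSq (F (up z₀)).im = 0 := by
      by_contra hne
      have h4 := hP _ ((up_mem_planeSection hs).2 h2.2.1)
      have h5 : cnu (Quaternion.normSq (F (up z₀)).im) = 0 := by simpa [hne] using h4
      obtain ⟨q, hq, hq0⟩ := exists_up_im_ne_zero_of_subset hΩ hG hGd hv' hU.1 hs h2.2.2 h2.2.1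
      apply hq0
      rw [← hE _ ((up_mem_planeSection hs).2 hq), expQ_im, hconst q hq, h5]
      simp
    have hsz : ∀ z ∈ planeSection (tube z₀ ε), Quaternion.normSq (F z).im = 0 := fun z hz =>
      ((hF.vecPart hs).symmetrization hs).forall_of_up hs (P := fun c => c = 0)
        (fun c hc => by simp [hc]) (fun q hq => (hconst q hq).trans hs0) hz
    have hexp : ∀ z ∈ planeSection (tube z₀ ε), Complex.exp (F z).re = k z := by
      intro z hz
      rw [← hk', ← hE z hz, expQ_re, hsz z hz, cmu_zero, mul_one]
    obtain ⟨n, hn⟩ := exists_branchIndex (scalarPart g) z₀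
    obtain ⟨a1, a2, a3⟩ := logBranch_spec hU hr hkU hkd (h3 n hn)
    obtain ⟨m, hm⟩ := exists_int_of_exp_eq hU hFd.1 a2
      (fun z hz => (hexp z hz).trans (a3 z hz).symm) h2.2.1
    have hn' := hn.add_two_mul m
    refine ⟨_, hn', fun q hq => hF.eq_of_up hs (hL _ hn') hq ?_⟩
    have hz := (up_mem_planeSection hs).2 hq
    have e1 : (F (up q)).im = (((k (up q))⁻¹ : ℂ) : ℍ[ℂ]) * (G (up q)).im := by
      rw [← hE _ hz, expQ_im, hsz _ hz, cnu_zero, mul_one, hexp _ hz, ← mul_assoc,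
        ← Quaternion.coe_mul, inv_mul_cancel₀ (hk0 _ (hsub hz)), Quaternion.coe_one, one_mul]
    rw [← Quaternion.re_add_im (F (up q)), e1, hm q hq, log_eq_logStem (up_im_pos hr hq)]

end Vector

/-! ### Germs at a point of the closed upper half plane -/

/-- An analytic germ at `a`, conjugation equivariant if `a` is real. -/
def SymGerm (a : ℂ) (u : ℂ → ℂ) : Prop :=
  AnalyticAt ℂ u a ∧ (a.im = 0 → ∀ᶠ z in 𝓝 a, u (conj z) = conj (u z))

/-- The condition defining germs, at the single point `z`. -/
def GoodAt (a : ℂ) (u : ℂ → ℂ) (z : ℂ) : Prop :=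
  AnalyticAt ℂ u z ∧ (a.im = 0 → u (conj z) = conj (u z))

section Germs

variable {a : ℂ} {u v : ℂ → ℂ}

theorem SymGerm.eventually (h : SymGerm a u) : ∀ᶠ z in 𝓝 a, GoodAt a u z := by
  by_cases ha : a.im = 0
  · filter_upwards [h.1.eventually_analyticAt, h.2 ha] with z h1 h2 using ⟨h1, fun _ => h2⟩
  · filter_upwards [h.1.eventually_analyticAt] with z h1 using ⟨h1, fun h => absurd h ha⟩

theorem SymGerm.conj_eq (h : SymGerm a u) (ha : a.im = 0) : (u a).im = 0 := by
  have := (h.2 ha).self_of_nhds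
  rw [Complex.conj_eq_iff_im.2 ha] at this
  exact Complex.conj_eq_iff_im.1 this.symm

theorem SymGerm.add (hu : SymGerm a u) (hv : SymGerm a v) : SymGerm a fun z => u z + v z :=
  ⟨hu.1.add hv.1, fun ha => by
    filter_upwards [hu.2 ha, hv.2 ha] with z h1 h2
    rw [h1, h2, map_add]⟩

theorem SymGerm.mul (hu : SymGerm a u) (hv : SymGerm a v) : SymGerm a fun z => u z * v z :=
  ⟨hu.1.mul hv.1, fun ha => by
    filter_upwards [hu.2 ha, hv.2 ha] with z h1 h2
    rw [h1, h2, map_mul]⟩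

theorem SymGerm.pow (hu : SymGerm a u) (n : ℕ) : SymGerm a fun z => u z ^ n :=
  ⟨hu.1.pow n, fun ha => by
    filter_upwards [hu.2 ha] with z h1
    rw [h1, map_pow]⟩

theorem SymGerm.div (hu : SymGerm a u) (hv : SymGerm a v) (h0 : v a ≠ 0) :
    SymGerm a fun z => u z / v z :=
  ⟨hu.1.div hv.1 h0, fun ha => by
    filter_upwards [hu.2 ha, hv.2 ha] with z h1 h2
    rw [h1, h2, map_div₀]⟩

theorem symGerm_sub_self (a : ℂ) : SymGerm a fun z => z - a :=
  ⟨by fun_prop, fun ha => Eventually.of_forall fun z => by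
    rw [map_sub, Complex.conj_eq_iff_im.2 ha]⟩

theorem eventually_conj {a : ℂ} (ha : a.im = 0) {P : ℂ → Prop} (h : ∀ᶠ z in 𝓝 a, P z) :
    ∀ᶠ z in 𝓝 a, P (conj z) := by
  have : Tendsto (fun z : ℂ => conj z) (𝓝 a) (𝓝 (conj a)) := Complex.continuous_conj.tendsto a
  rw [Complex.conj_eq_iff_im.2 ha] at this
  exact this.eventually h

/-- Square roots of germs. -/
theorem SymGerm.exists_sqrt (hu : SymGerm a u) (h0 : u a ≠ 0) (hpos : a.im = 0 → 0 < (u a).re) :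
    ∃ v, SymGerm a v ∧ (∀ᶠ z in 𝓝 a, v z ^ 2 = u z) ∧ v a ≠ 0 ∧ (a.im = 0 → 0 < (v a).re) := by
  by_cases ha : a.im = 0
  · have hs : u a ∈ Complex.slitPlane := Complex.mem_slitPlane_iff.2 (Or.inl (hpos ha))
    have hev : ∀ᶠ z in 𝓝 a, u z ∈ Complex.slitPlane :=
      hu.1.continuousAt.eventually_mem (Complex.isOpen_slitPlane.mem_nhds hs)
    -- At a real centre the principal logarithm is used because it commutes with conjugation.
    refine ⟨fun z => Complex.exp (Complex.log (u z) / 2),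
      ⟨((hu.1.clog hs).div_const).cexp, fun _ => ?_⟩, ?_, Complex.exp_ne_zero _, fun _ => ?_⟩
    · filter_upwards [hu.2 ha, hev] with z h1 h2
      rw [h1, log_conj_of_mem h2, ← Complex.exp_conj, map_div₀, map_ofNat]
    · filter_upwards [hev] with z hz
      rw [← Complex.exp_nat_mul]
      push_cast
      rw [mul_div_cancel₀ _ two_ne_zero, Complex.exp_log (Complex.slitPlane_ne_zero hz)]
    · have h1 := hu.conj_eq ha
      have e : u a = (((u a).re : ℝ) : ℂ) := Complex.ext rfl (by simpa using h1)
      have e2 : Complex.log (u a) / 2 = ((Real.log (u a).re / 2 : ℝ) : ℂ) := by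
        rw [e, ← Complex.ofReal_log (hpos ha).le]; simp
      beta_reduce
      rw [e2, ← Complex.ofReal_exp, Complex.ofReal_re]
      exact Real.exp_pos _
  · obtain ⟨κ, hκ⟩ := exists_sq_eq (u a)
    have hκ0 : κ ≠ 0 := by rintro rfl; apply h0; rw [hκ]; simp
    have hq : AnalyticAt ℂ (fun z => u z / u a) a := hu.1.div_const
    have hs : u a / u a ∈ Complex.slitPlane := by rw [div_self h0]; exact Complex.one_mem_slitPlane
    -- Off the real line no symmetry is required; dividing by u(a) moves the value at a to 1, inside
    -- the slit plane.
    refine ⟨fun z => κ * Complex.exp (Complex.log (u z / u a) / 2),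
      ⟨analyticAt_const.mul ((hq.clog hs).div_const).cexp, fun h => absurd h ha⟩, ?_,
      mul_ne_zero hκ0 (Complex.exp_ne_zero _), fun h => absurd h ha⟩
    filter_upwards [hu.1.continuousAt.eventually_ne h0] with z hz
    rw [mul_pow, ← Complex.exp_nat_mul]
    push_cast
    rw [mul_div_cancel₀ _ two_ne_zero, Complex.exp_log (div_ne_zero hz h0), ← hκ,
      mul_div_cancel₀ _ h0]

/-- Angles of germs on the complex circle `c ^ 2 + s ^ 2 = 1`. -/
theorem exists_angle {c s : ℂ → ℂ} (hc : SymGerm a c) (hs : SymGerm a s)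
    (h1 : ∀ᶠ z in 𝓝 a, c z ^ 2 + s z ^ 2 = 1) :
    ∃ φ, SymGerm a φ ∧ ∀ᶠ z in 𝓝 a, Complex.cos (φ z) = c z ∧ Complex.sin (φ z) = s z := by
  -- u = c + is plays the role of e^{iφ}, with inverse c - is; the angle is -i log u, the logarithm
  -- being centred at u(a).
  obtain ⟨u, hu⟩ : ∃ u : ℂ → ℂ, ∀ z, u z = c z + Complex.I * s z := ⟨_, fun _ => rfl⟩
  have hinv : ∀ z, c z ^ 2 + s z ^ 2 = 1 → u z * (c z - Complex.I * s z) = 1 := by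
    intro z hz
    rw [hu]
    linear_combination hz - s z ^ 2 * Complex.I_sq
  have hua : u a ≠ 0 := left_ne_zero_of_mul_eq_one (hinv a h1.self_of_nhds)
  have huan : AnalyticAt ℂ u a := by
    rw [funext hu]
    exact hc.1.add (analyticAt_const.mul hs.1)
  have hsl : u a / u a ∈ Complex.slitPlane := by
    rw [div_self hua]; exact Complex.one_mem_slitPlane
  have hev : ∀ᶠ z in 𝓝 a, u z / u a ∈ Complex.slitPlane :=
    (huan.div_const (c := u a)).continuousAt.eventually_mem (Complex.isOpen_slitPlane.mem_nhds hsl)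
  refine ⟨fun z => -Complex.I * (Complex.log (u a) + Complex.log (u z / u a)),
    ⟨analyticAt_const.mul (analyticAt_const.add (huan.div_const.clog hsl)), fun ha => ?_⟩, ?_⟩
  · have hcj : conj (u a) * u a = 1 := by
      have e1 := Complex.conj_eq_iff_im.2 (hc.conj_eq ha)
      have e2 := Complex.conj_eq_iff_im.2 (hs.conj_eq ha)
      rw [mul_comm, ← hinv a h1.self_of_nhds, hu]
      simp [e1, e2, sub_eq_add_neg]
    -- For real a the numbers c(a), s(a) are real, so |u(a)| = 1 and its logarithm is purely
    -- imaginary.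
    have hL : conj (Complex.log (u a)) = -Complex.log (u a) := by
      have hn : ‖u a‖ = 1 := by
        have := congrArg norm hcj
        rw [norm_mul, Complex.norm_conj, norm_one] at this
        nlinarith [norm_nonneg (u a)]
      have : Complex.log (u a) = (Complex.arg (u a) : ℂ) * Complex.I := by
        rw [Complex.log, hn]; simp
      rw [this]; simp
    filter_upwards [hc.2 ha, hs.2 ha, h1, hev] with z a1 a2 a3 a4
    -- Conjugation exchanges u with its inverse up to conjugating the argument; the factor -i then
    -- makes the angle symmetric.
    have e1 : u (conj z) = conj (u z)⁻¹ := by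
      rw [inv_eq_of_mul_eq_one_right (hinv z a3), hu, a1, a2]
      simp
    have e2 : u (conj z) / u a = conj (u z / u a)⁻¹ := by
      have h2 : conj (u a) = (u a)⁻¹ := eq_inv_of_mul_eq_one_left hcj
      rw [e1, inv_div, map_div₀, map_inv₀, div_eq_mul_inv, div_eq_mul_inv, h2, mul_comm]
    have hpi := (Complex.mem_slitPlane_iff_arg.1 a4).1
    have hinvs : (u z / u a)⁻¹ ∈ Complex.slitPlane := by
      rw [Complex.mem_slitPlane_iff_arg, Complex.arg_inv, if_neg hpi]
      exact ⟨fun h => by linarith [Complex.neg_pi_lt_arg (u z / u a)],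
        inv_ne_zero (Complex.slitPlane_ne_zero a4)⟩
    rw [e2, log_conj_of_mem hinvs, Complex.log_inv _ hpi, map_mul, map_add, hL]
    simp
    ring
  · filter_upwards [h1, hev] with z a3 a4
    have huz : u z ≠ 0 := left_ne_zero_of_mul_eq_one (hinv z a3)
    have e1 : Complex.exp (-Complex.I * (Complex.log (u a) + Complex.log (u z / u a)) *
        Complex.I) = u z := by
      have : -Complex.I * (Complex.log (u a) + Complex.log (u z / u a)) * Complex.I =
          Complex.log (u a) + Complex.log (u z / u a) := by
        linear_combination (-(Complex.log (u a) + Complex.log (u z / u a))) * Complex.I_sq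
      rw [this, Complex.exp_add, Complex.exp_log hua, Complex.exp_log (div_ne_zero huz hua),
        mul_div_cancel₀ _ hua]
    have e2 : Complex.exp (-(-Complex.I * (Complex.log (u a) + Complex.log (u z / u a))) *
        Complex.I) = c z - Complex.I * s z := by
      rw [neg_mul, Complex.exp_neg, e1]
      exact inv_eq_of_mul_eq_one_right (hinv z a3)
    rw [Complex.cos, Complex.sin, e1, e2, hu]
    constructor
    · ring
    · linear_combination (-s z) * Complex.I_sq

/-- A nonzero vector of germs is a power of `z - a` times a vector of germs not vanishing at
`a`. -/
theorem exists_factorization {x y t : ℂ → ℂ} (hx : SymGerm a x) (hy : SymGerm a y)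
    (ht : SymGerm a t) (h0 : ¬∀ᶠ z in 𝓝 a, (x z, y z, t z) = (0 : ℂ × ℂ × ℂ)) :
    ∃ h x' y' t', SymGerm a h ∧ SymGerm a x' ∧ SymGerm a y' ∧ SymGerm a t' ∧
      (x' a ≠ 0 ∨ y' a ≠ 0 ∨ t' a ≠ 0) ∧
      ∀ᶠ z in 𝓝 a, x z = h z * x' z ∧ y z = h z * y' z ∧ t z = h z * t' z := by
  -- The order of vanishing is taken for the ℂ³-valued germ, so that the common power of z - a comes
  -- out at once.
  have han : AnalyticAt ℂ (fun z => (x z, y z, t z)) a := hx.1.prod (hy.1.prod ht.1)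
  obtain ⟨n, g, hg, hg0, hfg⟩ := han.exists_eventuallyEq_pow_smul_nonzero_iff.2 h0
  have hh := (symGerm_sub_self a).pow n
  -- For real a the power of z - a is itself symmetric and cancels away from a; at a the symmetry
  -- follows by continuity.
  have key : ∀ {x x' : ℂ → ℂ}, SymGerm a x → AnalyticAt ℂ x' a →
      (∀ᶠ z in 𝓝 a, x z = (z - a) ^ n * x' z) → SymGerm a x' := by
    intro x x' hx hx' he
    refine ⟨hx', fun ha => ?_⟩
    have hca : conj a = a := Complex.conj_eq_iff_im.2 ha
    have h1 : ∀ᶠ z in 𝓝[≠] a, x' (conj z) = conj (x' z) := by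
      filter_upwards [self_mem_nhdsWithin, (hx.2 ha).filter_mono nhdsWithin_le_nhds,
        he.filter_mono nhdsWithin_le_nhds,
        (eventually_conj ha he).filter_mono nhdsWithin_le_nhds] with z hz a1 a2 a3
      have hne : conj (z - a) ^ n ≠ 0 := by
        refine pow_ne_zero _ ?_
        rw [ne_eq, map_eq_zero]
        exact sub_ne_zero.2 hz
      apply mul_left_cancel₀ hne
      have e : conj (z - a) = conj z - a := by rw [map_sub, hca]
      rw [a2, map_mul, map_pow, a3, ← e] at a1
      exact a1
    have hc1 : ContinuousAt (fun z => x' (conj z)) a := by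
      have : ContinuousAt x' (conj a) := by rw [hca]; exact hx'.continuousAt
      exact this.comp (f := fun z : ℂ => conj z) Complex.continuous_conj.continuousAt
    have hc2 : ContinuousAt (fun z => conj (x' z)) a :=
      Complex.continuous_conj.continuousAt.comp hx'.continuousAt
    have h2 : x' (conj a) = conj (x' a) := by
      refine tendsto_nhds_unique (l := 𝓝[≠] a) (hc1.tendsto.mono_left nhdsWithin_le_nhds)
        ((hc2.tendsto.mono_left nhdsWithin_le_nhds).congr' ?_)
      filter_upwards [h1] with z hz using hz.symm
    rw [eventually_nhdsWithin_iff] at h1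
    filter_upwards [h1] with z hz
    by_cases hza : z = a
    · rw [hza, h2]
    · exact hz hza
  have e : ∀ᶠ z in 𝓝 a, x z = (z - a) ^ n * (g z).1 ∧ y z = (z - a) ^ n * (g z).2.1 ∧
      t z = (z - a) ^ n * (g z).2.2 := by
    filter_upwards [hfg] with z hz
    rw [Prod.ext_iff, Prod.ext_iff] at hz
    simpa using hz
  have g1 : AnalyticAt ℂ (fun z => (g z).1) a := analyticAt_fst.comp hg
  have g2 : AnalyticAt ℂ (fun z => (g z).2.1) a := (analyticAt_fst.comp analyticAt_snd).comp hg
  have g3 : AnalyticAt ℂ (fun z => (g z).2.2) a := (analyticAt_snd.comp analyticAt_snd).comp hg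
  refine ⟨_, _, _, _, hh, key hx g1 (e.mono fun z h => h.1), key hy g2 (e.mono fun z h => h.2.1),
    key ht g3 (e.mono fun z h => h.2.2), ?_, e⟩
  by_contra hc
  push Not at hc
  exact hg0 (Prod.ext hc.1 (Prod.ext hc.2.1 hc.2.2))

end Germs

/-! ### Functions on tubes induced by germs -/

section TubeGerms

variable {p : ℍ[ℝ]} {ε : ℝ} {u x y t : ℂ → ℂ}

/-- The function induced by the reflection of a germ. -/
noncomputable def germFun (u : ℂ → ℂ) : ℍ[ℝ] → ℍ[ℝ] := sliceOf fun z => (symmExt u z : ℍ[ℂ])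

/-- The vectorial stem function with given components on the upper half plane. -/
noncomputable def vecStem (x y t : ℂ → ℂ) (z : ℂ) : ℍ[ℂ] :=
  ⟨0, symmExt x z, symmExt y z, symmExt t z⟩

@[simp] theorem vecStem_re (x y t : ℂ → ℂ) (z : ℂ) : (vecStem x y t z).re = 0 := rfl
@[simp] theorem vecStem_imI (x y t : ℂ → ℂ) (z : ℂ) : (vecStem x y t z).imI = symmExt x z := rfl
@[simp] theorem vecStem_imJ (x y t : ℂ → ℂ) (z : ℂ) : (vecStem x y t z).imJ = symmExt y z := rfl
@[simp] theorem vecStem_imK (x y t : ℂ → ℂ) (z : ℂ) : (vecStem x y t z).imK = symmExt t z := rfl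

theorem differentiableOn_of_goodAt (ha : Adm (up p) ε)
    (h : ∀ z ∈ Metric.ball (up p) ε, GoodAt (up p) u z) :
    DifferentiableOn ℂ (symmExt u) (planeSection (tube p ε)) :=
  differentiableOn_symmExt ha (fun z hz => (h z hz).1.differentiableAt.differentiableWithinAt)
    fun h0 z hz => (h z hz).2 h0

theorem sInd_germFun (ha : Adm (up p) ε) (h : ∀ z ∈ Metric.ball (up p) ε, GoodAt (up p) u z) :
    SInd (germFun u) (symmExt u) (tube p ε) :=
  sInd_sliceOf (isAxiallySymmetric_tube _ _)
    (fun _ hz => symmExt_conj ha (fun h0 z hz => (h z hz).2 h0) hz) fun _ _ => rfl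

theorem ind_vecStem (ha : Adm (up p) ε) (hx : ∀ z ∈ Metric.ball (up p) ε, GoodAt (up p) x z)
    (hy : ∀ z ∈ Metric.ball (up p) ε, GoodAt (up p) y z)
    (ht : ∀ z ∈ Metric.ball (up p) ε, GoodAt (up p) t z) :
    Ind (sliceOf (vecStem x y t)) (vecStem x y t) (tube p ε) ∧
      IsHolomorphic (vecStem x y t) (planeSection (tube p ε)) := by
  refine ⟨ind_sliceOf (isAxiallySymmetric_tube _ _) (fun z hz => ?_) fun _ _ => rfl,
    differentiableOn_const _, differentiableOn_of_goodAt ha hx, differentiableOn_of_goodAt ha hy,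
    differentiableOn_of_goodAt ha ht⟩
  ext1
  · simp
  · simpa using symmExt_conj ha (fun h0 z hz => (hx z hz).2 h0) hz
  · simpa using symmExt_conj ha (fun h0 z hz => (hy z hz).2 h0) hz
  · simpa using symmExt_conj ha (fun h0 z hz => (ht z hz).2 h0) hz

theorem SInd.symGerm {f : ℍ[ℝ] → ℍ[ℝ]} {h : ℂ → ℂ} {Ω : Set ℍ[ℝ]} (hΩ : IsOpen Ω)
    (hs : IsAxiallySymmetric Ω) (hf : SInd f h Ω) (hh : DifferentiableOn ℂ h (planeSection Ω))
    (hp : p ∈ Ω) : SymGerm (up p) h := by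
  have hD := planeSection_mem_nhds hΩ hs hp
  refine ⟨hh.analyticAt hD, fun _ => ?_⟩
  filter_upwards [hD] with z hz using hf.2 z hz

end TubeGerms

/-! ### Logarithms away from the zeros of the vectorial class -/

section Polar

variable {Ω U : Set ℍ[ℝ]} {g : ℍ[ℝ] → ℍ[ℝ]} {G : ℂ → ℍ[ℂ]} {z₀ p : ℍ[ℝ]}

theorem normSq_vec (Z : ℍ[ℂ]) (h : Z.re = 0) :
    Quaternion.normSq Z = Z.imI ^ 2 + Z.imJ ^ 2 + Z.imK ^ 2 := by
  rw [Quaternion.normSq_def', h]; ring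

theorem up_eq_of_mem_sphereThrough {q : ℍ[ℝ]} (h : q ∈ sphereThrough p) : up q = up p :=
  Complex.ext h.1 h.2

theorem mem_sphereThrough_iff {q : ℍ[ℝ]} : q ∈ sphereThrough p ↔ up q = up p :=
  ⟨up_eq_of_mem_sphereThrough, fun h => ⟨congrArg Complex.re h, congrArg Complex.im h⟩⟩

theorem sliceEmb_mem_sphereThrough {J : ℍ[ℝ]} (hJ : J ∈ unitSphere) :
    sliceEmb J (up p) ∈ sphereThrough p :=
  mem_sphereThrough_iff.2 (up_sliceEmb_of_nonneg hJ (up_im_nonneg p))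

/-- A slice function vanishing on a whole sphere has a stem vanishing there. -/
theorem Ind.exists_ne_zero_on_sphere {w : ℍ[ℝ] → ℍ[ℝ]} {W : ℂ → ℍ[ℂ]}
    (hU : IsAxiallySymmetric U) (hw : Ind w W U) (hp : p ∈ U) (h : W (up p) ≠ 0) :
    ∃ q ∈ sphereThrough p, w q ≠ 0 := by
  by_contra hc
  push Not at hc
  apply h
  have hz := (up_mem_planeSection hU).2 hp
  refine eq_of_phi_eq coeI_mem ?_ ?_
  · rw [← hw.1 _ coeI_mem _ hz, hc _ (sliceEmb_mem_sphereThrough coeI_mem)]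
    exact (ind_zero U).1 _ coeI_mem _ hz
  · rw [← hw.1 _ (neg_mem_unitSphere coeI_mem) _ hz,
      hc _ (sliceEmb_mem_sphereThrough (neg_mem_unitSphere coeI_mem))]
    exact (ind_zero U).1 _ (neg_mem_unitSphere coeI_mem) _ hz

/-- The vectorial part factors locally into a germ and a nonvanishing vector. -/
theorem exists_minimal_germs (hΩ : IsAxSymDomain Ω) (hg : Ind g G Ω)
    (hG : IsHolomorphic G (planeSection Ω)) (hv : ∃ q ∈ Ω, (G (up q)).im ≠ 0) (hp : p ∈ Ω) :
    ∃ h x y t, SymGerm (up p) h ∧ SymGerm (up p) x ∧ SymGerm (up p) y ∧ SymGerm (up p) t ∧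
      (x (up p) ≠ 0 ∨ y (up p) ≠ 0 ∨ t (up p) ≠ 0) ∧
      ∀ᶠ z in 𝓝 (up p),
        (G z).imI = h z * x z ∧ (G z).imJ = h z * y z ∧ (G z).imK = h z * t z := by
  have hs := hΩ.2.2
  refine exists_factorization ((hg.compI hs).symGerm hΩ.1 hs hG.2.1 hp)
    ((hg.compJ hs).symGerm hΩ.1 hs hG.2.2.1 hp) ((hg.compK hs).symGerm hΩ.1 hs hG.2.2.2 hp) ?_
  intro h
  obtain ⟨z, h1, h2⟩ := ((eventually_im_ne_zero hΩ hG hv hp).and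
    (h.filter_mono nhdsWithin_le_nhds)).exists
  apply h1
  rw [Prod.ext_iff, Prod.ext_iff] at h2
  ext1
  · rfl
  · exact h2.1
  · exact h2.2.1
  · exact h2.2.2

/-- If x² + y² + t² vanished at the centre, the function with components x, y, t on a small tube
would be a minimal representative with an isotropic nonzero stem value, hence with a zero on the
sphere of p. -/
theorem normSq_germ_ne_zero (hΩ : IsAxSymDomain Ω) (hg : Ind g G Ω)
    (hv : ∃ q ∈ Ω, vecPart g q ≠ 0) (hp : p ∈ Ω)
    (hd : Disjoint (classZeros g Ω) (sphereThrough p)) {h x y t : ℂ → ℂ}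
    (hh : SymGerm (up p) h) (hx : SymGerm (up p) x) (hy : SymGerm (up p) y)
    (ht : SymGerm (up p) t) (h0 : x (up p) ≠ 0 ∨ y (up p) ≠ 0 ∨ t (up p) ≠ 0)
    (hf : ∀ᶠ z in 𝓝 (up p),
      (G z).imI = h z * x z ∧ (G z).imJ = h z * y z ∧ (G z).imK = h z * t z) :
    x (up p) ^ 2 + y (up p) ^ 2 + t (up p) ^ 2 ≠ 0 := by
  intro hN
  have hne : ∀ᶠ z in 𝓝 (up p), x z ≠ 0 ∨ y z ≠ 0 ∨ t z ≠ 0 := by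
    rcases h0 with h0 | h0 | h0
    · exact (hx.1.continuousAt.eventually_ne h0).mono fun _ => Or.inl
    · exact (hy.1.continuousAt.eventually_ne h0).mono fun _ h => Or.inr (Or.inl h)
    · exact (ht.1.continuousAt.eventually_ne h0).mono fun _ h => Or.inr (Or.inr h)
  obtain ⟨ε, h1, h2, h3⟩ := exists_tube hΩ.1 hΩ.2.2 hp (hh.eventually.and (hx.eventually.and
    (hy.eventually.and (ht.eventually.and (hne.and hf)))))
  have hU := h2.1.1
  have hs := hU.2.2
  have ah := sInd_germFun h1 fun z hz => (h3 z hz).1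
  have ahd := differentiableOn_of_goodAt h1 fun z hz => (h3 z hz).1
  obtain ⟨hw, hwd⟩ := ind_vecStem h1 (fun z hz => (h3 z hz).2.1) (fun z hz => (h3 z hz).2.2.1)
    (fun z hz => (h3 z hz).2.2.2.1)
  have hgU := (hg.mono h2.2.2).vecPart hs
  have hrel : ∀ q ∈ tube p ε, germFun h q * sliceOf (vecStem x y t) q +
      ((-1 : ℝ) : ℍ[ℝ]) * vecPart g q = 0 := by
    intro q hq
    have := (h3 _ hq).2.2.2.2.2
    refine ((ah.mul_ind hw).add ((sInd_coe (-1) _).mul_ind hgU)).eq_of_up hs (ind_zero _) hq ?_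
    ext1 <;> simp [symmExt_up, this]
  have hW : ∀ q ∈ tube p ε, vecStem x y t (up q) ≠ 0 := by
    intro q hq h
    have := (h3 _ hq).2.2.2.2.1
    rw [Quaternion.ext_iff] at h
    simp [symmExt_up] at h
    tauto
  have hp' := h2.2.1
  have hW2 : Quaternion.normSq (vecStem x y t (up p)) = 0 := by
    rw [normSq_vec _ rfl]
    simpa [symmExt_up] using hN
  obtain ⟨J, hJ, hJ0⟩ := exists_phi_eq_zero hW2 fun h => hW p hp' (eq_zero_of_normSq_eq_zero h hW2)
  have hpz := (up_mem_planeSection hs).2 hp'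
  have hmem : sliceEmb J (up p) ∈ classZeros g Ω := ⟨hv, _, sliceOf (vecStem x y t),
    isOpen_tube p ε, hs, h2.2.2, ⟨(SRV_iff hs).2 ⟨_, hw, hwd, fun _ _ => rfl⟩, fun q hq =>
      ⟨_, hU, hq, subset_rfl, germFun h, _, (SRR_iff hs).2 ⟨_, ah, ahd⟩,
        (SRR_iff hs).2 ⟨_, sInd_coe (-1) _, differentiableOn_const _⟩,
        Or.inr ⟨p, hp', by simp⟩, hrel⟩, fun q hq =>
      hw.exists_ne_zero_on_sphere hs hq (hW q hq)⟩, (mem_planeSection hs hJ).1 hpz, by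
        rw [hw.1 _ hJ _ hpz, hJ0]⟩
  exact Set.disjoint_left.1 hd hmem (sliceEmb_mem_sphereThrough hJ)

theorem re_sum_sq_pos {x y t : ℂ} (hx : x.im = 0) (hy : y.im = 0) (ht : t.im = 0)
    (h0 : x ≠ 0 ∨ y ≠ 0 ∨ t ≠ 0) : 0 < (x ^ 2 + y ^ 2 + t ^ 2).re := by
  have e : (x ^ 2 + y ^ 2 + t ^ 2).re = x.re ^ 2 + y.re ^ 2 + t.re ^ 2 := by
    simp [pow_two, hx, hy, ht]
  have hr : ∀ {c : ℂ}, c.im = 0 → c ≠ 0 → c.re ≠ 0 := fun h h' h'' => h' (Complex.ext h'' h)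
  rw [e]
  rcases h0 with h | h | h
  · have := hr hx h; positivity
  · have := hr hy h; positivity
  · have := hr ht h; positivity

/-- The polar form of `g` near `p`, in terms of germs. -/
theorem exists_polar_germs (hΩ : IsAxSymDomain Ω) (hg : Ind g G Ω)
    (hG : IsHolomorphic G (planeSection Ω)) (hg0 : Quaternion.normSq (G (up p)) ≠ 0)
    (hv : ∃ q ∈ Ω, vecPart g q ≠ 0) (hp : p ∈ Ω)
    (hd : Disjoint (classZeros g Ω) (sphereThrough p)) :
    ∃ r s φ x y t, SymGerm (up p) r ∧ SymGerm (up p) s ∧ SymGerm (up p) φ ∧ SymGerm (up p) x ∧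
      SymGerm (up p) y ∧ SymGerm (up p) t ∧ ∀ᶠ z in 𝓝 (up p),
        (r z ≠ 0 ∧ r z ^ 2 = Quaternion.normSq (G z) ∧ ((up p).im = 0 → 0 < (r z).re)) ∧
        x z ^ 2 + y z ^ 2 + t z ^ 2 = 1 ∧
        ((G z).imI = s z * x z ∧ (G z).imJ = s z * y z ∧ (G z).imK = s z * t z) ∧
        Complex.cos (φ z) = (r z)⁻¹ * (G z).re ∧ Complex.sin (φ z) = (r z)⁻¹ * s z := by
  have hs := hΩ.2.2
  obtain ⟨h, x, y, t, hh, hx, hy, ht, h0, hf⟩ := exists_minimal_germs hΩ hg hG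
    (exists_up_im_ne_zero hs hg hv) hp
  have hN0 := normSq_germ_ne_zero hΩ hg hv hp hd hh hx hy ht h0 hf
  -- τ is the length of the reduced vector: w is that vector divided by τ, and s = hτ. At a real
  -- centre it is a root of a sum of real squares that are not all zero.
  obtain ⟨τ, hτ, hτ2, hτ0, -⟩ := (((hx.pow 2).add (hy.pow 2)).add (ht.pow 2)).exists_sqrt hN0
    fun ha => re_sum_sq_pos (hx.conj_eq ha) (hy.conj_eq ha) (ht.conj_eq ha) h0
  have hS : SymGerm (up p) fun z => Quaternion.normSq (G z) :=
    (hg.symmetrization hs).symGerm hΩ.1 hs (differentiableOn_normSq hG) hp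
  obtain ⟨r, hr, hr2, hr0, hrp⟩ := hS.exists_sqrt hg0 fun ha => by
    have hI := stemIm_eq_zero_of_conj (hg.2 _ ((up_mem_planeSection hs).2 hp)) ha
    have i0 : (G (up p)).re.im = 0 := congrArg (·.re) hI
    have i1 : (G (up p)).imI.im = 0 := congrArg (·.imI) hI
    have i2 : (G (up p)).imJ.im = 0 := congrArg (·.imJ) hI
    have i3 : (G (up p)).imK.im = 0 := congrArg (·.imK) hI
    have hn : Quaternion.normSq (G (up p)) =
        (((G (up p)).re.re ^ 2 + (G (up p)).imI.re ^ 2 + (G (up p)).imJ.re ^ 2 +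
          (G (up p)).imK.re ^ 2 : ℝ) : ℂ) := by
      rw [Quaternion.normSq_def']
      apply Complex.ext <;> simp [pow_two, i0, i1, i2, i3, -Complex.ofReal_add, -Complex.ofReal_mul]
    rw [hn] at hg0 ⊢
    rw [Complex.ofReal_re]
    exact lt_of_le_of_ne (by positivity) fun h => hg0 (by rw [← h, Complex.ofReal_zero])
  have hsg := hh.mul hτ
  have hre : SymGerm (up p) fun z => (G z).re :=
    (hg.scalarPart hs).symGerm hΩ.1 hs hG.1 hp
  have hc := hre.div hr hr0
  have hsn := hsg.div hr hr0
  have hne := (hr.1.continuousAt.eventually_ne hr0).and (hτ.1.continuousAt.eventually_ne hτ0)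
  -- (g₀/r, s/r) lies on the complex circle, because r² = n(G) = g₀² + s².
  obtain ⟨φ, hφ, hφ2⟩ := exists_angle hc hsn (by
    filter_upwards [hr2, hτ2, hf, hne] with z a1 a2 a3 a4
    rw [div_pow, div_pow, ← add_div, div_eq_one_iff_eq (pow_ne_zero _ a4.1), a1, mul_pow, a2,
      Quaternion.normSq_def', a3.1, a3.2.1, a3.2.2]
    ring)
  refine ⟨r, _, φ, _, _, _, hr, hsg, hφ, hx.div hτ hτ0, hy.div hτ hτ0, ht.div hτ hτ0, ?_⟩
  have hpos : ∀ᶠ z in 𝓝 (up p), (up p).im = 0 → 0 < (r z).re := by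
    by_cases ha : (up p).im = 0
    · have : ContinuousAt (fun z => (r z).re) (up p) :=
        Complex.continuous_re.continuousAt.comp hr.1.continuousAt
      filter_upwards [this.eventually (lt_mem_nhds (hrp ha))] with z hz _ using hz
    · exact Eventually.of_forall fun _ h => absurd h ha
  filter_upwards [hr2, hτ2, hf, hne, hpos, hφ2] with z a1 a2 a3 a4 a5 a6
  refine ⟨⟨a4.1, a1, a5⟩, ?_, ?_, ?_, ?_⟩
  · rw [div_pow, div_pow, div_pow, ← add_div, ← add_div, ← a2, div_self (pow_ne_zero _ a4.2)]
  · rw [a3.1, a3.2.1, a3.2.2]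
    have := a4.2
    refine ⟨?_, ?_, ?_⟩ <;> field_simp
  · rw [a6.1, div_eq_inv_mul]
  · rw [a6.2, div_eq_inv_mul]

/-- Logarithms from a polar form. -/
theorem polar_log (hU : IsAxSymDomain U) (hg : Ind g G U) {s φ w L : ℍ[ℝ] → ℍ[ℝ]}
    {R S Φ ℓ : ℂ → ℂ} {W : ℂ → ℍ[ℂ]} (hs : SInd s S U)
    (hsd : DifferentiableOn ℂ S (planeSection U)) (hφ : SInd φ Φ U)
    (hφd : DifferentiableOn ℂ Φ (planeSection U)) (hw : Ind w W U)
    (hwd : IsHolomorphic W (planeSection U)) (hL : SInd L ℓ U)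
    (hLd : DifferentiableOn ℂ ℓ (planeSection U)) (hW : ∀ z, (W z).re = 0)
    (H : ∀ q ∈ U, R (up q) ≠ 0 ∧ Quaternion.normSq (W (up q)) = 1 ∧
      (G (up q)).im = (S (up q) : ℍ[ℂ]) * W (up q) ∧
      Complex.cos (Φ (up q)) = (R (up q))⁻¹ * (G (up q)).re ∧
      Complex.sin (Φ (up q)) = (R (up q))⁻¹ * S (up q))
    (hne : ∃ q ∈ U, (G (up q)).im ≠ 0) {e : ℂ} (he : e * e = 1) {b : ℝ}
    (hcos : Complex.cos b = e) (hsin : Complex.sin b = 0)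
    (hexp : ∀ q ∈ U, Complex.exp (ℓ (up q)) = e * R (up q)) :
    SRClass (fun q => L q + (φ q + (b : ℍ[ℝ])) * w q) g U ∧
      StarExpEq (fun q => L q + (φ q + (b : ℍ[ℝ])) * w q) g U := by
  have hsU := hU.2.2
  have hb := hφ.add (sInd_coe b U)
  have hbd : DifferentiableOn ℂ (fun z => Φ z + (b : ℂ)) (planeSection U) := hφd.add_const _
  have hF := hL.ind.add (hb.mul_ind hw)
  have hFd := isHolomorphic_add (isHolomorphic_coe hLd) (isHolomorphic_coe_mul hbd hwd)
  refine ⟨srClass_of_relation hU hF hFd hg hs hsd hb.neg hbd.neg ?_ ?_ ?_,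
    starExpEq_of_up hsU hF hg ?_⟩
  · intro q hq
    obtain ⟨-, -, h3, -, -⟩ := H q hq
    rw [im_coe_add_mul _ _ (hW _), h3, ← mul_assoc, ← mul_assoc, ← Quaternion.coe_mul,
      ← Quaternion.coe_mul, ← add_mul, ← Quaternion.coe_add]
    -- The relation witnessing the class is S F_v - (Φ + b) G_v = 0, both parts being multiples of
    -- w.
    have : S (up q) * (Φ (up q) + ↑b) + -(Φ (up q) + ↑b) * S (up q) = 0 := by ring
    rw [this]; simp
  · obtain ⟨q, hq, h⟩ := hne
    refine ⟨q, hq, Or.inl fun h0 => h ?_⟩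
    rw [(H q hq).2.2.1, h0]; simp
  · intro h0
    obtain ⟨q, hq, h⟩ := hne
    exact absurd (h0 q hq) h
  · intro q hq
    obtain ⟨h1, h2, h3, h4, h5⟩ := H q hq
    rw [expQ_add_mul_of_normSq_one _ _ (hW _) h2, hexp q hq, Complex.cos_add, Complex.sin_add,
      hcos, hsin, h4, h5, mul_add, ← mul_assoc, ← Quaternion.coe_mul, ← Quaternion.coe_mul]
    -- The sign e arises once from the scalar summand and once from the shift of the angle by b; e²
    -- = 1 removes it.
    have e1 : e * R (up q) * ((R (up q))⁻¹ * (G (up q)).re * e -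
        (R (up q))⁻¹ * S (up q) * 0) = (G (up q)).re := by
      field_simp
      linear_combination (G (up q)).re * he
    have e2 : e * R (up q) * ((R (up q))⁻¹ * S (up q) * e +
        (R (up q))⁻¹ * (G (up q)).re * 0) = S (up q) := by
      field_simp
      linear_combination S (up q) * he
    rw [e1, e2, ← h3, Quaternion.re_add_im]

end Polar

section PolarCase

variable {Ω : Set ℍ[ℝ]} {g : ℍ[ℝ] → ℍ[ℝ]} {z₀ : ℍ[ℝ]}

/-- Logarithms near a sphere on which the vectorial class has no zero. -/
theorem polar_case (hΩ : IsAxSymDomain Ω) (hg : SR g Ω) (hg0 : ∀ q ∈ Ω, g q ≠ 0)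
    (hz₀ : z₀ ∈ Ω) (hv : ∃ q ∈ Ω, vecPart g q ≠ 0)
    (hd : Disjoint (classZeros g Ω) (sphereThrough z₀)) :
      ∃ U r s φ w, IsBasicNhd U z₀ Ω ∧ (z₀ ∉ realAxis → Disjoint U realAxis) ∧
        SRR r U ∧ SRR s U ∧ SRR φ U ∧ SRV w U ∧
        (∀ q ∈ U, r q ≠ 0 ∧ r q ^ 2 = symmetrization g q ∧ s q ^ 2 = symmetrization (vecPart g) q ∧
          symmetrization w q = 1 ∧ vecPart g q = s q * w q ∧
          qcos (φ q) = (r q)⁻¹ * scalarPart g q ∧ qsin (φ q) = (r q)⁻¹ * s q) ∧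
        (z₀ ∈ realAxis →
          (∀ x ∈ U ∩ realAxis, r x ∈ posRay) ∧ (∀ q ∈ U, r q ∉ nonposRay) ∧
          ∀ n : ℤ,
            SRClass (fun q => qlog (r q) + (φ q + ((2 * (n : ℝ) * Real.pi : ℝ) : ℍ[ℝ])) * w q)
              g U ∧
            StarExpEq (fun q => qlog (r q) + (φ q + ((2 * (n : ℝ) * Real.pi : ℝ) : ℍ[ℝ])) * w q)
              g U) ∧
        (z₀ ∉ realAxis → ∀ k, BranchIndex r z₀ k → BranchDefined k r U ∧
          ∀ m n : ℤ, Even (m + n) →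
            SRClass (fun q => logBranch k r q + ((m : ℝ) * Real.pi) • imUnit q
              + (φ q + (((n : ℝ) * Real.pi : ℝ) : ℍ[ℝ])) * w q) g U ∧
            StarExpEq (fun q => logBranch k r q + ((m : ℝ) * Real.pi) • imUnit q
              + (φ q + (((n : ℝ) * Real.pi : ℝ) : ℍ[ℝ])) * w q) g U) := by
  have hsΩ := hΩ.2.2
  obtain ⟨G, hG, hGd⟩ := SR_iff.1 hg
  have hv' := exists_up_im_ne_zero hsΩ hG hv
  obtain ⟨r, s, φ, x, y, t, hr, hs, hφ, hx, hy, ht, H⟩ := exists_polar_germs hΩ hG hGd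
    (normSq_ne_zero_of_nonvanishing hsΩ hG hg0 ((up_mem_planeSection hsΩ).2 hz₀)) hv hz₀ hd
  obtain ⟨ε₀, e1, e2, e3⟩ := exists_tube hΩ.1 hsΩ hz₀ (H.and (hr.eventually.and
    (hs.eventually.and (hφ.eventually.and (hx.eventually.and (hy.eventually.and
      ht.eventually))))))
  have hr0 := sInd_germFun e1 fun z hz => (e3 z hz).2.1
  have hr0d := differentiableOn_of_goodAt e1 fun z hz => (e3 z hz).2.1
  -- The branch condition refers to the value of r at z₀, and r exists only on the first tube; hence
  -- a second, smaller one.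
  obtain ⟨ε, f1, f2, -, f3⟩ := exists_branch_tube e2.1.1 hr0 hr0d e2.2.1
    (by rw [symmExt_up]; exact H.self_of_nhds.1.1) (P := fun _ => True)
    (Eventually.of_forall fun _ => trivial)
  have hsub := f2.2.2
  have hsubp := planeSection_mono hsub
  have hU := f2.1.1
  have hsU := hU.2.2
  have e3U : ∀ q ∈ tube z₀ ε, _ := fun q hq => (e3 (up q) (hsub hq)).1
  have hrU := hr0.mono hsub
  have hrd := hr0d.mono hsubp
  have hsI := (sInd_germFun e1 fun z hz => (e3 z hz).2.2.1).mono hsub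
  have hsd := (differentiableOn_of_goodAt e1 fun z hz => (e3 z hz).2.2.1).mono hsubp
  have hφI := (sInd_germFun e1 fun z hz => (e3 z hz).2.2.2.1).mono hsub
  have hφd := (differentiableOn_of_goodAt e1 fun z hz => (e3 z hz).2.2.2.1).mono hsubp
  have hw0 := ind_vecStem e1 (fun z hz => (e3 z hz).2.2.2.2.1)
    (fun z hz => (e3 z hz).2.2.2.2.2.1) (fun z hz => (e3 z hz).2.2.2.2.2.2)
  have hw := hw0.1.mono hsub
  have hwd := hw0.2.mono hsubp
  have hΩU := hsub.trans e2.2.2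
  have hGU := hG.mono hΩU
  have hW1 : ∀ q ∈ tube z₀ ε, Quaternion.normSq (vecStem x y t (up q)) = 1 := by
    intro q hq
    rw [normSq_vec _ rfl]
    simpa [symmExt_up] using (e3U q hq).2.1
  have hGim : ∀ q ∈ tube z₀ ε,
      (G (up q)).im = (symmExt s (up q) : ℍ[ℂ]) * vecStem x y t (up q) := by
    intro q hq
    have := (e3U q hq).2.2.1
    ext1 <;> simp [symmExt_up, this]
  have hQ : ∀ q ∈ tube z₀ ε, symmExt r (up q) ≠ 0 ∧
      Quaternion.normSq (vecStem x y t (up q)) = 1 ∧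
      (G (up q)).im = (symmExt s (up q) : ℍ[ℂ]) * vecStem x y t (up q) ∧
      Complex.cos (symmExt φ (up q)) = (symmExt r (up q))⁻¹ * (G (up q)).re ∧
      Complex.sin (symmExt φ (up q)) = (symmExt r (up q))⁻¹ * symmExt s (up q) := by
    intro q hq
    have h := e3U q hq
    refine ⟨?_, hW1 q hq, hGim q hq, ?_, ?_⟩
    · rw [symmExt_up]; exact h.1.1
    · rw [symmExt_up, symmExt_up]; exact h.2.2.2.1
    · rw [symmExt_up, symmExt_up, symmExt_up]; exact h.2.2.2.2
  have hne := exists_up_im_ne_zero_of_subset hΩ hG hGd hv' hU.1 hsU hΩU f2.2.1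
  refine ⟨tube z₀ ε, germFun r, germFun s, germFun φ, sliceOf (vecStem x y t),
    ⟨f2.1, f2.2.1, hΩU⟩, disjoint_tube_realAxis f1, (SRR_iff hsU).2 ⟨_, hrU, hrd⟩,
    (SRR_iff hsU).2 ⟨_, hsI, hsd⟩, (SRR_iff hsU).2 ⟨_, hφI, hφd⟩,
    (SRV_iff hsU).2 ⟨_, hw, hwd, fun _ _ => rfl⟩, fun q hq => ?_, fun hz => ?_, fun hz k hk => ?_⟩
  · obtain ⟨a1, a2, a3, a4, a5⟩ := hQ q hq
    refine ⟨fun h => a1 ((hrU.eq_zero_iff hsU hq).1 h),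
      (hrU.pow 2).eq_of_up hsU (hGU.symmetrization hsU) hq ?_,
      (hsI.pow 2).eq_of_up hsU ((hGU.vecPart hsU).symmetrization hsU) hq ?_,
      (hw.symmetrization hsU).eq_of_up hsU (sInd_one _) hq a2,
      (hGU.vecPart hsU).eq_of_up hsU (hsI.mul_ind hw) hq a3,
      hφI.qcos.eq_of_up hsU (hrU.inv.mul (hGU.scalarPart hsU)) hq a4,
      hφI.qsin.eq_of_up hsU (hrU.inv.mul hsI) hq a5⟩
    · rw [symmExt_up]; exact (e3U q hq).1.2.1
    · rw [a3, map_mul, a2, mul_one, Quaternion.normSq_coe]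
  · have ha := mem_realAxis_iff.1 hz
    have hpos : ∀ q ∈ tube z₀ ε, 0 < (symmExt r (up q)).re := fun q hq => by
      rw [symmExt_up]; exact (e3U q hq).1.2.2 ha
    have hsl : ∀ z ∈ planeSection (tube z₀ ε), symmExt r z ∈ Complex.slitPlane := fun z hz =>
      hrU.forall_of_up hsU (P := fun c => c ∈ Complex.slitPlane) (fun c => conj_mem_slitPlane.2)
        (fun q hq => Complex.mem_slitPlane_iff.2 (Or.inl (hpos q hq))) hz
    refine ⟨fun q hq => (mem_posRay_iff hsU hrU hq.1).2 ⟨hpos q hq.1, ?_⟩,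
      (hrU.not_mem_nonposRay_iff hsU).2 hsl, fun n => ?_⟩
    · have := hrU.2 _ ((up_mem_planeSection hsU).2 hq.1)
      rw [Complex.conj_eq_iff_im.2 (mem_realAxis_iff.1 hq.2)] at this
      exact Complex.conj_eq_iff_im.1 this.symm
    · have e : ((2 * (n : ℝ) * Real.pi : ℝ) : ℂ) = 0 + n * (2 * Real.pi) := by push_cast; ring
      refine polar_log (R := symmExt r) hU hGU hsI hsd hφI hφd hw hwd (hrU.qlog hsl)
        (hrd.clog hsl) (fun _ => rfl) hQ hne (e := 1) (one_mul 1) ?_ ?_ fun q hq => ?_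
      · rw [e, Complex.cos_add_int_mul_two_pi, Complex.cos_zero]
      · rw [e, Complex.sin_add_int_mul_two_pi, Complex.sin_zero]
      · rw [Complex.exp_log (hQ q hq).1, one_mul]
  · have hra := disjoint_tube_realAxis f1 hz
    obtain ⟨a1, a2, a3⟩ := logBranch_spec hU hra hrU hrd (f3 k hk)
    refine ⟨(smul_mem_slitPlane_iff_branchDefined hsU hrU k).2 (f3 k hk), fun m n hmn => ?_⟩
    -- Since m + n is even, e^{mπI} and exp(nπw) are the same sign and cancel.
    have hb : (-1 : ℂ) ^ m = (-1 : ℂ) ^ n := by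
      rcases Int.even_or_odd m with h | h
      · rw [h.neg_one_zpow, ((Int.even_add.1 hmn).1 h).neg_one_zpow]
      · rw [h.neg_one_zpow, Odd.neg_one_zpow]
        rw [← Int.not_even_iff_odd] at h ⊢
        rwa [← Int.even_add.1 hmn]
    refine polar_log (R := symmExt r) hU hGU hsI hsd hφI hφd hw hwd
      (a1.add ((sInd_imUnit _).smul ((m : ℝ) * Real.pi)))
      (a2.add ((differentiableOn_unitStem hsU hra).const_smul ((m : ℝ) * Real.pi)))
      (fun _ => rfl) hQ hne (e := (-1) ^ m) ?_ ?_ ?_ fun q hq => ?_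
    · rw [← mul_zpow]; norm_num
    · rw [hb, ← Complex.ofReal_cos, Real.cos_int_mul_pi]; push_cast; rfl
    · push_cast; rw [Complex.sin_int_mul_pi]
    · rw [Complex.exp_add, a3 _ ((up_mem_planeSection hsU).2 hq),
        exp_int_mul_unitStem m (up_im_pos hra hq).ne', mul_comm]

end PolarCase

/-! ### Logarithms near the zeros of the vectorial class -/

section ZeroCase

variable {Ω : Set ℍ[ℝ]} {g : ℍ[ℝ] → ℍ[ℝ]} {G : ℂ → ℍ[ℂ]} {p z₀ : ℍ[ℝ]}

theorem tendsto_of_holomorphic {D : Set ℂ} {h : ℂ → ℂ} {a : ℂ} (hh : DifferentiableOn ℂ h D)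
    (hD : D ∈ 𝓝 a) : Tendsto h (𝓝[≠] a) (𝓝 (h a)) :=
  ((hh.differentiableAt hD).continuousAt.tendsto).mono_left nhdsWithin_le_nhds

/-- At the zeros of the vectorial class, the vectorial part of the stem is isotropic. -/
theorem isotropic_of_mem_classZeros (hg : Ind g G Ω)
    (hG : IsHolomorphic G (planeSection Ω)) (hp : p ∈ classZeros g Ω) :
    p ∉ realAxis ∧ Quaternion.normSq (G (up p)).im = 0 := by
  obtain ⟨-, U, w, hUo, hUs, hUΩ, ⟨hw, hE, hne⟩, hpU, hw0⟩ := hp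
  obtain ⟨W, hW, hWd, hWre⟩ := (SRV_iff hUs).1 hw
  have hpz := (up_mem_planeSection hUs).2 hpU
  have hWp : W (up p) ≠ 0 := by
    intro h
    obtain ⟨q, hq, hq0⟩ := hne p hpU
    have hqU : q ∈ U := by
      rwa [← up_mem_planeSection hUs, up_eq_of_mem_sphereThrough hq, up_mem_planeSection hUs]
    exact hq0 (hW.eq_of_up hUs (ind_zero U) hqU (by rw [up_eq_of_mem_sphereThrough hq, h]))
  have hN : Quaternion.normSq (W (up p)) = 0 := by
    obtain ⟨J, hJ, hpJ⟩ := exists_sliceEmb_up p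
    exact normSq_eq_zero_of_phi hJ (by rw [← hW.1 _ hJ _ hpz, ← hpJ, hw0])
  -- At a real point an isotropic stem value is real, hence zero, which minimality excludes.
  refine ⟨fun h => hWp (eq_zero_of_normSq_eq_zero
    (stemIm_eq_zero_of_conj (hW.2 _ hpz) (mem_realAxis_iff.1 h)) hN), ?_⟩
  obtain ⟨V, hV, hpV, hVU, a, b, ha, hb, hab, hrel⟩ := hE p hpU
  have hVs := hV.2.2
  obtain ⟨α, hα, hαd⟩ := (SRR_iff hVs).1 ha
  obtain ⟨β, hβ, hβd⟩ := (SRR_iff hVs).1 hb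
  have hGV := hg.mono (hVU.trans hUΩ)
  have hGd := hG.mono (planeSection_mono (hVU.trans hUΩ))
  have hWV := hWd.mono (planeSection_mono hVU)
  have hD := planeSection_mem_nhds hV.1 hVs hpV
  have hR : ∀ z ∈ planeSection V, (α z : ℍ[ℂ]) * W z + (β z : ℍ[ℂ]) * (G z).im = 0 :=
    fun z hz => ((hα.mul_ind (hW.mono hVU)).add (hβ.mul_ind (hGV.vecPart hVs))).eqOn_stem hVs
      (ind_zero V) hrel hz
  have hRI : ∀ z ∈ planeSection V, α z * (W z).imI + β z * (G z).imI = 0 := fun z hz => by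
    simpa using congrArg (·.imI) (hR z hz)
  have hRJ : ∀ z ∈ planeSection V, α z * (W z).imJ + β z * (G z).imJ = 0 := fun z hz => by
    simpa using congrArg (·.imJ) (hR z hz)
  have hRK : ∀ z ∈ planeSection V, α z * (W z).imK + β z * (G z).imK = 0 := fun z hz => by
    simpa using congrArg (·.imK) (hR z hz)
  have hW0 := hWre _ hpz
  have hWc : (W (up p)).imI ≠ 0 ∨ (W (up p)).imJ ≠ 0 ∨ (W (up p)).imK ≠ 0 := by
    rwa [← im_ne_zero_iff, im_eq_self hW0]
  -- If β vanished identically, αW = 0 with W nonzero at p would force α = 0 as well, against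
  -- nontriviality of the relation.
  have hβ0 : ∃ q ∈ V, β (up q) ≠ 0 := by
    by_contra hc
    push Not at hc
    have hα0 : ∀ q ∈ V, α (up q) = 0 := by
      by_contra hc'
      push Not at hc'
      obtain ⟨q, hq, hq0⟩ := hc'
      have key : ∀ k l : ℂ → ℂ, DifferentiableOn ℂ k (planeSection V) →
          (∀ z ∈ planeSection V, α z * k z + β z * l z = 0) → k (up p) = 0 := by
        intro k l hk h
        by_contra hk0
        obtain ⟨z, h1, h2, h3⟩ := ((eventually_ne_zero hV hαd hq hq0 hpV).and
          ((eventually_ne_zero hV hk hpV hk0 hpV).and (nhdsWithin_le_nhds hD))).exists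
        have := h z h3
        rw [hβ.eqOn_stem hVs (sInd_zero V) (fun q hq => (hβ.eq_zero_iff hVs hq).2 (hc q hq)) h3,
          zero_mul, add_zero] at this
        exact (mul_ne_zero h1 h2) this
      rcases hWc with h | h | h
      · exact h (key _ _ hWV.2.1 hRI)
      · exact h (key _ _ hWV.2.2.1 hRJ)
      · exact h (key _ _ hWV.2.2.2 hRK)
    rcases hab with ⟨q, hq, h⟩ | ⟨q, hq, h⟩
    · exact h ((hα.eq_zero_iff hVs hq).2 (hα0 q hq))
    · exact h ((hβ.eq_zero_iff hVs hq).2 (hc q hq))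
  obtain ⟨q, hq, hq0⟩ := hβ0
  have hNW := tendsto_of_holomorphic (differentiableOn_normSq hWV) hD
  have hNG := tendsto_of_holomorphic (differentiableOn_normSq (isHolomorphic_im hGd)) hD
  have key : ∀ k l : ℂ → ℂ, DifferentiableOn ℂ k (planeSection V) →
      DifferentiableOn ℂ l (planeSection V) →
      (∀ z ∈ planeSection V, α z * k z + β z * l z = 0) → k (up p) ≠ 0 →
      Quaternion.normSq (G (up p)).im = 0 := by
    intro k l hk hl h hk0
    -- Proportionality gives n(G_v) k² = n(W) l² wherever β ≠ 0, for matching components k of W and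
    -- l of G_v. In the limit at p, where n(W) = 0 and some k is nonzero, n(G_v) must vanish, even
    -- if α and β both vanish there.
    have e := tendsto_nhds_unique (l := 𝓝[≠] (up p))
      (hNG.mul ((tendsto_of_holomorphic hk hD).pow 2))
      ((hNW.mul ((tendsto_of_holomorphic hl hD).pow 2)).congr' (by
        filter_upwards [nhdsWithin_le_nhds hD, eventually_ne_zero hV hβd hq hq0 hpV] with z h1 h2
        have h3 : β z ^ 2 * Quaternion.normSq (G z).im = α z ^ 2 * Quaternion.normSq (W z) := by
          rw [normSq_vec _ (hWre z (planeSection_mono hVU h1)), normSq_vec _ (Quaternion.re_im _),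
            Quaternion.imI_im, Quaternion.imJ_im, Quaternion.imK_im]
          linear_combination (β z * (G z).imI - α z * (W z).imI) * hRI z h1 +
            (β z * (G z).imJ - α z * (W z).imJ) * hRJ z h1 +
            (β z * (G z).imK - α z * (W z).imK) * hRK z h1
        apply mul_left_cancel₀ (pow_ne_zero 2 h2)
        linear_combination Quaternion.normSq (W z) * (β z * l z - α z * k z) * h z h1 -
          k z ^ 2 * h3))
    rw [hN, zero_mul] at e
    exact (mul_eq_zero.1 e).resolve_right (pow_ne_zero 2 hk0)
  rcases hWc with h | h | h
  · exact key _ _ hWV.2.1 hGd.2.1 hRI h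
  · exact key _ _ hWV.2.2.1 hGd.2.2.1 hRJ h
  · exact key _ _ hWV.2.2.2 hGd.2.2.2 hRK h

/-- Logarithms near a sphere on which the vectorial class has a zero. -/
theorem zero_case (hΩ : IsAxSymDomain Ω) (hg : SR g Ω) (hg0 : ∀ q ∈ Ω, g q ≠ 0)
    (hz₀ : z₀ ∈ Ω) (hd : ∃ p ∈ classZeros g Ω, z₀ ∈ sphereThrough p) :
      z₀ ∉ realAxis ∧
      ∃ U, IsBasicNhd U z₀ Ω ∧ Disjoint U realAxis ∧
        (∀ q ∈ U, scalarPart g q ≠ 0) ∧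
        (∀ q ∈ U, 1 + symmetrization (vecPart g) q * (scalarPart g q ^ 2)⁻¹ ∉ nonposRay) ∧
        ∃ ρ r F : ℍ[ℝ] → ℍ[ℝ],
          (∀ q, ρ q = qsqrt (1 + symmetrization (vecPart g) q * (scalarPart g q ^ 2)⁻¹)) ∧
          (∀ q, r q = scalarPart g q * ρ q) ∧
          (∀ q, F q = muInv (ρ q)⁻¹) ∧
          SRR r U ∧ SRR F U ∧
          (∀ q ∈ U, r q ≠ 0 ∧ r q ^ 2 = symmetrization g q ∧
            F q ∈ muDom ∧ qmu (F q) = (r q)⁻¹ * scalarPart g q ∧ qnu (F q) ≠ 0) ∧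
          (∀ q ∈ sphereThrough z₀, r q = scalarPart g q ∧ F q = 0) ∧
          ∀ n, BranchIndex r z₀ n → BranchDefined n r U ∧
            SRClass (fun q => logBranch n r q + (qnu (F q) * r q)⁻¹ * vecPart g q) g U ∧
            StarExpEq (fun q => logBranch n r q + (qnu (F q) * r q)⁻¹ * vecPart g q) g U := by
  have hsΩ := hΩ.2.2
  obtain ⟨G, hG, hGd⟩ := SR_iff.1 hg
  obtain ⟨p, hp, hpz⟩ := hd
  have hup := up_eq_of_mem_sphereThrough hpz
  obtain ⟨hreal, hN⟩ := isotropic_of_mem_classZeros hG hGd hp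
  have hz : z₀ ∉ realAxis := by rwa [mem_realAxis_iff, hup, ← mem_realAxis_iff]
  rw [← hup] at hN
  have hz₀' := (up_mem_planeSection hsΩ).2 hz₀
  have hre : (G (up z₀)).re ≠ 0 := by
    intro h
    apply normSq_ne_zero_of_nonvanishing hsΩ hG hg0 hz₀'
    rw [normSq_eq_re_add_im, hN, h]; simp
  -- Isotropy at z₀ makes 1 + n(G_v)/g₀² equal to 1 there, so 1/ρ starts at 1 = μ(0) and κ(1/ρ) is
  -- an analytic germ with value 0.
  obtain ⟨κ, hκ, hκ1, hκ2⟩ := exists_local_inverse_cmu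
  obtain ⟨N, hNdef⟩ : ∃ N : ℂ → ℂ, ∀ z, N z = Quaternion.normSq (G z).im := ⟨_, fun _ => rfl⟩
  obtain ⟨A, hA⟩ : ∃ A : ℂ → ℂ, ∀ z, A z = 1 + N z * ((G z).re ^ 2)⁻¹ := ⟨_, fun _ => rfl⟩
  obtain ⟨R, hR⟩ : ∃ R : ℂ → ℂ, ∀ z, R z = Complex.exp ((2 : ℝ)⁻¹ • Complex.log (A z)) :=
    ⟨_, fun _ => rfl⟩
  have hNd : DifferentiableOn ℂ N (planeSection Ω) := by
    rw [funext hNdef]; exact differentiableOn_normSq (isHolomorphic_im hGd)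
  have hD := planeSection_mem_nhds hΩ.1 hsΩ hz₀
  have hNan := hNd.analyticAt hD
  have hkan := hGd.1.analyticAt hD
  have hAan : AnalyticAt ℂ A (up z₀) := by
    rw [funext hA]
    exact analyticAt_const.add (hNan.mul ((hkan.pow 2).inv (pow_ne_zero 2 hre)))
  have hA1 : A (up z₀) = 1 := by rw [hA, hNdef, hN]; simp
  have hAs : A (up z₀) ∈ Complex.slitPlane := by rw [hA1]; exact Complex.one_mem_slitPlane
  have hRan : AnalyticAt ℂ R (up z₀) := by
    rw [funext hR]
    exact ((hAan.clog hAs).const_smul (c := (2 : ℝ)⁻¹)).cexp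
  have hR1 : R (up z₀) = 1 := by rw [hR, hA1]; simp
  have hR0 : ∀ z, R z ≠ 0 := fun z => by rw [hR]; exact Complex.exp_ne_zero _
  have hRinv : AnalyticAt ℂ (fun z => (R z)⁻¹) (up z₀) := hRan.inv (hR0 _)
  have hRt : Tendsto (fun z => (R z)⁻¹) (𝓝 (up z₀)) (𝓝 1) := by
    simpa [hR1] using hRinv.continuousAt.tendsto
  have hu : AnalyticAt ℂ (fun z => κ (R z)⁻¹) (up z₀) := by
    have : AnalyticAt ℂ κ (R (up z₀))⁻¹ := by rw [hR1, inv_one]; exact hκ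
    exact this.comp (f := fun z => (R z)⁻¹) hRinv
  obtain ⟨u, hudef⟩ : ∃ u : ℂ → ℂ, ∀ z, u z = κ (R z)⁻¹ := ⟨_, fun _ => rfl⟩
  simp only [← hudef] at hu
  have huS : SymGerm (up z₀) u := ⟨hu, fun h => absurd (mem_realAxis_iff.2 h) hz⟩
  obtain ⟨ε₀, e1, e2, e3⟩ := exists_tube hΩ.1 hsΩ hz₀ (huS.eventually.and
    ((hkan.continuousAt.eventually_ne hre).and ((hAan.continuousAt.eventually_mem
      (Complex.isOpen_slitPlane.mem_nhds hAs)).and (hRt.eventually hκ2))))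
  have hsT := e2.1.1.2.2
  have hkI := (hG.mono e2.2.2).scalarPart hsT
  have hNI : SInd (symmetrization (vecPart g)) N (tube z₀ ε₀) := by
    rw [funext hNdef]
    exact ((hG.mono e2.2.2).vecPart hsT).symmetrization hsT
  have hAI : SInd (fun q => 1 + symmetrization (vecPart g) q * (scalarPart g q ^ 2)⁻¹) A
      (tube z₀ ε₀) := by
    rw [funext hA]
    exact (sInd_one _).add (hNI.mul (hkI.pow 2).inv)
  have hk0 : ∀ z ∈ planeSection (tube z₀ ε₀), (G z).re ≠ 0 := fun z hz =>
    hkI.forall_of_up hsT (P := fun c => c ≠ 0) (fun c hc => by simpa using hc)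
      (fun q hq => (e3 _ hq).2.1) hz
  have hAsl : ∀ z ∈ planeSection (tube z₀ ε₀), A z ∈ Complex.slitPlane := fun z hz =>
    hAI.forall_of_up hsT (P := fun c => c ∈ Complex.slitPlane) (fun c => conj_mem_slitPlane.2)
      (fun q hq => (e3 _ hq).2.2.1) hz
  have hRI := hAI.qsqrt hAsl
  rw [← funext hR] at hRI
  obtain ⟨ρ, hρ⟩ : ∃ ρ : ℍ[ℝ] → ℍ[ℝ], ∀ q,
      ρ q = qsqrt (1 + symmetrization (vecPart g) q * (scalarPart g q ^ 2)⁻¹) := ⟨_, fun _ => rfl⟩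
  rw [← funext hρ] at hRI
  have hrI := hkI.mul hRI
  have hsubΩ := planeSection_mono e2.2.2
  have hAd : DifferentiableOn ℂ A (planeSection (tube z₀ ε₀)) := by
    rw [funext hA]
    exact (((hNd.mono hsubΩ).fun_mul (((hGd.1.mono hsubΩ).fun_pow 2).fun_inv
      fun z hz => pow_ne_zero 2 (hk0 z hz)))).const_add 1
  have hRd : DifferentiableOn ℂ R (planeSection (tube z₀ ε₀)) := by
    rw [funext hR]
    exact ((hAd.clog hAsl).const_smul (2 : ℝ)⁻¹).cexp
  have hrd := (hGd.1.mono hsubΩ).fun_mul hRd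
  have hR2 : ∀ z ∈ planeSection (tube z₀ ε₀), R z ^ 2 = A z := by
    intro z hz
    rw [hR, ← Complex.exp_nat_mul]
    have : ((2 : ℕ) : ℂ) * ((2 : ℝ)⁻¹ • Complex.log (A z)) = Complex.log (A z) := by
      rw [Complex.real_smul]; push_cast; ring
    rw [this, Complex.exp_log (Complex.slitPlane_ne_zero (hAsl z hz))]
  have huI : SInd (germFun u) (symmExt u) (tube z₀ ε₀) := sInd_germFun e1 fun z hz => (e3 z hz).1
  have hud := differentiableOn_of_goodAt e1 fun z hz => (e3 z hz).1
  -- The germ and the principal inverse agree because κ takes values of modulus below π², where μ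
  -- has no other preimage in M₀.
  have hF : ∀ q ∈ tube z₀ ε₀, ∃ J ∈ unitSphere, muInv (ρ q)⁻¹ = sliceEmb J (u (up q)) ∧
      germFun u q = sliceEmb J (u (up q)) := by
    intro q hq
    have hqz := (up_mem_planeSection hsT).2 hq
    obtain ⟨J, hJ, hqJ⟩ := exists_sliceEmb_up q
    have h1 := hRI.inv.1 J hJ _ hqz
    have h2 := huI.1 J hJ _ hqz
    rw [← hqJ] at h1 h2
    beta_reduce at h1
    rw [symmExt_up] at h2
    have h3 := (e3 _ hq).2.2.2
    rw [← hudef] at h3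
    exact ⟨J, hJ, by rw [h1, muInv_sliceEmb hJ h3.2.1 h3.1], h2⟩
  have hFI : SInd (fun q => muInv (ρ q)⁻¹) (symmExt u) (tube z₀ ε₀) :=
    huI.congr hsT (fun q hq => by
      obtain ⟨J, -, h1, h2⟩ := hF q hq
      rw [h1, h2]) fun _ _ => rfl
  obtain ⟨ε, f1, f2, -, f3⟩ := exists_branch_tube e2.1.1 hrI hrd e2.2.1
    (mul_ne_zero hre (hR0 _)) (P := fun _ => True) (Eventually.of_forall fun _ => trivial)
  have hsub := f2.2.2
  have hsubp := planeSection_mono hsub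
  have hU := f2.1.1
  have hsU := hU.2.2
  have hΩU := hsub.trans e2.2.2
  have hGU := hG.mono hΩU
  have hra := disjoint_tube_realAxis f1 hz
  have hkU := hkI.mono hsub
  have hrU := hrI.mono hsub
  have hFU := hFI.mono hsub
  have hr0 : ∀ z ∈ planeSection (tube z₀ ε), (G z).re * R z ≠ 0 := fun z hz =>
    mul_ne_zero (hk0 z (hsubp hz)) (hR0 z)
  have hr2 : ∀ z ∈ planeSection (tube z₀ ε), ((G z).re * R z) ^ 2 = (G z).re ^ 2 + N z := by
    intro z hz
    have := hk0 z (hsubp hz)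
    rw [mul_pow, hR2 z (hsubp hz), hA]
    field_simp
  have hFq : ∀ q ∈ tube z₀ ε, cmu (symmExt u (up q)) = (R (up q))⁻¹ ∧
      cnu (symmExt u (up q)) ≠ 0 := by
    intro q hq
    have h3 := (e3 _ (hsub hq)).2.2.2
    rw [← hudef] at h3
    rw [symmExt_up]
    exact ⟨h3.1, h3.2.2⟩
  refine ⟨hz, tube z₀ ε, ⟨f2.1, f2.2.1, hΩU⟩, hra, fun q hq h => ?_,
    ((hAI.mono hsub).not_mem_nonposRay_iff hsU).2 fun z hz => hAsl z (hsubp hz), ρ, _, _, hρ,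
    fun _ => rfl, fun _ => rfl, (SRR_iff hsU).2 ⟨_, hrU, hrd.mono hsubp⟩,
    (SRR_iff hsU).2 ⟨_, hFU, hud.mono hsubp⟩, fun q hq => ?_, fun q hq => ?_, fun n hn => ?_⟩
  · exact hk0 _ (hsubp ((up_mem_planeSection hsU).2 hq)) ((hkU.eq_zero_iff hsU hq).1 h)
  · have hqz := (up_mem_planeSection hsU).2 hq
    obtain ⟨h1, h2⟩ := hFq q hq
    refine ⟨fun h => hr0 _ hqz ((hrU.eq_zero_iff hsU hq).1 h),
      (hrU.pow 2).eq_of_up hsU (hGU.symmetrization hsU) hq ?_, ?_,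
      hFU.qmu.eq_of_up hsU (hrU.inv.mul hkU) hq ?_,
      fun h => h2 ((hFU.qnu.eq_zero_iff hsU hq).1 h)⟩
    · rw [hr2 _ hqz, hNdef, ← normSq_eq_re_add_im]
    · obtain ⟨J, hJ, h3, -⟩ := hF q (hsub hq)
      have h4 := (e3 _ (hsub hq)).2.2.2
      rw [← hudef] at h4
      rw [h3]
      exact sliceEmb_mem_muDom hJ h4.2.1
    · rw [h1, mul_inv, mul_comm, mul_inv_cancel_left₀ (hk0 _ (hsubp hqz))]
  · have hqz := up_eq_of_mem_sphereThrough hq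
    have hqU : q ∈ tube z₀ ε := by
      rw [← up_mem_planeSection hsU, hqz, up_mem_planeSection hsU]; exact f2.2.1
    refine ⟨hrU.eq_of_up hsU hkU hqU ?_, (hFU.eq_zero_iff hsU hqU).2 ?_⟩
    · rw [hqz, hR1, mul_one]
    · rw [symmExt_up, hqz, hudef, hR1, inv_one, hκ1]
  · obtain ⟨a1, a2, a3⟩ := logBranch_spec hU hra hrU (hrd.mono hsubp) (f3 n hn)
    have hB := (hFU.qnu.mul hrU).inv
    have hcnu : ∀ z ∈ planeSection (tube z₀ ε), cnu (symmExt u z) ≠ 0 := fun z hz =>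
      hFU.forall_of_up hsU (P := fun c => cnu c ≠ 0)
        (fun c hc => by rw [cnu_conj]; simpa using hc) (fun q hq => (hFq q hq).2) hz
    have hBd : DifferentiableOn ℂ (fun z => (cnu (symmExt u z) * ((G z).re * R z))⁻¹)
        (planeSection (tube z₀ ε)) :=
      ((differentiable_cnu.comp_differentiableOn (hud.mono hsubp)).fun_mul
        (hrd.mono hsubp)).fun_inv fun z hz => mul_ne_zero (hcnu z hz) (hr0 z hz)
    have hL := a1.ind.add (hB.mul_ind (hGU.vecPart hsU))
    refine ⟨(smul_mem_slitPlane_iff_branchDefined hsU hrU n).2 (f3 n hn),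
      srClass_of_relation hU hL (isHolomorphic_add (isHolomorphic_coe a2)
        (isHolomorphic_coe_mul hBd (isHolomorphic_im (hGd.mono (planeSection_mono hΩU))))) hGU
        (sInd_one _) (differentiableOn_const _) hB.neg hBd.neg ?_ ⟨z₀, f2.2.1, Or.inl one_ne_zero⟩
        ?_, starExpEq_of_up hsU hL hGU ?_⟩
    · intro q hq
      rw [im_coe_add_mul _ _ (by simp)]
      simp
    · intro H q hq
      rw [im_coe_add_mul _ _ (by simp), H q hq, mul_zero]
    · intro q hq
      have hqz := (up_mem_planeSection hsU).2 hq
      obtain ⟨h1, h2⟩ := hFq q hq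
      obtain ⟨k, hk⟩ : ∃ k, k = (G (up q)).re * R (up q) := ⟨_, rfl⟩
      have hk0' : k ≠ 0 := by rw [hk]; exact hr0 _ hqz
      -- From g₀ = rμ(F), r² = g₀² + n(G_v) and μ² + Fν² = 1 one gets n(G_v) = F(νr)². So G_v/(νr)
      -- has n equal to F, and its exponential is μ(F) + G_v/r.
      have h5 : N (up q) = symmExt u (up q) * (cnu (symmExt u (up q)) * k) ^ 2 := by
        have h6 := cmu_sq_add (symmExt u (up q))
        have h7 := hr2 _ hqz
        have h8 : k * cmu (symmExt u (up q)) = (G (up q)).re := by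
          rw [h1, hk, mul_inv_cancel_right₀ (hR0 _)]
        rw [← hk] at h7
        rw [← h8] at h7
        linear_combination -h7 - k ^ 2 * h6
      have h6 : (cnu (symmExt u (up q)) * k)⁻¹ ^ 2 * N (up q) = symmExt u (up q) := by
        rw [h5, mul_comm, mul_assoc, ← mul_pow, mul_inv_cancel₀ (mul_ne_zero h2 hk0'), one_pow,
          mul_one]
      rw [expQ_add_mul _ _ (by simp), ← hNdef, a3 _ hqz, ← hk, h6, mul_add, ← mul_assoc,
        ← Quaternion.coe_mul, ← Quaternion.coe_mul, h1]
      have e4 : k * (R (up q))⁻¹ = (G (up q)).re := by rw [hk, mul_inv_cancel_right₀ (hR0 _)]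
      have e5 : k * (cnu (symmExt u (up q)) * (cnu (symmExt u (up q)) * k)⁻¹) = 1 := by
        field_simp
      rw [e4, e5, Quaternion.coe_one, one_mul, Quaternion.re_add_im]

end ZeroCase

/-! ### Existence of logarithms -/

section Existence

variable {Ω U : Set ℍ[ℝ]} {f g : ℍ[ℝ] → ℍ[ℝ]} {z₀ : ℍ[ℝ]}

theorem SR.sRR_iff_vecPart (hU : IsAxiallySymmetric U) (hg : SR g U) :
    SRR g U ↔ ∀ q ∈ U, vecPart g q = 0 := by
  constructor
  · intro h q hq
    obtain ⟨k, hk, -⟩ := (SRR_iff hU).1 h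
    exact (hk.ind.vecPart hU).eq_of_up hU (ind_zero U) hq (by simp)
  · intro h
    obtain ⟨G, hG, hGd⟩ := SR_iff.1 hg
    exact SRR_congr hU ((hG.scalarPart hU).congr hU (fun q hq => sub_eq_zero.1 (h q hq))
      fun _ _ => rfl) hGd.1

theorem SRR.srClass (hU : IsAxSymDomain U) (hf : SRR f U) (hg : SRR g U) : SRClass f g U := by
  obtain ⟨h, hh, hhd⟩ := (SRR_iff hU.2.2).1 hf
  obtain ⟨k, hk, -⟩ := (SRR_iff hU.2.2).1 hg
  obtain ⟨q, hq⟩ := hU.2.1.nonempty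
  exact srClass_of_relation hU hh.ind (isHolomorphic_coe hhd) hk.ind (sInd_one U)
    (differentiableOn_const _) (sInd_zero U) (differentiableOn_const _) (by simp)
    ⟨q, hq, Or.inl one_ne_zero⟩ (by simp)

theorem SRR.mono {V : Set ℍ[ℝ]} (hV : IsAxiallySymmetric V) (hU : IsAxiallySymmetric U)
    (hg : SRR g U) (h : V ⊆ U) : SRR g V := by
  obtain ⟨k, hk, hkd⟩ := (SRR_iff hU).1 hg
  exact SRR_congr hV (hk.mono h) (hkd.mono (planeSection_mono h))

/-- The constant i serves; it supplies the unit direction for a negative scalar g at a real point.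
-/
theorem exists_SRV_one (hU : IsAxiallySymmetric U) :
    ∃ w, SRV w U ∧ ∀ q ∈ U, symmetrization w q = 1 := by
  have h : Ind (sliceOf fun _ => (⟨0, 1, 0, 0⟩ : ℍ[ℂ])) (fun _ => ⟨0, 1, 0, 0⟩) U :=
    ind_sliceOf hU (fun _ _ => by ext <;> simp [iotaConj]) fun _ _ => rfl
  refine ⟨_, (SRV_iff hU).2 ⟨_, h, ⟨differentiableOn_const _, differentiableOn_const _,
    differentiableOn_const _, differentiableOn_const _⟩, fun _ _ => rfl⟩, fun q hq =>
    (h.symmetrization hU).eq_of_up hU (sInd_one U) hq ?_⟩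
  exact (normSq_vec _ rfl).trans (by simp)

theorem SRR.mem_negRay_of_not_mem_posRay (hΩ : IsAxiallySymmetric Ω) (hg : SRR g Ω)
    (hz₀ : z₀ ∈ Ω) (h0 : g z₀ ≠ 0) (hz : z₀ ∈ realAxis) (hpos : g z₀ ∉ posRay) :
    g z₀ ∈ negRay := by
  obtain ⟨k, hk, -⟩ := (SRR_iff hΩ).1 hg
  have h1 := hk.im_eq_zero hΩ hz₀ hz
  rw [mem_posRay_iff hΩ hk hz₀] at hpos
  rw [mem_negRay_iff hΩ hk hz₀]
  refine ⟨lt_of_le_of_ne (not_lt.1 fun h => hpos ⟨h, h1⟩) fun h => h0 ?_, h1⟩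
  exact (hk.eq_zero_iff hΩ hz₀).2 (Complex.ext h h1)

/-- Logarithms in the vectorial class of `g`. -/
theorem exists_log_mem_class (hΩ : IsAxSymDomain Ω) (hg : SR g Ω) (hg0 : ∀ q ∈ Ω, g q ≠ 0)
    (hz₀ : z₀ ∈ Ω) (h : SRR g Ω → z₀ ∈ realAxis → g z₀ ∈ posRay) :
    ∃ U f, IsBasicNhd U z₀ Ω ∧ SRClass f g U ∧ StarExpEq f g U := by
  by_cases hgR : SRR g Ω
  · by_cases hz : z₀ ∈ realAxis
    · obtain ⟨U, hU, -, h1, h2, -⟩ := slicePreserving_real_pos hΩ hgR hz₀ hz (h hgR hz)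
      exact ⟨U, _, hU, h1.srClass hU.1.1 (hgR.mono hU.1.1.2.2 hΩ.2.2 hU.2.2), h2⟩
    · obtain ⟨U, hU, -, h1, -⟩ := slicePreserving_nonreal hΩ hgR hg0 hz₀ hz
      obtain ⟨n, hn⟩ := exists_branchIndex g z₀
      obtain ⟨-, h2, h3⟩ := h1 n hn
      exact ⟨U, _, hU, h2.srClass hU.1.1 (hgR.mono hU.1.1.2.2 hΩ.2.2 hU.2.2), h3⟩
  · have hv : ∃ q ∈ Ω, vecPart g q ≠ 0 := by
      rw [hg.sRR_iff_vecPart hΩ.2.2] at hgR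
      simpa using hgR
    by_cases hd : Disjoint (classZeros g Ω) (sphereThrough z₀)
    · obtain ⟨U, r, s, φ, w, hU, -, -, -, -, -, -, h1, h2⟩ := polar_case hΩ hg hg0 hz₀ hv hd
      by_cases hz : z₀ ∈ realAxis
      · exact ⟨U, _, hU, (h1 hz).2.2 0⟩
      · obtain ⟨n, hn⟩ := exists_branchIndex r z₀
        exact ⟨U, _, hU, (h2 hz n hn).2 0 0 (by simp)⟩
    · obtain ⟨p, hp, hpz⟩ := Set.not_disjoint_iff.1 hd
      obtain ⟨-, U, hU, -, -, -, ρ, r, F, -, -, -, -, -, -, -, h1⟩ :=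
        zero_case hΩ hg hg0 hz₀ ⟨p, hp, hpz.1.symm, hpz.2.symm⟩
      obtain ⟨n, hn⟩ := exists_branchIndex r z₀
      exact ⟨U, _, hU, (h1 n hn).2⟩

/-- Local logarithms exist. -/
theorem exists_log (hΩ : IsAxSymDomain Ω) (hg : SR g Ω) (hg0 : ∀ q ∈ Ω, g q ≠ 0)
    (hz₀ : z₀ ∈ Ω) : ∃ U f, IsBasicNhd U z₀ Ω ∧ SR f U ∧ StarExpEq f g U := by
  by_cases h : SRR g Ω → z₀ ∈ realAxis → g z₀ ∈ posRay
  · obtain ⟨U, f, h1, h2, h3⟩ := exists_log_mem_class hΩ hg hg0 hz₀ h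
    exact ⟨U, f, h1, h2.1, h3⟩
  · push Not at h
    obtain ⟨hgR, hz, hpos⟩ := h
    obtain ⟨U, hU, -, h1⟩ := slicePreserving_real_neg hΩ hgR hz₀
      (hgR.mem_negRay_of_not_mem_posRay hΩ.2.2 hz₀ (hg0 z₀ hz₀) hz hpos)
    obtain ⟨w, hw, hw1⟩ := exists_SRV_one hU.1.1.2.2
    obtain ⟨h2, h3⟩ := h1 U w hU.1.1 subset_rfl hw hw1 0
    exact ⟨U, _, hU, h2.1, h3⟩

/-- By the convention for the class [0], a logarithm in the class of a slice preserving g is itself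
slice preserving, so positivity on the real axis applies. -/
theorem mem_posRay_of_log_mem_class (hU : IsAxSymDomain U) (hz₀ : z₀ ∈ U) (hf : SRClass f g U)
    (H : StarExpEq f g U) (hg : SRR g U) (hz : z₀ ∈ realAxis) : g z₀ ∈ posRay := by
  have hs := hU.2.2
  have h := (hf.1.sRR_iff_vecPart hs).2 (hf.2.1 ((hg.1.sRR_iff_vecPart hs).1 hg))
  obtain ⟨k, hk, -⟩ := (SRR_iff hs).1 hg
  exact mem_posRay_of_starExpEq hs hk h H hz₀ hz

end Existence

end StarLog

/-! ### The main theorem, assembled from the cases -/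

theorem mainTheorem4 (Ω : Set ℍ[ℝ]) (hΩ : IsBasicDomain Ω) (g : ℍ[ℝ] → ℍ[ℝ]) (hg : SR g Ω)
    (hg0 : ∀ q ∈ Ω, g q ≠ 0) (z₀ : ℍ[ℝ]) (hz₀ : z₀ ∈ Ω) :
    -- a local logarithm always exists
    (∃ U f, IsBasicNhd U z₀ Ω ∧ SR f U ∧ StarExpEq f g U) ∧
    -- a local logarithm in the vectorial class of `g` exists if and only if it is not the case
    -- that `g` is slice preserving, `z₀` is real and `g z₀ < 0`
    ((∃ U f, IsBasicNhd U z₀ Ω ∧ SRClass f g U ∧ StarExpEq f g U) ↔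
      (SRR g Ω → z₀ ∈ realAxis → g z₀ ∈ posRay)) ∧
    -- Case 1: `g` is slice preserving
    (SRR g Ω →
      (∀ U f, IsAxSymDomain U → U ⊆ Ω → SRR f U → StarExpEq f g U →
        ∀ x ∈ U ∩ realAxis, g x ∈ posRay) ∧
      (z₀ ∉ realAxis → ∃ U, IsBasicNhd U z₀ Ω ∧ Disjoint U realAxis ∧
        (∀ n, BranchIndex g z₀ n → BranchDefined n g U ∧
          SRR (logBranch n g) U ∧ StarExpEq (logBranch n g) g U) ∧
        (∀ f, SRR f U → StarExpEq f g U →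
          ∃ n, BranchIndex g z₀ n ∧ Set.EqOn f (logBranch n g) U)) ∧
      (z₀ ∈ realAxis → g z₀ ∈ posRay → ∃ U, IsBasicNhd U z₀ Ω ∧
        (∀ q ∈ U, g q ∉ nonposRay) ∧
        SRR (fun q => qlog (g q)) U ∧ StarExpEq (fun q => qlog (g q)) g U ∧
        (∀ f, SRR f U → StarExpEq f g U → Set.EqOn f (fun q => qlog (g q)) U)) ∧
      (z₀ ∈ realAxis → g z₀ ∈ negRay → ∃ U, IsBasicNhd U z₀ Ω ∧
        (∀ q ∈ U, -g q ∉ nonposRay) ∧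
        (∀ V w, IsAxSymDomain V → V ⊆ U → SRV w V → (∀ q ∈ V, symmetrization w q = 1) → ∀ n : ℤ,
          SRClass (fun q => qlog (-g q) + ((2 * (n : ℝ) + 1) * Real.pi) • w q) w V ∧
          StarExpEq (fun q => qlog (-g q) + ((2 * (n : ℝ) + 1) * Real.pi) • w q) g V))) ∧
    -- Case 2: `g_v` is not identically zero, but `g_v^s` is
    ((∃ q ∈ Ω, vecPart g q ≠ 0) → (∀ q ∈ Ω, symmetrization (vecPart g) q = 0) →
      Disjoint Ω realAxis ∧ (∀ q ∈ Ω, scalarPart g q ≠ 0) ∧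
      ∃ U, IsBasicNhd U z₀ Ω ∧
        (∀ n, BranchIndex (scalarPart g) z₀ n → BranchDefined n (scalarPart g) U ∧
          SRClass (fun q => logBranch n (scalarPart g) q + (scalarPart g q)⁻¹ * vecPart g q) g U ∧
          StarExpEq (fun q => logBranch n (scalarPart g) q + (scalarPart g q)⁻¹ * vecPart g q)
            g U) ∧
        (∀ f, SR f U → StarExpEq f g U → ∃ n, BranchIndex (scalarPart g) z₀ n ∧
          Set.EqOn f
            (fun q => logBranch n (scalarPart g) q + (scalarPart g q)⁻¹ * vecPart g q) U)) ∧
    -- Case 3: `g_v` is not identically zero and its class has no zero on the sphere of `z₀`;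
    -- here `r = √(g^s)`, `s = √(g_v^s)`, `w = g_v / √(g_v^s)` and `φ = √(f_v^s)`
    ((∃ q ∈ Ω, vecPart g q ≠ 0) → Disjoint (classZeros g Ω) (sphereThrough z₀) →
      ∃ U r s φ w, IsBasicNhd U z₀ Ω ∧ (z₀ ∉ realAxis → Disjoint U realAxis) ∧
        SRR r U ∧ SRR s U ∧ SRR φ U ∧ SRV w U ∧
        (∀ q ∈ U, r q ≠ 0 ∧ r q ^ 2 = symmetrization g q ∧ s q ^ 2 = symmetrization (vecPart g) q ∧
          symmetrization w q = 1 ∧ vecPart g q = s q * w q ∧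
          qcos (φ q) = (r q)⁻¹ * scalarPart g q ∧ qsin (φ q) = (r q)⁻¹ * s q) ∧
        (z₀ ∈ realAxis →
          (∀ x ∈ U ∩ realAxis, r x ∈ posRay) ∧ (∀ q ∈ U, r q ∉ nonposRay) ∧
          ∀ n : ℤ,
            SRClass (fun q => qlog (r q) + (φ q + ((2 * (n : ℝ) * Real.pi : ℝ) : ℍ[ℝ])) * w q)
              g U ∧
            StarExpEq (fun q => qlog (r q) + (φ q + ((2 * (n : ℝ) * Real.pi : ℝ) : ℍ[ℝ])) * w q)
              g U) ∧
        (z₀ ∉ realAxis → ∀ k, BranchIndex r z₀ k → BranchDefined k r U ∧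
          ∀ m n : ℤ, Even (m + n) →
            SRClass (fun q => logBranch k r q + ((m : ℝ) * Real.pi) • imUnit q
              + (φ q + (((n : ℝ) * Real.pi : ℝ) : ℍ[ℝ])) * w q) g U ∧
            StarExpEq (fun q => logBranch k r q + ((m : ℝ) * Real.pi) • imUnit q
              + (φ q + (((n : ℝ) * Real.pi : ℝ) : ℍ[ℝ])) * w q) g U)) ∧
    -- Case 4: `z₀` lies on the sphere of a zero of the class of `g_v`;
    -- here `ρ = √(1 + g_v^s / g₀²)`, so that `√(g^s) = g₀ ρ`, and `F = μ⁻¹(1 / ρ) = f_v^s`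
    ((∃ p ∈ classZeros g Ω, z₀ ∈ sphereThrough p) →
      z₀ ∉ realAxis ∧
      ∃ U, IsBasicNhd U z₀ Ω ∧ Disjoint U realAxis ∧
        (∀ q ∈ U, scalarPart g q ≠ 0) ∧
        (∀ q ∈ U, 1 + symmetrization (vecPart g) q * (scalarPart g q ^ 2)⁻¹ ∉ nonposRay) ∧
        ∃ ρ r F : ℍ[ℝ] → ℍ[ℝ],
          (∀ q, ρ q = qsqrt (1 + symmetrization (vecPart g) q * (scalarPart g q ^ 2)⁻¹)) ∧
          (∀ q, r q = scalarPart g q * ρ q) ∧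
          (∀ q, F q = muInv (ρ q)⁻¹) ∧
          SRR r U ∧ SRR F U ∧
          (∀ q ∈ U, r q ≠ 0 ∧ r q ^ 2 = symmetrization g q ∧
            F q ∈ muDom ∧ qmu (F q) = (r q)⁻¹ * scalarPart g q ∧ qnu (F q) ≠ 0) ∧
          (∀ q ∈ sphereThrough z₀, r q = scalarPart g q ∧ F q = 0) ∧
          ∀ n, BranchIndex r z₀ n → BranchDefined n r U ∧
            SRClass (fun q => logBranch n r q + (qnu (F q) * r q)⁻¹ * vecPart g q) g U ∧
            StarExpEq (fun q => logBranch n r q + (qnu (F q) * r q)⁻¹ * vecPart g q) g U) := by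
  have hd := hΩ.1
  refine ⟨exists_log hd hg hg0 hz₀, ⟨?_, exists_log_mem_class hd hg hg0 hz₀⟩,
    fun hgR => ⟨fun U f hU hUΩ hf H x hx => ?_, slicePreserving_nonreal hd hgR hg0 hz₀,
      slicePreserving_real_pos hd hgR hz₀, fun _ => slicePreserving_real_neg hd hgR hz₀⟩,
    isotropic_case hd hg hg0 hz₀, polar_case hd hg hg0 hz₀, zero_case hd hg hg0 hz₀⟩
  · rintro ⟨U, f, hU, hf, H⟩ hgR hz
    exact mem_posRay_of_log_mem_class hU.1.1 hU.2.1 hf H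
      (hgR.mono hU.1.1.2.2 hd.2.2 hU.2.2) hz
  · obtain ⟨k, hk, -⟩ := (SRR_iff hU.2.2).1 (hgR.mono hU.2.2 hd.2.2 hUΩ)
    exact mem_posRay_of_starExpEq hU.2.2 hk hf H hx.1 hx.2
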